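/- **Proposition 2.6 (A priori energy estimates).** Let $U\subset\mathbb R^2$ be a bounded $C^2$ domain, let $\varepsilon,\eta,T>0$, let $g\in L^2(U)$ and $u_0,z_0\in H^1(U)$. Let $\phi:\mathbb R\to\mathbb R$ be a nondecreasing $C^\infty$ function with $\phi(s)=-1$ for $s\le -1$, $\phi(s)=s$ for $0<s<1$ and $\phi(s)=2$ for $s\ge 2$, and put $$AT(u,z)=\frac12\int_U\big[(\eta+\phi(z)^2)|\nabla u|^2+(u-g)^2\big]\,dx+\int_U\Big[\frac{(1-z)^2}{4\varepsilon}+\varepsilon|\nabla z|^2\Big]\,dx .$$ Let $(e_i)_{i\in\mathbb N}$ be an orthogonal basis of $H^1(U)$ made of eigenfunctions of $-\Delta$ with homogeneous Neumann boundary conditions (that is, $\int_U\nabla e_i\cdot\nabla\psi\,dx=\lambda_i\int_U e_i\psi\,dx$ for all $\psi\in H^1(U)$), with $\|e_i\|_{L^2(U)}=1$. Let $V_N$ be the span of the first $N$ of them and $\pi_N$ the $L^2(U)$-orthogonal projection on $V_N$. For $u,z\in V_N$ let $\pi_N[\nabla AT(u,z)]\in V_N\times V_N$ be the $[L^2(U)]^2$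 gradient of $AT$ projected on $V_N\times V_N$: its two components have, as $i$-th coefficients with respect to $(e_i)$, the derivatives of $AT$ at $(u,z)$ in the directions $(e_i,0)$ and $(0,e_i)$. Then there is a constant $C$, independent of $N$, such that the following holds for every $N$ and every pair $u_N(t)=\sum_i a_i(t)e_i$, $z_N(t)=\sum_i b_i(t)e_i$ with values in $V_N$ that solves the Galerkin system on $[0,T]$, that is, $u_N(0)=\pi_N u_0$, $z_N(0)=\pi_N z_0$ and, for all $t\in[0,T]$ and all $e_i\in V_N$, $$a_i'=-\int_U(\eta+\phi(z_N)^2)\nabla u_N\cdot\nabla e_i\,dx-\int_U(u_N-\pi_N g)\,e_i\,dx,$$ $$b_i'=-2\varepsilon\int_U\nabla z_N\cdot\nabla e_i\,dx-\int_U\phi'(z_N)\phi(z_N)|\nabla u_N|^2e_i\,dx+\int_U\frac{1-z_N}{2\varepsilon}\,e_i\,dx .$$ 1. *(Gradient)* For every $t\in[0,T]$ and all $v,w\in V_N$, the function $s\mapsto AT(u_N(t)+sv,z_N(t)+sw)$ is differentiable at $s=0$, with derivative $\langle \pi_N[\nabla AT(u_N(t),z_N(t))],(v,w)\rangle_{[L^2(U)]^2}$.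 2. *(Energy identity)* For every $t\in[0,T]$, $$\frac{d}{dt}AT(u_N(t),z_N(t))=-\|\pi_N[\nabla AT(u_N(t),z_N(t))]\|_{[L^2(U)]^2}^2=-\|\partial_tu_N(t)\|_{L^2(U)}^2-\|\partial_tz_N(t)\|_{L^2(U)}^2,$$ $$AT(u_N(t),z_N(t))+\int_0^t\big(\|\partial_tu_N(s)\|_{L^2(U)}^2+\|\partial_tz_N(s)\|_{L^2(U)}^2\big)\,ds=AT(\pi_Nu_0,\pi_Nz_0).$$ 3. *(A priori bound)* The supremum below is finite and $$\sup_{t\in[0,T]}AT(u_N(t),z_N(t))+\int_0^T\big(\|\partial_tu_N\|_{L^2(U)}^2+\|\partial_tz_N\|_{L^2(U)}^2\big)\,dt$$ $$=\sup_{t\in[0,T]}AT(u_N(t),z_N(t))+\int_0^T\|\pi_N[\nabla AT(u_N,z_N)]\|_{[L^2(U)]^2}^2\,dt\le C .$$ 4. *(Uniform bounds in $L^\infty(0,T;H^1(U))$ and $H^1(0,T;L^2(U))$)* For every $t\in[0,T]$, $u_N(t),z_N(t)\in H^1(U)$ with $\|u_N(t)\|_{H^1(U)}^2\le C$ and $\|z_N(t)\|_{H^1(U)}^2\le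 C$; moreover $\int_0^T(\|u_N\|_{L^2(U)}^2+\|\partial_tu_N\|_{L^2(U)}^2)\,dt\le C$ and $\int_0^T(\|z_N\|_{L^2(U)}^2+\|\partial_tz_N\|_{L^2(U)}^2)\,dt\le C$. All the time integrals are integrals of integrable functions. -/

import Mathlib

open MeasureTheory Set Filter Topology
open scoped ContDiff

noncomputable section

namespace AmbrosioTortorelli

/-- The Euclidean plane. -/
abbrev Plane := EuclideanSpace ℝ (Fin 2)

/-- A bounded `C²` domain of the plane: an open, connected, bounded set which, near each of its
boundary points and up to a linear isometry, is the region above the graph of a `C²` function. -/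
structure IsC2Domain (U : Set Plane) : Prop where
  isOpen : IsOpen U
  isConnected : IsConnected U
  isBounded : Bornology.IsBounded U
  boundary : ∀ p ∈ frontier U, ∃ r > 0, ∃ (R : Plane ≃ₗᵢ[ℝ] Plane) (γ : ℝ → ℝ),
    ContDiff ℝ 2 γ ∧ ∀ x ∈ Metric.ball p r, x ∈ U ↔ γ (R x 0) < R x 1

/-- `G` is the weak gradient of `f` in `U`: integration by parts against test functions. -/
def IsWeakGrad (U : Set Plane) (f : Plane → ℝ) (G : Plane → Plane) : Prop :=
  ∀ ψ : Plane → ℝ, ContDiff ℝ ∞ ψ → HasCompactSupport ψ → tsupport ψ ⊆ U →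
    ∀ v : Plane, ∫ x in U, f x * fderiv ℝ ψ x v = - ∫ x in U, inner ℝ (G x) v * ψ x

/-- `f ∈ H¹(U)`: `f` is square integrable on `U`, with a square integrable weak gradient. -/
def MemH1 (U : Set Plane) (f : Plane → ℝ) : Prop :=
  MemLp f 2 (volume.restrict U) ∧
    ∃ G : Plane → Plane, MemLp G 2 (volume.restrict U) ∧ IsWeakGrad U f G

open Classical in
/-- The weak gradient of `f ∈ H¹(U)` (unique up to null sets; the value is `0` when
`f` is not in `H¹(U)`). -/
def weakGrad (U : Set Plane) (f : Plane → ℝ) : Plane → Plane :=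
  if h : MemH1 U f then h.2.choose else 0

/-- The `L²(U)` inner product. -/
def l2Inner (U : Set Plane) (f h : Plane → ℝ) : ℝ := ∫ x in U, f x * h x

/-- The squared `L²(U)` norm. -/
def l2NormSq (U : Set Plane) (f : Plane → ℝ) : ℝ := ∫ x in U, f x ^ 2

/-- The Dirichlet form `∫_U ∇f · ∇h`. -/
def dirichletForm (U : Set Plane) (f h : Plane → ℝ) : ℝ :=
  ∫ x in U, inner ℝ (weakGrad U f x) (weakGrad U h x)

/-- The `H¹(U)` inner product. -/
def h1Inner (U : Set Plane) (f h : Plane → ℝ) : ℝ := l2Inner U f h + dirichletForm U f h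

/-- The squared `H¹(U)` norm. -/
def h1NormSq (U : Set Plane) (f : Plane → ℝ) : ℝ :=
  l2NormSq U f + ∫ x in U, ‖weakGrad U f x‖ ^ 2

/-- The function `∑_{i < N} c_i e_i`. For an orthonormal system `e`, these are the elements of
`V_N = span {e_0, …, e_{N-1}}`. -/
def comb (e : ℕ → Plane → ℝ) (N : ℕ) (c : Fin N → ℝ) : Plane → ℝ :=
  fun x => ∑ i : Fin N, c i * e i x

/-- `e_i`, `i ∈ ℕ`, is an orthogonal basis of `H¹(U)` made of eigenfunctions of `-Δ` with
homogeneous Neumann boundary conditions (`-Δ e_i = lam_i e_i` in `U`, `∂_n e_i = 0` on `∂U`, in the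
weak formulation), normalized in `L²(U)`. -/
structure IsNeumannEigenbasis (U : Set Plane) (e : ℕ → Plane → ℝ) (lam : ℕ → ℝ) : Prop where
  memH1 : ∀ i, MemH1 U (e i)
  eigen : ∀ i, ∀ ψ, MemH1 U ψ → dirichletForm U (e i) ψ = lam i * l2Inner U (e i) ψ
  normalized : ∀ i, l2NormSq U (e i) = 1
  orthogonal : ∀ i j, i ≠ j → h1Inner U (e i) (e j) = 0
  complete : ∀ f, MemH1 U f → ∀ δ > 0, ∃ (N : ℕ) (c : Fin N → ℝ),
    h1NormSq U (f - comb e N c) < δ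

/-- The `L²(U)`-orthogonal projection `π_N f = ∑_{i < N} ⟨f, e_i⟩ e_i` on `V_N`. -/
def proj (U : Set Plane) (e : ℕ → Plane → ℝ) (N : ℕ) (f : Plane → ℝ) : Plane → ℝ :=
  comb e N fun i => l2Inner U f (e i)

/-- A nondecreasing smooth cutoff with `φ(s) = -1` for `s ≤ -1`, `φ(s) = s` for `0 < s < 1`,
`φ(s) = 2` for `s ≥ 2`. -/
structure IsCutoff (φ : ℝ → ℝ) : Prop where
  smooth : ContDiff ℝ ∞ φ
  monotone : Monotone φ
  eq_neg_one : ∀ s ≤ -1, φ s = -1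
  eq_self : ∀ s, 0 < s → s < 1 → φ s = s
  eq_two : ∀ s, 2 ≤ s → φ s = 2

/-- The (modified) Ambrosio–Tortorelli functional. -/
def AT (U : Set Plane) (ε η : ℝ) (φ : ℝ → ℝ) (g : Plane → ℝ) (u z : Plane → ℝ) : ℝ :=
  1 / 2 * (∫ x in U, ((η + φ (z x) ^ 2) * ‖weakGrad U u x‖ ^ 2 + (u x - g x) ^ 2))
    + (∫ x in U, ((1 - z x) ^ 2 / (4 * ε) + ε * ‖weakGrad U z x‖ ^ 2))

/-- First component of `π_N[∇ F(u, z)]`, the `L²` gradient of `F` projected on `V_N × V_N`. Its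
`i`-th coordinate is the derivative of `F` in the direction `(e_i, 0)`. -/
def projGradFst (e : ℕ → Plane → ℝ) (N : ℕ) (F : (Plane → ℝ) → (Plane → ℝ) → ℝ)
    (u z : Plane → ℝ) : Plane → ℝ :=
  comb e N fun i => deriv (fun s : ℝ => F (u + s • e i) z) 0

/-- Second component of `π_N[∇ F(u, z)]`. Its `i`-th coordinate is the derivative of `F` in the
direction `(0, e_i)`. -/
def projGradSnd (e : ℕ → Plane → ℝ) (N : ℕ) (F : (Plane → ℝ) → (Plane → ℝ) → ℝ)
    (u z : Plane → ℝ) : Plane → ℝ :=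
  comb e N fun i => deriv (fun s : ℝ => F u (z + s • e i)) 0

/-- `‖π_N[∇ F(u, z)]‖²` in `[L²(U)]²`. -/
def projGradNormSq (U : Set Plane) (e : ℕ → Plane → ℝ) (N : ℕ)
    (F : (Plane → ℝ) → (Plane → ℝ) → ℝ) (u z : Plane → ℝ) : ℝ :=
  l2NormSq U (projGradFst e N F u z) + l2NormSq U (projGradSnd e N F u z)

/-- For `w(t) = ∑_{i < N} a_i(t) e_i` with `t ∈ [0, T]`, the time derivative
`∂_t w(t) = ∑_{i < N} a_i'(t) e_i` (one-sided at the endpoints). -/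
def timeDeriv (e : ℕ → Plane → ℝ) (N : ℕ) (T : ℝ) (a : ℝ → Fin N → ℝ) (t : ℝ) : Plane → ℝ :=
  comb e N fun i => derivWithin (fun s => a s i) (Icc 0 T) t

/-- `u_N(t) = ∑ a_i(t) e_i`, `z_N(t) = ∑ b_i(t) e_i` solve on `[0, T]` the Galerkin system
`∂_t u_N = π_N[div((η + φ(z_N)²)∇u_N)] - (u_N - π_N g)`,
`∂_t z_N = 2ε Δz_N - π_N[φ'(z_N) φ(z_N) |∇u_N|²] + π_N[(1 - z_N) / (2ε)]`
with homogeneous Neumann conditions and initial data `π_N u₀`, `π_N z₀`. The equations are tested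
with `e_i`, which gives the ordinary differential equations for `a_i`, `b_i`. -/
structure IsGalerkinSolution (U : Set Plane) (ε η : ℝ) (φ : ℝ → ℝ) (g u₀ z₀ : Plane → ℝ)
    (e : ℕ → Plane → ℝ) (T : ℝ) (N : ℕ) (a b : ℝ → Fin N → ℝ) : Prop where
  init_u : comb e N (a 0) = proj U e N u₀
  init_z : comb e N (b 0) = proj U e N z₀
  eq_u : ∀ t ∈ Icc 0 T, ∀ i, HasDerivWithinAt (fun s => a s i)
    (- (∫ x in U, (η + φ (comb e N (b t) x) ^ 2) *
          inner ℝ (weakGrad U (comb e N (a t)) x) (weakGrad U (e i) x))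
      - ∫ x in U, (comb e N (a t) x - proj U e N g x) * e i x) (Icc 0 T) t
  eq_z : ∀ t ∈ Icc 0 T, ∀ i, HasDerivWithinAt (fun s => b s i)
    (- (2 * ε * dirichletForm U (comb e N (b t)) (e i))
      - (∫ x in U, deriv φ (comb e N (b t) x) * φ (comb e N (b t) x) *
          ‖weakGrad U (comb e N (a t)) x‖ ^ 2 * e i x)
      + ∫ x in U, (1 - comb e N (b t) x) / (2 * ε) * e i x) (Icc 0 T) t

end AmbrosioTortorelli

end

open AmbrosioTortorelli

/-! In `L²`-orthonormal coordinates the Galerkin system is the gradient flow of the energy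
restricted to `V_N × V_N`: `a_i'` and `b_i'` are minus the partial derivatives of `AT`. Replacing
`g` by `π_N g` changes nothing, because the equation is tested only with elements of `V_N`. The
chain rule gives `dE/dt = -|∇E|² = -|a'|² - |b'|²`, and integrating in time gives the energy
identity; in particular the energy is largest at `t = 0`. The initial energy is bounded
independently of `N` because `π_N` decreases both the `L²` norm and the Dirichlet form (Bessel), and
the energy controls both `H¹` norms since `η, ε > 0`.

The one analytic difficulty is that `AT` must be differentiable on `V_N × V_N`. The derivative in
`z` contains `φ'(z) φ(z) |∇u|² e_k`, which is not integrable merely because the `e_i` lie in `H¹`.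
It is enough to know `e_k |∇e_i| ∈ L²`, and this is obtained without boundary regularity theory, in
three steps. (i) `H¹(U) ⊂ L⁴(U)` (`memLp_four`). Near each point of its closure, `U` contains
translates of a fixed truncated cone. Averages of `f` over such cones at two scales differ by at
most a truncated Riesz potential of `|∇f|`, which lies in `L⁴` in the plane. (ii) If `-Δu = h`
weakly with Neumann conditions and `u, h ∈ L⁴`, testing with a truncation of `u³` gives `u² |∇u|² ∈
L¹` (`integrableOn_sq_mul_norm_weakGrad_sq`). The test function is admissible by the chain rule for
weak gradients. (iii) Linear combinations of eigenfunctions solve such equations, so the estimate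
polarizes to `e_k² |∇e_i|² ∈ L¹`. Dominated convergence then allows differentiation under the
integral sign (`hasFDerivAt_integral_density`). -/

namespace AmbrosioTortorelli

/-! ### Estimates for Riesz-type potentials. -/

section

open scoped ENNReal

theorem lintegral_mul_sq_le {α : Type*} [MeasurableSpace α] {μ : Measure α} {f g : α → ℝ≥0∞}
    (hf : AEMeasurable f μ) (hg : AEMeasurable g μ) :
    (∫⁻ a, f a * g a ∂μ) ^ 2 ≤ (∫⁻ a, f a ^ 2 ∂μ) * ∫⁻ a, g a ^ 2 ∂μ := by
  have h := ENNReal.lintegral_mul_le_Lp_mul_Lq μ Real.HolderConjugate.two_two hf hg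
  have h2 := pow_le_pow_left' h 2
  rw [mul_pow] at h2
  simp only [Pi.mul_apply, ← ENNReal.rpow_natCast, ← ENNReal.rpow_mul] at h2
  norm_num at h2
  exact_mod_cast h2

/-- Potential estimate behind the embedding of `H¹` into `L⁴` in the plane. -/
theorem lintegral_potential_pow_four_le {E : Type*} [NormedAddCommGroup E] [NormedSpace ℝ E]
    [MeasurableSpace E] [BorelSpace E] [FiniteDimensional ℝ E] {μ : Measure E} [μ.IsAddHaarMeasure]
    {F j : E → ℝ≥0∞} (hF : Measurable F) (hj : Measurable j) :
    ∫⁻ x, (∫⁻ y, F y * j (y - x) ^ 4 ∂μ) ^ 4 ∂μ ≤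
      (∫⁻ y, j y ^ 6 ∂μ) ^ 2 * (∫⁻ y, F y ^ 2 ∂μ) * ((∫⁻ y, F y ^ 2 ∂μ) * ∫⁻ y, j y ^ 4 ∂μ) := by
  -- Cauchy–Schwarz twice, with the splittings `F j⁴ = (F j) · j³` and `(F j)² = F · (F j²)`. For `j
  -- = |y|^(-1/4)` only `j⁶` and `j⁴` occur, both locally integrable in the plane, whereas the
  -- square `j⁸ = |y|⁻²` of the kernel is not.
  have key : ∀ x, (∫⁻ y, F y * j (y - x) ^ 4 ∂μ) ^ 4 ≤
      (∫⁻ y, j y ^ 6 ∂μ) ^ 2 * (∫⁻ y, F y ^ 2 ∂μ) * ∫⁻ y, F y ^ 2 * j (y - x) ^ 4 ∂μ := by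
    intro x
    have hjx : Measurable fun y => j (y - x) := hj.comp (measurable_id.sub_const x)
    have h1 := lintegral_mul_sq_le (μ := μ) (f := fun y => F y * j (y - x))
      (g := fun y => j (y - x) ^ 3) (by fun_prop) (by fun_prop)
    have h2 := lintegral_mul_sq_le (μ := μ) (f := F)
      (g := fun y => F y * j (y - x) ^ 2) (by fun_prop) (by fun_prop)
    have e6 : ∫⁻ y, j (y - x) ^ 6 ∂μ = ∫⁻ y, j y ^ 6 ∂μ :=
      lintegral_sub_right_eq_self (fun y => j y ^ 6) x
    have r1 : ∀ y, F y * j (y - x) * j (y - x) ^ 3 = F y * j (y - x) ^ 4 := fun y => by ring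
    have r2 : ∀ y, (F y * j (y - x)) ^ 2 = F y * (F y * j (y - x) ^ 2) := fun y => by ring
    have r3 : ∀ y, (j (y - x) ^ 3) ^ 2 = j (y - x) ^ 6 := fun y => by ring
    have r4 : ∀ y, (F y * j (y - x) ^ 2) ^ 2 = F y ^ 2 * j (y - x) ^ 4 := fun y => by ring
    simp only [r1, r2, r3, r4] at h1 h2
    rw [e6] at h1
    calc (∫⁻ y, F y * j (y - x) ^ 4 ∂μ) ^ 4 = ((∫⁻ y, F y * j (y - x) ^ 4 ∂μ) ^ 2) ^ 2 := by ring
      _ ≤ ((∫⁻ y, F y * (F y * j (y - x) ^ 2) ∂μ) * ∫⁻ y, j y ^ 6 ∂μ) ^ 2 := by gcongr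
      _ = (∫⁻ y, j y ^ 6 ∂μ) ^ 2 * (∫⁻ y, F y * (F y * j (y - x) ^ 2) ∂μ) ^ 2 := by ring
      _ ≤ (∫⁻ y, j y ^ 6 ∂μ) ^ 2 *
          ((∫⁻ y, F y ^ 2 ∂μ) * ∫⁻ y, F y ^ 2 * j (y - x) ^ 4 ∂μ) := by gcongr
      _ = _ := by ring
  calc ∫⁻ x, (∫⁻ y, F y * j (y - x) ^ 4 ∂μ) ^ 4 ∂μ
      ≤ ∫⁻ x, (∫⁻ y, j y ^ 6 ∂μ) ^ 2 * (∫⁻ y, F y ^ 2 ∂μ) *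
          ∫⁻ y, F y ^ 2 * j (y - x) ^ 4 ∂μ ∂μ := lintegral_mono key
    _ = (∫⁻ y, j y ^ 6 ∂μ) ^ 2 * (∫⁻ y, F y ^ 2 ∂μ) *
          ∫⁻ x, ∫⁻ y, F y ^ 2 * j (y - x) ^ 4 ∂μ ∂μ := by
        refine lintegral_const_mul _ ?_
        exact Measurable.lintegral_prod_right' (f := fun p : E × E => F p.2 ^ 2 * j (p.2 - p.1) ^ 4)
          (by fun_prop)
    _ = _ := by
        rw [lintegral_lintegral_swap]
        · congr 1
          rw [← lintegral_mul_const _ (by fun_prop)]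
          refine lintegral_congr fun y => ?_
          rw [lintegral_const_mul _ (by fun_prop)]
          congr 1
          exact lintegral_sub_left_eq_self (fun z => j z ^ 4) y
        · exact Measurable.aemeasurable
            (f := fun p : E × E => F p.2 ^ 2 * j (p.2 - p.1) ^ 4) (by fun_prop)

/-- In polar coordinates the integrand becomes `r ^ (d - 1 + s)`, integrable near `0` because `d + s
> 0`. -/
theorem lintegral_ball_norm_rpow_lt_top {E : Type*} [NormedAddCommGroup E] [NormedSpace ℝ E]
    [MeasurableSpace E] [BorelSpace E] [FiniteDimensional ℝ E] [Nontrivial E]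
    {μ : Measure E} [μ.IsAddHaarMeasure] {s : ℝ} (hs : -(Module.finrank ℝ E : ℝ) < s) {K : ℝ}
    (hK : 0 < K) :
    ∫⁻ y in Metric.ball (0 : E) K, ENNReal.ofReal (‖y‖ ^ s) ∂μ < ⊤ := by
  have h : IntegrableOn (fun y : E => ‖y‖ ^ s) (Metric.ball 0 K) μ := by
    rw [integrableOn_fun_norm_addHaar μ (f := fun r => r ^ s)]
    have h1 : IntegrableOn (fun r : ℝ => r ^ ((Module.finrank ℝ E : ℝ) - 1 + s)) (Ioo 0 K) :=
      (intervalIntegral.integrableOn_Ioo_rpow_iff hK).2 (by linarith)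
    refine h1.congr_fun (fun r hr => ?_) measurableSet_Ioo
    have : 0 < Module.finrank ℝ E := Module.finrank_pos
    simp only [smul_eq_mul]
    rw [Real.rpow_add hr.1, ← Real.rpow_natCast, Nat.cast_sub this, Nat.cast_one]
  exact h.lintegral_lt_top

end

/-! ### One-sided mollifiers supported in a cone. -/

section

open scoped ENNReal

/-- A smooth bump on the line, supported in `[-m, m]`. -/
noncomputable def slopeBump (m s : ℝ) : ℝ := Real.smoothTransition (1 - (s / m) ^ 2)

/-- A smooth function, equal to `1` on `(-∞, 1/2]` and to `0` on `[1, ∞)`. -/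
noncomputable def heightCutoff (s : ℝ) : ℝ := Real.smoothTransition (2 - 2 * s)

theorem contDiff_slopeBump (m : ℝ) : ContDiff ℝ ∞ (slopeBump m) := by
  unfold slopeBump
  exact Real.smoothTransition.contDiff.comp (by fun_prop)

theorem contDiff_heightCutoff : ContDiff ℝ ∞ heightCutoff := by
  unfold heightCutoff
  exact Real.smoothTransition.contDiff.comp (by fun_prop)

theorem slopeBump_nonneg (m s : ℝ) : 0 ≤ slopeBump m s := Real.smoothTransition.nonneg _

theorem slopeBump_le_one (m s : ℝ) : slopeBump m s ≤ 1 := Real.smoothTransition.le_one _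

theorem slopeBump_zero (m : ℝ) : slopeBump m 0 = 1 := by simp [slopeBump]

theorem abs_le_of_slopeBump_ne_zero {m s : ℝ} (hm : 0 < m) (h : slopeBump m s ≠ 0) : |s| ≤ m := by
  by_contra! hs
  refine h (Real.smoothTransition.zero_of_nonpos ?_)
  have : 1 ≤ |s / m| := by rw [abs_div, abs_of_pos hm, le_div_iff₀ hm]; linarith
  nlinarith [sq_abs (s / m)]

theorem heightCutoff_of_le {s : ℝ} (h : s ≤ 1 / 2) : heightCutoff s = 1 :=
  Real.smoothTransition.one_of_one_le (by linarith)

theorem heightCutoff_of_ge {s : ℝ} (h : 1 ≤ s) : heightCutoff s = 0 :=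
  Real.smoothTransition.zero_of_nonpos (by linarith)

theorem heightCutoff_nonneg (s : ℝ) : 0 ≤ heightCutoff s := Real.smoothTransition.nonneg _

theorem heightCutoff_le_one (s : ℝ) : heightCutoff s ≤ 1 := Real.smoothTransition.le_one _

theorem antitone_heightCutoff : Antitone heightCutoff := fun a b h =>
  Real.smoothTransition.monotone (by linarith)

theorem deriv_heightCutoff_nonpos (s : ℝ) : deriv heightCutoff s ≤ 0 :=
  antitone_heightCutoff.deriv_nonpos

theorem continuous_deriv_heightCutoff : Continuous (deriv heightCutoff) :=
  contDiff_heightCutoff.continuous_deriv (by simp)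

theorem hasDerivAt_heightCutoff (s : ℝ) : HasDerivAt heightCutoff (deriv heightCutoff s) s :=
  (contDiff_heightCutoff.differentiable (by simp) s).hasDerivAt

theorem hasDerivAt_slopeBump (m s : ℝ) : HasDerivAt (slopeBump m) (deriv (slopeBump m) s) s :=
  ((contDiff_slopeBump m).differentiable (by simp) s).hasDerivAt

theorem mem_Icc_of_deriv_heightCutoff_ne_zero {s : ℝ} (h : deriv heightCutoff s ≠ 0) :
    s ∈ Icc (1 / 2 : ℝ) 1 := by
  by_contra hs
  apply h
  rw [mem_Icc, not_and_or, not_le, not_le] at hs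
  rcases hs with hs | hs
  · have : heightCutoff =ᶠ[𝓝 s] fun _ => 1 := by
      filter_upwards [Iio_mem_nhds hs] with a ha using heightCutoff_of_le (le_of_lt ha)
    rw [this.deriv_eq]; simp
  · have : heightCutoff =ᶠ[𝓝 s] fun _ => 0 := by
      filter_upwards [Ioi_mem_nhds hs] with a ha using heightCutoff_of_ge (le_of_lt ha)
    rw [this.deriv_eq]; simp

theorem exists_bound_deriv_heightCutoff : ∃ D > 0, ∀ s, |deriv heightCutoff s| ≤ D := by
  have hc : HasCompactSupport (deriv heightCutoff) :=
    HasCompactSupport.intro isCompact_Icc fun s hs => by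
      by_contra h; exact hs (mem_Icc_of_deriv_heightCutoff_ne_zero h)
  obtain ⟨D, hD⟩ := continuous_deriv_heightCutoff.bounded_above_of_compact_support hc
  exact ⟨max D 1, by positivity, fun s => (hD s).trans (le_max_left _ _)⟩

theorem exists_deriv_heightCutoff_neg : ∃ s ∈ Ioo (1 / 2 : ℝ) 1, deriv heightCutoff s < 0 := by
  obtain ⟨s, hs, h⟩ := exists_deriv_eq_slope heightCutoff (a := 1 / 2) (b := 1) (by norm_num)
    contDiff_heightCutoff.continuous.continuousOn
    ((contDiff_heightCutoff.differentiable (by simp)).differentiableOn)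
  refine ⟨s, hs, ?_⟩
  rw [h, heightCutoff_of_le le_rfl, heightCutoff_of_ge le_rfl]
  norm_num

/-- Linear coordinates on the plane, with the dual basis. -/
structure PlaneCoords where
  ℓ₀ : Plane →L[ℝ] ℝ
  ℓ₁ : Plane →L[ℝ] ℝ
  v₀ : Plane
  v₁ : Plane
  h₀₀ : ℓ₀ v₀ = 1
  h₀₁ : ℓ₀ v₁ = 0
  h₁₀ : ℓ₁ v₀ = 0
  h₁₁ : ℓ₁ v₁ = 1
  norm_le : ∀ y, ‖y‖ ≤ |ℓ₀ y| + |ℓ₁ y|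
  norm_v₀ : ‖v₀‖ ≤ 1
  norm_v₁ : ‖v₁‖ ≤ 1

namespace PlaneCoords

variable (L : PlaneCoords)

/-- Radial weight of the vector field joining two mollifiers of the cone. -/
noncomputable def weight (m τ h : ℝ) (y : Plane) : ℝ :=
  slopeBump m (L.ℓ₀ y / L.ℓ₁ y) *
    ((heightCutoff (L.ℓ₁ y / h) - heightCutoff (L.ℓ₁ y / τ)) / L.ℓ₁ y ^ 2)

/-- One-sided mollifier, supported in the cone `|ℓ₀| ≤ m ℓ₁` at height `τ`. -/
noncomputable def mollifier (m τ : ℝ) (y : Plane) : ℝ :=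
  -slopeBump m (L.ℓ₀ y / L.ℓ₁ y) * (deriv heightCutoff (L.ℓ₁ y / τ) / (τ * L.ℓ₁ y))

/-- Truncated cone. -/
def cone (m h : ℝ) : Set Plane := {y | 0 < L.ℓ₁ y ∧ L.ℓ₁ y ≤ h ∧ |L.ℓ₀ y| ≤ m * L.ℓ₁ y}

variable {L} {m τ h : ℝ}

theorem norm_le_of_mem_cone {y : Plane} (hy : y ∈ L.cone m h) : ‖y‖ ≤ (1 + m) * L.ℓ₁ y := by
  have := L.norm_le y
  rw [abs_of_pos hy.1] at this
  linarith [hy.2.2]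

theorem cone_subset (hm : 0 < m) : L.cone m h ⊆ Metric.closedBall 0 ((1 + m) * h) := by
  intro y hy
  rw [mem_closedBall_zero_iff]
  refine (norm_le_of_mem_cone hy).trans ?_
  have := hy.2.1
  gcongr

theorem abs_le_of_div (hm : 0 < m) {y : Plane} (hy : 0 < L.ℓ₁ y)
    (h : slopeBump m (L.ℓ₀ y / L.ℓ₁ y) ≠ 0) : |L.ℓ₀ y| ≤ m * L.ℓ₁ y := by
  have := abs_le_of_slopeBump_ne_zero hm h
  rwa [abs_div, abs_of_pos hy, div_le_iff₀ hy] at this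

theorem weight_eq_zero_of_le (hτ : 0 < τ) (hτh : τ ≤ h) {y : Plane} (hy : L.ℓ₁ y ≤ τ / 2) :
    L.weight m τ h y = 0 := by
  have h1 : L.ℓ₁ y / τ ≤ 1 / 2 := by rw [div_le_iff₀ hτ]; linarith
  have h2 : L.ℓ₁ y / h ≤ 1 / 2 := by rw [div_le_iff₀ (by linarith)]; linarith
  simp [weight, heightCutoff_of_le h1, heightCutoff_of_le h2]

theorem weight_support (hm : 0 < m) (hτ : 0 < τ) (hτh : τ ≤ h) {y : Plane}
    (hy : L.weight m τ h y ≠ 0) : y ∈ L.cone m h ∧ τ / 2 ≤ L.ℓ₁ y := by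
  have h1 : τ / 2 < L.ℓ₁ y := by
    by_contra! hle; exact hy (weight_eq_zero_of_le hτ hτh hle)
  have h0 : 0 < L.ℓ₁ y := by linarith
  refine ⟨⟨h0, ?_, abs_le_of_div hm h0 fun hz => hy (by simp [weight, hz])⟩, h1.le⟩
  by_contra! hlt
  refine hy ?_
  have h1 : 1 ≤ L.ℓ₁ y / τ := by rw [le_div_iff₀ hτ]; linarith
  have h2 : 1 ≤ L.ℓ₁ y / h := by rw [le_div_iff₀ (by linarith)]; linarith
  simp [weight, heightCutoff_of_ge h1, heightCutoff_of_ge h2]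

theorem abs_weight_le (y : Plane) :
    |L.weight m τ h y| ≤ (L.ℓ₁ y ^ 2)⁻¹ := by
  unfold weight
  rw [abs_mul, abs_of_nonneg (slopeBump_nonneg _ _), abs_div, abs_of_nonneg (sq_nonneg (L.ℓ₁ y)),
    ← one_div, ← one_mul (1 / _)]
  have : |heightCutoff (L.ℓ₁ y / h) - heightCutoff (L.ℓ₁ y / τ)| ≤ 1 := by
    rw [abs_le]
    constructor <;> linarith [heightCutoff_nonneg (L.ℓ₁ y / h), heightCutoff_nonneg (L.ℓ₁ y / τ),
      heightCutoff_le_one (L.ℓ₁ y / h), heightCutoff_le_one (L.ℓ₁ y / τ)]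
  gcongr
  exact slopeBump_le_one _ _

theorem contDiff_weight (hτ : 0 < τ) (hτh : τ ≤ h) : ContDiff ℝ ∞ (L.weight m τ h) := by
  rw [contDiff_iff_contDiffAt]
  intro y
  by_cases hy : 0 < L.ℓ₁ y
  · have h0 : ContDiffAt ℝ ∞ (fun y => L.ℓ₀ y / L.ℓ₁ y) y :=
      L.ℓ₀.contDiff.contDiffAt.div L.ℓ₁.contDiff.contDiffAt hy.ne'
    have h1 : ContDiffAt ℝ ∞ (fun y => (heightCutoff (L.ℓ₁ y / h) - heightCutoff (L.ℓ₁ y / τ))) y :=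
      ContDiff.contDiffAt (((contDiff_heightCutoff.comp (L.ℓ₁.contDiff.div_const h))).sub
        ((contDiff_heightCutoff.comp (L.ℓ₁.contDiff.div_const τ))))
    exact ((contDiff_slopeBump m).contDiffAt.comp y h0).mul
      (h1.div (L.ℓ₁.contDiff.contDiffAt.pow 2) (by positivity))
  -- The two cutoffs cancel for `ℓ₁ ≤ τ / 2`, so the singularity of the quotients at `ℓ₁ = 0` is
  -- never reached.
  · have : L.weight m τ h =ᶠ[𝓝 y] fun _ => 0 := by
      have ho : IsOpen {y | L.ℓ₁ y < τ / 2} := isOpen_lt L.ℓ₁.continuous continuous_const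
      filter_upwards [ho.mem_nhds (show L.ℓ₁ y < τ / 2 by linarith)] with a ha
      exact weight_eq_zero_of_le hτ hτh (le_of_lt ha)
    exact contDiffAt_const.congr_of_eventuallyEq this

theorem mollifier_eq_zero_of_le (hτ : 0 < τ) {y : Plane} (hy : L.ℓ₁ y < τ / 2) :
    L.mollifier m τ y = 0 := by
  have : deriv heightCutoff (L.ℓ₁ y / τ) = 0 := by
    by_contra hd
    have h1 := (mem_Icc_of_deriv_heightCutoff_ne_zero hd).1
    rw [le_div_iff₀ hτ] at h1
    linarith
  simp [mollifier, this]

theorem mollifier_support (hm : 0 < m) (hτ : 0 < τ) {y : Plane} (hy : L.mollifier m τ y ≠ 0) :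
    y ∈ L.cone m τ ∧ τ / 2 ≤ L.ℓ₁ y := by
  have h1 : τ / 2 ≤ L.ℓ₁ y := by
    by_contra! hle; exact hy (mollifier_eq_zero_of_le hτ hle)
  have h0 : 0 < L.ℓ₁ y := by linarith
  refine ⟨⟨h0, ?_, abs_le_of_div hm h0 fun hz => hy (by simp [mollifier, hz])⟩, h1⟩
  have hd : deriv heightCutoff (L.ℓ₁ y / τ) ≠ 0 := fun hz => hy (by simp [mollifier, hz])
  have h2 := (mem_Icc_of_deriv_heightCutoff_ne_zero hd).2
  rwa [div_le_one hτ] at h2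

theorem mollifier_nonneg (hτ : 0 < τ) (y : Plane) : 0 ≤ L.mollifier m τ y := by
  by_cases hy : L.ℓ₁ y < τ / 2
  · rw [mollifier_eq_zero_of_le hτ hy]
  · have h0 : 0 < L.ℓ₁ y := by linarith
    unfold mollifier
    rw [neg_mul, ← mul_neg, ← neg_div]
    have := deriv_heightCutoff_nonpos (L.ℓ₁ y / τ)
    have := slopeBump_nonneg m (L.ℓ₀ y / L.ℓ₁ y)
    have : 0 ≤ -deriv heightCutoff (L.ℓ₁ y / τ) := by linarith
    positivity

theorem mollifier_le {D : ℝ} (hD : ∀ s, |deriv heightCutoff s| ≤ D) (hτ : 0 < τ) (y : Plane) :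
    |L.mollifier m τ y| ≤ 2 * D / τ ^ 2 := by
  have hD0 : 0 ≤ D := (abs_nonneg _).trans (hD 0)
  by_cases hy : L.ℓ₁ y < τ / 2
  · rw [mollifier_eq_zero_of_le hτ hy]; simp; positivity
  · push Not at hy
    have h0 : 0 < L.ℓ₁ y := by linarith
    unfold mollifier
    rw [abs_mul, abs_neg, abs_of_nonneg (slopeBump_nonneg _ _), abs_div,
      abs_of_pos (show 0 < τ * L.ℓ₁ y by positivity)]
    calc _ ≤ 1 * (D / (τ * (τ / 2))) := by
          gcongr
          · exact slopeBump_le_one _ _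
          · exact hD _
      _ = _ := by field_simp

theorem continuous_mollifier (hτ : 0 < τ) : Continuous (L.mollifier m τ) := by
  rw [continuous_iff_continuousAt]
  intro y
  by_cases hy : 0 < L.ℓ₁ y
  · have h0 : ContinuousAt (fun y => L.ℓ₀ y / L.ℓ₁ y) y :=
      L.ℓ₀.continuous.continuousAt.div L.ℓ₁.continuous.continuousAt hy.ne'
    have h1 : ContinuousAt (fun y => deriv heightCutoff (L.ℓ₁ y / τ)) y :=
      (continuous_deriv_heightCutoff.comp (L.ℓ₁.continuous.div_const τ)).continuousAt
    exact ((contDiff_slopeBump m).continuous.continuousAt.comp h0).neg.mul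
      (h1.div (continuousAt_const.mul L.ℓ₁.continuous.continuousAt) (by positivity))
  · have : L.mollifier m τ =ᶠ[𝓝 y] fun _ => 0 := by
      have ho : IsOpen {y | L.ℓ₁ y < τ / 2} := isOpen_lt L.ℓ₁.continuous continuous_const
      filter_upwards [ho.mem_nhds (show L.ℓ₁ y < τ / 2 by linarith)] with a ha
      exact mollifier_eq_zero_of_le hτ ha
    exact continuousAt_const.congr this.symm

theorem hasCompactSupport_mollifier (hm : 0 < m) (hτ : 0 < τ) :
    HasCompactSupport (L.mollifier m τ) :=
  HasCompactSupport.intro (isCompact_closedBall 0 ((1 + m) * τ)) fun y hy => by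
    by_contra h; exact hy (cone_subset hm (mollifier_support hm hτ h).1)

theorem mollifier_eq_smul (hτ : 0 < τ) (y : Plane) :
    L.mollifier m τ y = (τ ^ 2)⁻¹ * L.mollifier m 1 (τ⁻¹ • y) := by
  unfold mollifier
  simp only [map_smul, smul_eq_mul]
  rw [show τ⁻¹ * L.ℓ₀ y / (τ⁻¹ * L.ℓ₁ y) = L.ℓ₀ y / L.ℓ₁ y by
    rw [mul_div_mul_left _ _ (by positivity)], show τ⁻¹ * L.ℓ₁ y / 1 = L.ℓ₁ y / τ by
    rw [div_one, div_eq_inv_mul]]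
  field_simp

/-- The factor `τ⁻²` in `mollifier_eq_smul` is the Jacobian of the dilation in dimension two. -/
theorem integral_mollifier (hτ : 0 < τ) :
    ∫ y, L.mollifier m τ y = ∫ y, L.mollifier m 1 y := by
  simp_rw [mollifier_eq_smul (L := L) (m := m) hτ]
  rw [integral_const_mul, Measure.integral_comp_inv_smul]
  simp only [finrank_euclideanSpace, Fintype.card_fin, smul_eq_mul, abs_pow, abs_of_pos hτ]
  field_simp

theorem integral_mollifier_pos (hm : 0 < m) : 0 < ∫ y, L.mollifier m 1 y := by
  obtain ⟨s, hs, hd⟩ := exists_deriv_heightCutoff_neg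
  refine (continuous_mollifier one_pos).integral_pos_of_hasCompactSupport_nonneg_nonzero
    (hasCompactSupport_mollifier hm one_pos) (mollifier_nonneg one_pos) (x := s • L.v₁) ?_
  have : (0 : ℝ) < s := by linarith [hs.1]
  simp [mollifier, L.h₀₁, L.h₁₁, slopeBump_zero, hd.ne, this.ne']

/-- The left side is the divergence of the radial field `y ↦ weight y • y`. Where `ℓ₁ > 0`, the
slope factor is homogeneous of degree `0` and `ℓ₁⁻²` of degree `-2`. In the plane the field they
form is divergence free, so only the derivatives of the two height cutoffs survive. -/
theorem fderiv_weight_add (hτ : 0 < τ) (hτh : τ ≤ h) (y : Plane) :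
    fderiv ℝ (fun y => L.ℓ₀ y * L.weight m τ h y) y L.v₀ +
      fderiv ℝ (fun y => L.ℓ₁ y * L.weight m τ h y) y L.v₁ =
    L.mollifier m τ y - L.mollifier m h y := by
  have hh : 0 < h := by linarith
  have d0 : Differentiable ℝ (fun y => L.ℓ₀ y * L.weight m τ h y) :=
    (L.ℓ₀.contDiff.mul (contDiff_weight hτ hτh)).differentiable (n := ∞) (by simp)
  have d1 : Differentiable ℝ (fun y => L.ℓ₁ y * L.weight m τ h y) :=
    (L.ℓ₁.contDiff.mul (contDiff_weight hτ hτh)).differentiable (n := ∞) (by simp)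
  by_cases hy : 0 < L.ℓ₁ y
  · rw [← (d0 y).lineDeriv_eq_fderiv, ← (d1 y).lineDeriv_eq_fderiv, lineDeriv, lineDeriv]
    simp only [weight, mollifier, map_add, map_smul, smul_eq_mul, L.h₀₀, L.h₀₁, L.h₁₀, L.h₁₁,
      mul_one, mul_zero, add_zero]
    set a := L.ℓ₀ y
    set b := L.ℓ₁ y
    set M := (heightCutoff (b / h) - heightCutoff (b / τ)) / b ^ 2 with hM
    have e0 : HasDerivAt (fun t : ℝ => (a + t) * (slopeBump m ((a + t) / b) * M))
        (1 * (slopeBump m ((a + 0) / b) * M) +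
          (a + 0) * (deriv (slopeBump m) ((a + 0) / b) * (1 / b) * M)) 0 := by
      have ht : HasDerivAt (fun t : ℝ => a + t) 1 0 := (hasDerivAt_id 0).const_add a
      exact ht.mul (((hasDerivAt_slopeBump m _).comp 0 (ht.div_const b)).mul_const M)
    have e1 : HasDerivAt (fun t : ℝ => (b + t) * (slopeBump m (a / (b + t)) *
          ((heightCutoff ((b + t) / h) - heightCutoff ((b + t) / τ)) / (b + t) ^ 2)))
        (1 * (slopeBump m (a / (b + 0)) *
            ((heightCutoff ((b + 0) / h) - heightCutoff ((b + 0) / τ)) / (b + 0) ^ 2)) +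
          (b + 0) * (deriv (slopeBump m) (a / (b + 0)) * ((0 * (b + 0) - a * 1) / (b + 0) ^ 2) *
            ((heightCutoff ((b + 0) / h) - heightCutoff ((b + 0) / τ)) / (b + 0) ^ 2) +
            slopeBump m (a / (b + 0)) *
              (((deriv heightCutoff ((b + 0) / h) * (1 / h)
                  - deriv heightCutoff ((b + 0) / τ) * (1 / τ)) * (b + 0) ^ 2 -
                (heightCutoff ((b + 0) / h) - heightCutoff ((b + 0) / τ)) *
                  ((2 : ℕ) * (b + 0) ^ (2 - 1) * 1)) / ((b + 0) ^ 2) ^ 2))) 0 := by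
      have ht : HasDerivAt (fun t : ℝ => b + t) 1 0 := (hasDerivAt_id 0).const_add b
      refine ht.mul (HasDerivAt.mul ?_ (HasDerivAt.div (HasDerivAt.sub ?_ ?_) (ht.pow 2) ?_))
      · exact (hasDerivAt_slopeBump m _).comp 0 ((hasDerivAt_const _ a).div ht (by simp [hy.ne']))
      · exact (hasDerivAt_heightCutoff _).comp 0 (ht.div_const h)
      · exact (hasDerivAt_heightCutoff _).comp 0 (ht.div_const τ)
      · simp [hy.ne']
    rw [e0.deriv, e1.deriv]
    simp only [add_zero, hM]
    field_simp
    push_cast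
    ring
  · have hlt : L.ℓ₁ y < τ / 2 := by linarith
    have ho : IsOpen {y | L.ℓ₁ y < τ / 2} := isOpen_lt L.ℓ₁.continuous continuous_const
    have e0 : (fun y => L.ℓ₀ y * L.weight m τ h y) =ᶠ[𝓝 y] fun _ => 0 := by
      filter_upwards [ho.mem_nhds hlt] with a ha
      rw [weight_eq_zero_of_le hτ hτh (le_of_lt ha), mul_zero]
    have e1 : (fun y => L.ℓ₁ y * L.weight m τ h y) =ᶠ[𝓝 y] fun _ => 0 := by
      filter_upwards [ho.mem_nhds hlt] with a ha
      rw [weight_eq_zero_of_le hτ hτh (le_of_lt ha), mul_zero]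
    rw [e0.fderiv_eq, e1.fderiv_eq, mollifier_eq_zero_of_le hτ hlt,
      mollifier_eq_zero_of_le hh (by linarith)]
    simp

end PlaneCoords

end

/-! ### Pointwise representation on cones and local `L⁴` integrability. -/

section

open scoped ENNReal

/-- Fourth root of the Riesz kernel `1 / |y|`, truncated. -/
noncomputable def rootKernel (K : ℝ) (y : Plane) : ℝ≥0∞ :=
  (Metric.ball (0 : Plane) K).indicator (fun y => ENNReal.ofReal (‖y‖ ^ (-(1 / 4) : ℝ))) y

theorem measurable_rootKernel (K : ℝ) : Measurable (rootKernel K) := by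
  unfold rootKernel
  exact Measurable.indicator (by fun_prop) measurableSet_ball

/-- The `n`-th power is `|y| ^ (-n / 4)` on the ball, and `n / 4 < 2` is the integrability threshold
in the plane. For `n = 0` the power would equal `1` outside the ball as well. -/
theorem lintegral_rootKernel_pow_lt_top {K : ℝ} (hK : 0 < K) {n : ℕ} (hn : n < 8) (h0 : n ≠ 0) :
    ∫⁻ y, rootKernel K y ^ n < ⊤ := by
  have h1 : ∀ y, rootKernel K y ^ n = (Metric.ball (0 : Plane) K).indicator
      (fun y => ENNReal.ofReal (‖y‖ ^ (-(n / 4) : ℝ))) y := by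
    intro y
    unfold rootKernel
    by_cases hy : y ∈ Metric.ball (0 : Plane) K
    · rw [indicator_of_mem hy, indicator_of_mem hy, ← ENNReal.ofReal_pow (by positivity),
        ← Real.rpow_natCast, ← Real.rpow_mul (norm_nonneg _)]
      congr 2
      ring
    · simp [indicator_of_notMem hy, h0]
  simp_rw [h1]
  rw [lintegral_indicator measurableSet_ball]
  refine lintegral_ball_norm_rpow_lt_top ?_ hK
  rw [finrank_euclideanSpace, Fintype.card_fin]
  have : (n : ℝ) < 8 := by exact_mod_cast hn
  push_cast
  linarith

theorem inv_norm_le_rootKernel {K : ℝ} {y : Plane} (hy : y ∈ Metric.ball (0 : Plane) K)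
    (h0 : y ≠ 0) : ENNReal.ofReal ‖y‖⁻¹ = rootKernel K y ^ 4 := by
  unfold rootKernel
  rw [indicator_of_mem hy, ← ENNReal.ofReal_pow (by positivity), ← Real.rpow_natCast,
    ← Real.rpow_mul (norm_nonneg _), ← Real.rpow_neg_one]
  norm_num

variable {U : Set Plane} {f : Plane → ℝ} {G : Plane → Plane} {L : PlaneCoords} {m τ h : ℝ}
  {x : Plane}

/-- The set of points `x` such that the truncated cone with vertex `x` lies in `U`. -/
def PlaneCoords.coneVertices (L : PlaneCoords) (m h : ℝ) (U : Set Plane) : Set Plane :=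
  {x | ∀ y ∈ L.cone m h, x + y ∈ U}

theorem integral_mul_fderiv_weight (hm : 0 < m) (hτ : 0 < τ) (hτh : τ ≤ h)
    (hfG : IsWeakGrad U f G) (hx : x ∈ L.coneVertices m h U) (ℓ : Plane →L[ℝ] ℝ) (v : Plane) :
    ∫ y in U, f y * fderiv ℝ (fun y => ℓ y * L.weight m τ h y) (y - x) v =
      -∫ y in U, inner ℝ (G y) v * (ℓ (y - x) * L.weight m τ h (y - x)) := by
  -- The truncated cone omits its vertex and is not closed. Keeping `τ / 2 ≤ ℓ₁` gives a compact
  -- subset of `U` that contains the support, so the translated weight is a valid test function.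
  set A : Set Plane := {y | τ / 2 ≤ L.ℓ₁ (y - x) ∧ L.ℓ₁ (y - x) ≤ h ∧
    |L.ℓ₀ (y - x)| ≤ m * L.ℓ₁ (y - x)} with hA
  have hAc : IsClosed A := by
    have c0 : Continuous fun y => L.ℓ₀ (y - x) := by fun_prop
    have c1 : Continuous fun y => L.ℓ₁ (y - x) := by fun_prop
    exact (isClosed_le continuous_const c1).inter
      ((isClosed_le c1 continuous_const).inter (isClosed_le c0.abs (continuous_const.mul c1)))
  have hAcone : ∀ y ∈ A, y - x ∈ L.cone m h := fun y hy => ⟨by linarith [hy.1], hy.2.1, hy.2.2⟩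
  have hsupp : Function.support (fun y => ℓ (y - x) * L.weight m τ h (y - x)) ⊆ A := by
    intro y hy
    have := PlaneCoords.weight_support hm hτ hτh (right_ne_zero_of_mul hy)
    exact ⟨this.2, this.1.2.1, this.1.2.2⟩
  have htsupp : tsupport (fun y => ℓ (y - x) * L.weight m τ h (y - x)) ⊆ A :=
    closure_minimal hsupp hAc
  have hAK : IsCompact A := by
    refine (isCompact_closedBall x ((1 + m) * h)).of_isClosed_subset hAc fun y hy => ?_
    rw [mem_closedBall_iff_norm, ← mem_closedBall_zero_iff]
    exact PlaneCoords.cone_subset hm (hAcone y hy)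
  have key := hfG (fun y => ℓ (y - x) * L.weight m τ h (y - x))
    (ContDiff.mul (ℓ.contDiff.comp (contDiff_id.sub contDiff_const))
      ((PlaneCoords.contDiff_weight hτ hτh).comp (contDiff_id.sub contDiff_const)))
    (HasCompactSupport.of_support_subset_isCompact hAK hsupp)
    (fun y hy => by simpa using hx _ (hAcone y (htsupp hy))) v
  rw [← key]
  refine integral_congr_ae (ae_of_all _ fun y => ?_)
  simp only
  rw [fderiv_comp_sub (f := fun y => ℓ y * L.weight m τ h y)]

theorem integrableOn_mul_comp_sub (hf : IntegrableOn f U) {w : Plane → ℝ} (hw : Continuous w)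
    (hwc : HasCompactSupport w) (x : Plane) : IntegrableOn (fun y => f y * w (y - x)) U := by
  obtain ⟨C, hC⟩ := hw.bounded_above_of_compact_support hwc
  exact hf.mul_bdd (c := C) (by fun_prop) (ae_of_all _ fun y => hC (y - x))

theorem PlaneCoords.hasCompactSupport_weight (hm : 0 < m) (hτ : 0 < τ) (hτh : τ ≤ h) :
    HasCompactSupport (L.weight m τ h) :=
  HasCompactSupport.intro (isCompact_closedBall 0 ((1 + m) * h)) fun y hy => by
    by_contra hne; exact hy (PlaneCoords.cone_subset hm (PlaneCoords.weight_support hm hτ hτh hne).1)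

/-- The difference of the mollifiers is the divergence of a field supported in the cone. The weak
gradient takes over the derivative, and the field has size at most `(1 + m)² / |y|` there. The bound
does not depend on `τ`, so it survives `τ → 0`. -/
theorem enorm_integral_mollifier_sub_le (hm : 0 < m) (hτ : 0 < τ) (hτh : τ ≤ h)
    (hf : IntegrableOn f U) (hG : IntegrableOn G U)
    (hfG : IsWeakGrad U f G) (hx : x ∈ L.coneVertices m h U) :
    ‖(∫ y in U, f y * L.mollifier m τ (y - x)) - ∫ y in U, f y * L.mollifier m h (y - x)‖ₑ ≤
      ∫⁻ y in U, ‖G y‖ₑ * ENNReal.ofReal ((1 + m) ^ 2) * rootKernel ((1 + m) * h + 1) (y - x) ^ 4 := by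
  have hh : 0 < h := hτ.trans_le hτh
  have hw := (PlaneCoords.contDiff_weight (L := L) (m := m) hτ hτh)
  have hwc := PlaneCoords.hasCompactSupport_weight (L := L) hm hτ hτh
  have hi : ∀ ℓ : Plane →L[ℝ] ℝ, ∀ v : Plane,
      IntegrableOn (fun y => f y * fderiv ℝ (fun y => ℓ y * L.weight m τ h y) (y - x) v) U :=
    fun ℓ v => integrableOn_mul_comp_sub (w := fun y => fderiv ℝ (fun y => ℓ y * L.weight m τ h y) y v)
      hf (((ℓ.contDiff.mul hw).continuous_fderiv (by simp)).clm_apply continuous_const)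
      ((hwc.mul_left.fderiv (𝕜 := ℝ)).comp_left (g := fun A : Plane →L[ℝ] ℝ => A v) (by simp)) x
  have hi' : ∀ ℓ : Plane →L[ℝ] ℝ, ∀ v : Plane,
      IntegrableOn (fun y => inner ℝ (G y) v * (ℓ (y - x) * L.weight m τ h (y - x))) U :=
    fun ℓ v => integrableOn_mul_comp_sub (w := fun y => ℓ y * L.weight m τ h y)
      (hG.inner_const v) (by have := hw.continuous; fun_prop) hwc.mul_left x
  have e : (∫ y in U, f y * L.mollifier m τ (y - x)) - ∫ y in U, f y * L.mollifier m h (y - x) =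
      -∫ y in U, (inner ℝ (G y) L.v₀ * (L.ℓ₀ (y - x) * L.weight m τ h (y - x)) +
        inner ℝ (G y) L.v₁ * (L.ℓ₁ (y - x) * L.weight m τ h (y - x))) := by
    rw [← integral_sub, integral_add (hi' _ _) (hi' _ _), neg_add,
      ← integral_mul_fderiv_weight hm hτ hτh hfG hx, ← integral_mul_fderiv_weight hm hτ hτh hfG hx,
      ← integral_add (hi _ _) (hi _ _)]
    · refine integral_congr_ae (ae_of_all _ fun y => ?_)
      simp only
      rw [← mul_sub, ← mul_add, PlaneCoords.fderiv_weight_add hτ hτh]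
    · exact integrableOn_mul_comp_sub hf (PlaneCoords.continuous_mollifier hτ)
        (PlaneCoords.hasCompactSupport_mollifier hm hτ) x
    · exact integrableOn_mul_comp_sub hf (PlaneCoords.continuous_mollifier hh)
        (PlaneCoords.hasCompactSupport_mollifier hm hh) x
  rw [e, enorm_neg]
  refine (enorm_integral_le_lintegral_enorm _).trans (lintegral_mono fun y => ?_)
  set z := y - x
  by_cases hz : L.weight m τ h z = 0
  · simp [hz]
  have hzc := PlaneCoords.weight_support hm hτ hτh hz
  have h1 : 0 < L.ℓ₁ z := hzc.1.1
  have hz0 : z ≠ 0 := by rintro h0; simp [h0] at h1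
  rw [← inv_norm_le_rootKernel _ hz0, mul_assoc, ← ENNReal.ofReal_mul (by positivity),
    ← ofReal_norm (G y), ← ENNReal.ofReal_mul (norm_nonneg _), Real.enorm_eq_ofReal_abs]
  · refine ENNReal.ofReal_le_ofReal ?_
    have hw1 := PlaneCoords.abs_weight_le (L := L) (m := m) (τ := τ) (h := h) z
    have n0 : |inner ℝ (G y) L.v₀| ≤ ‖G y‖ := (abs_real_inner_le_norm _ _).trans
      (mul_le_of_le_one_right (norm_nonneg _) L.norm_v₀)
    have n1 : |inner ℝ (G y) L.v₁| ≤ ‖G y‖ := (abs_real_inner_le_norm _ _).trans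
      (mul_le_of_le_one_right (norm_nonneg _) L.norm_v₁)
    have hn := PlaneCoords.norm_le_of_mem_cone hzc.1
    have hzn : 0 < ‖z‖ := norm_pos_iff.2 hz0
    calc _ ≤ |inner ℝ (G y) L.v₀| * (|L.ℓ₀ z| * |L.weight m τ h z|) +
          |inner ℝ (G y) L.v₁| * (|L.ℓ₁ z| * |L.weight m τ h z|) := by
          rw [← abs_mul, ← abs_mul, ← abs_mul, ← abs_mul]; exact abs_add_le _ _
      _ ≤ ‖G y‖ * (m * L.ℓ₁ z * (L.ℓ₁ z ^ 2)⁻¹) + ‖G y‖ * (L.ℓ₁ z * (L.ℓ₁ z ^ 2)⁻¹) := by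
          gcongr
          · exact hzc.1.2.2
          · rw [abs_of_pos h1]
      _ = ‖G y‖ * ((1 + m) * (L.ℓ₁ z)⁻¹) := by field_simp; ring
      _ ≤ ‖G y‖ * ((1 + m) * ((1 + m) * ‖z‖⁻¹)) := by
          gcongr
          rw [inv_le_iff_one_le_mul₀ h1, mul_comm, ← mul_assoc, ← div_eq_mul_inv, le_div_iff₀ hzn]
          linarith
      _ = _ := by ring
  -- The cone lies in a closed ball of radius `(1 + m) * h`; the extra `1` puts it in the open ball
  -- that carries the kernel.
  · rw [mem_ball_zero_iff]
    have := mem_closedBall_zero_iff.1 (PlaneCoords.cone_subset hm hzc.1)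
    linarith

/-- The mollifiers sit on one side of `x`, but inside balls centred at `x` and with height
comparable to the inverse volume of these balls. Convergence therefore holds at every Lebesgue point
of `f` extended by zero. -/
theorem ae_tendsto_integral_mollifier (hU : MeasurableSet U) (hm : 0 < m)
    (hf : IntegrableOn f U) {τ : ℕ → ℝ} (hτ : ∀ n, 0 < τ n)
    (hlim : Tendsto τ atTop (𝓝 0)) :
    ∀ᵐ x, x ∈ U ∩ L.coneVertices m h U →
      Tendsto (fun n => ∫ y in U, f y * L.mollifier m (τ n) (y - x)) atTop
        (𝓝 ((∫ y, L.mollifier m 1 y) * f x)) := by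
  obtain ⟨D, hD0, hD⟩ := exists_bound_deriv_heightCutoff
  set c := ∫ y, L.mollifier m 1 y with hc
  have hcpos : 0 < c := PlaneCoords.integral_mollifier_pos hm
  have hfi : Integrable (U.indicator f) := (integrable_indicator_iff hU).2 hf
  filter_upwards [IsUnifLocDoublingMeasure.ae_tendsto_average_norm_sub volume
    hfi.locallyIntegrable 0] with x hx hxU
  have hδ : Tendsto (fun n => (1 + m) * τ n) atTop (𝓝[>] 0) := by
    refine tendsto_nhdsWithin_iff.2 ⟨by simpa using hlim.const_mul (1 + m),
      Eventually.of_forall fun n => ?_⟩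
    have := hτ n
    exact mem_Ioi.2 (by positivity)
  have h1 := hx (fun _ : ℕ => x) _ hδ (by simp)
  -- The constant is chosen so that the bound `2 * D / τ²` on the mollifier, divided by its mass
  -- `c`, equals this constant over the volume of the ball of radius `(1 + m) * τ`.
  have h2 := tendsto_integral_smul_of_tendsto_average_norm_sub
    (2 * D * (1 + m) ^ 2 * volume.real (Metric.ball (0 : Plane) 1) / c)
    (g := fun n y => c⁻¹ * L.mollifier m (τ n) (y - x)) h1
    (Eventually.of_forall fun n => hfi.integrableOn) ?_
    (Eventually.of_forall fun n => ?_) (Eventually.of_forall fun n y => ?_)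
  · rw [indicator_of_mem hxU.1] at h2
    refine ((h2.const_mul c).congr fun n => ?_)
    rw [← integral_const_mul, ← integral_indicator hU]
    refine integral_congr_ae (ae_of_all _ fun y => ?_)
    simp only [smul_eq_mul]
    by_cases hy : y ∈ U
    · rw [indicator_of_mem hy, indicator_of_mem hy]; field_simp
    · simp [indicator_of_notMem hy]
  · refine tendsto_const_nhds.congr fun n => ?_
    rw [integral_const_mul, integral_sub_right_eq_self (L.mollifier m (τ n)) x,
      PlaneCoords.integral_mollifier (hτ n), inv_mul_cancel₀ hcpos.ne']
  · intro y hy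
    rw [mem_closedBall_iff_norm, ← mem_closedBall_zero_iff]
    exact PlaneCoords.cone_subset hm
      (PlaneCoords.mollifier_support hm (hτ n) (right_ne_zero_of_mul hy)).1
  · have ht := hτ n
    rw [abs_mul, abs_of_pos (inv_pos.2 hcpos),
      Measure.addHaar_real_closedBall _ _ (by positivity), finrank_euclideanSpace, Fintype.card_fin]
    have hb : 0 < volume.real (Metric.ball (0 : Plane) 1) :=
      ENNReal.toReal_pos (Metric.measure_ball_pos _ _ one_pos).ne' measure_ball_lt_top.ne
    calc _ ≤ c⁻¹ * (2 * D / τ n ^ 2) := by gcongr; exact PlaneCoords.mollifier_le hD ht _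
      _ = _ := by field_simp

/-- Letting the small scale tend to `0` gives `c |f| ≤ A + I` almost everywhere on `P`. Here `A`
bounds the average at scale `h` and `I` is a truncated Riesz potential of `|G|`. The potential is in
`L⁴` and `P` has finite measure. -/
theorem memLp_four_of_coneVertices (hU : MeasurableSet U) (hUb : volume U ≠ ⊤) (hm : 0 < m)
    (hh : 0 < h) (hf : MemLp f 2 (volume.restrict U)) (hG : MemLp G 2 (volume.restrict U))
    (hfG : IsWeakGrad U f G) {P : Set Plane} (hP : P ⊆ U) (hPc : P ⊆ L.coneVertices m h U)
    (hPm : MeasurableSet P) : ∫⁻ x in P, ‖f x‖ₑ ^ 4 < ⊤ := by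
  have : IsFiniteMeasure (volume.restrict U) := ⟨by simpa using hUb.lt_top⟩
  have hfi : IntegrableOn f U := hf.integrable (by norm_num)
  have hGi : IntegrableOn G U := hG.integrable (by norm_num)
  obtain ⟨D, hD0, hD⟩ := exists_bound_deriv_heightCutoff
  set c := ∫ y, L.mollifier m 1 y with hc
  have hcpos : 0 < c := PlaneCoords.integral_mollifier_pos hm
  set K := (1 + m) * h + 1 with hK
  have hKpos : 0 < K := by positivity
  -- A measurable representative on the whole plane, zero almost everywhere off `U`: the potential
  -- estimate uses Tonelli and translation invariance.
  obtain ⟨F, hFm, hF⟩ : ∃ F : Plane → ℝ≥0∞, Measurable F ∧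
      (fun y => U.indicator (fun y => ‖G y‖ₑ * ENNReal.ofReal ((1 + m) ^ 2)) y) =ᵐ[volume] F := by
    have : AEMeasurable (fun y => U.indicator
        (fun y => ‖G y‖ₑ * ENNReal.ofReal ((1 + m) ^ 2)) y) volume :=
      (aemeasurable_indicator_iff hU).2 (hG.1.enorm.mul_const _)
    exact ⟨_, this.measurable_mk, this.ae_eq_mk⟩
  have hFI : ∀ x, ∫⁻ y in U, ‖G y‖ₑ * ENNReal.ofReal ((1 + m) ^ 2) * rootKernel K (y - x) ^ 4 =
      ∫⁻ y, F y * rootKernel K (y - x) ^ 4 := by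
    intro x
    rw [← lintegral_indicator hU]
    refine lintegral_congr_ae ?_
    filter_upwards [hF] with y hy
    rw [← hy]
    by_cases hyU : y ∈ U
    · simp [hyU]
    · simp [hyU]
  have hF2 : ∫⁻ y, F y ^ 2 < ⊤ := by
    have e : ∫⁻ y, F y ^ 2 = ∫⁻ y in U, ‖G y‖ₑ ^ 2 * ENNReal.ofReal ((1 + m) ^ 2) ^ 2 := by
      rw [← lintegral_indicator hU]
      refine lintegral_congr_ae ?_
      filter_upwards [hF] with y hy
      rw [← hy]
      by_cases hyU : y ∈ U
      · simp [hyU, mul_pow]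
      · simp [hyU]
    rw [e, lintegral_mul_const' _ _ (by simp)]
    have h2 := hG.eLpNorm_lt_top
    rw [eLpNorm_lt_top_iff_lintegral_rpow_enorm_lt_top (by norm_num) (by norm_num)] at h2
    refine ENNReal.mul_lt_top ?_ (by simp)
    simpa using h2
  set I : Plane → ℝ≥0∞ := fun x => ∫⁻ y, F y * rootKernel K (y - x) ^ 4 with hI
  have hIm : Measurable I := Measurable.lintegral_prod_right'
    (f := fun p : Plane × Plane => F p.2 * rootKernel K (p.2 - p.1) ^ 4) (by
      have := measurable_rootKernel K
      fun_prop)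
  have hI4 : ∫⁻ x, I x ^ 4 < ⊤ := by
    refine (lintegral_potential_pow_four_le hFm (measurable_rootKernel K)).trans_lt ?_
    have h6 := lintegral_rootKernel_pow_lt_top hKpos (n := 6) (by norm_num) (by norm_num)
    have h4 := lintegral_rootKernel_pow_lt_top hKpos (n := 4) (by norm_num) (by norm_num)
    exact ENNReal.mul_lt_top (ENNReal.mul_lt_top (ENNReal.pow_lt_top h6) hF2)
      (ENNReal.mul_lt_top hF2 h4)
  set A : ℝ≥0∞ := ENNReal.ofReal (∫ y in U, |f y| * (2 * D / h ^ 2)) with hA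
  have hbd : ∀ᵐ x, x ∈ P → ENNReal.ofReal c * ‖f x‖ₑ ≤ A + I x := by
    have hlim : Tendsto (fun n : ℕ => h / ((n : ℝ) + 1)) atTop (𝓝 0) := by
      simpa using (tendsto_one_div_add_atTop_nhds_zero_nat (𝕜 := ℝ)).const_mul h |>.congr
        fun n => by ring
    have hle : ∀ n : ℕ, h / ((n : ℝ) + 1) ≤ h := fun n =>
      div_le_self hh.le (by linarith [(Nat.cast_nonneg n : (0 : ℝ) ≤ n)])
    filter_upwards [ae_tendsto_integral_mollifier (L := L) hU hm hfi (fun n => by positivity)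
      hlim] with x hx hxP
    have ht := hx ⟨hP hxP, hPc hxP⟩
    have h1 : ‖c * f x - ∫ y in U, f y * L.mollifier m h (y - x)‖ₑ ≤ I x := by
      refine le_of_tendsto ((ht.sub_const _).enorm) (Eventually.of_forall fun n => ?_)
      exact (enorm_integral_mollifier_sub_le hm (by positivity) (hle n) hfi hGi hfG
        (hPc hxP)).trans (hFI x).le
    have h2 : ‖∫ y in U, f y * L.mollifier m h (y - x)‖ₑ ≤ A := by
      rw [Real.enorm_eq_ofReal_abs]
      refine ENNReal.ofReal_le_ofReal ((abs_integral_le_integral_abs).trans ?_)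
      refine integral_mono_of_nonneg (ae_of_all _ fun y => abs_nonneg _)
        (hfi.abs.mul_const _) (ae_of_all _ fun y => ?_)
      simp only
      rw [abs_mul]
      gcongr
      exact PlaneCoords.mollifier_le hD hh _
    calc ENNReal.ofReal c * ‖f x‖ₑ = ‖c * f x‖ₑ := by
          rw [enorm_mul, Real.enorm_eq_ofReal hcpos.le]
      _ = ‖(∫ y in U, f y * L.mollifier m h (y - x)) +
            (c * f x - ∫ y in U, f y * L.mollifier m h (y - x))‖ₑ := by congr 1; ring
      _ ≤ _ := (enorm_add_le _ _).trans (add_le_add h2 h1)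
  have hc4 : ENNReal.ofReal c ^ 4 * ∫⁻ x in P, ‖f x‖ₑ ^ 4 < ⊤ := by
    rw [← lintegral_const_mul' _ _ (by simp)]
    calc ∫⁻ x in P, ENNReal.ofReal c ^ 4 * ‖f x‖ₑ ^ 4
        ≤ ∫⁻ x in P, (16 * A ^ 4 + 16 * I x ^ 4) := by
          refine lintegral_mono_ae ?_
          rw [ae_restrict_iff' hPm]
          filter_upwards [hbd] with x hx hxP
          rw [← mul_pow]
          calc _ ≤ (A + I x) ^ 4 := by gcongr; exact hx hxP
            _ ≤ (2 * max A (I x)) ^ 4 := by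
              rw [two_mul]; gcongr; exacts [le_max_left _ _, le_max_right _ _]
            _ = 16 * max A (I x) ^ 4 := by ring
            _ ≤ 16 * (A ^ 4 + I x ^ 4) := by
              gcongr
              rcases le_total A (I x) with hle | hle
              · rw [max_eq_right hle]; exact le_add_self
              · rw [max_eq_left hle]; exact le_self_add
            _ = _ := by ring
      _ = 16 * A ^ 4 * volume P + 16 * ∫⁻ x in P, I x ^ 4 := by
          rw [lintegral_add_left measurable_const, setLIntegral_const,
            lintegral_const_mul _ (hIm.pow_const 4)]
      _ < ⊤ := by
          refine ENNReal.add_lt_top.2 ⟨ENNReal.mul_lt_top (ENNReal.mul_lt_top (by simp)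
            (ENNReal.pow_lt_top (by simp [hA]))) ((measure_mono hP).trans_lt hUb.lt_top),
            ENNReal.mul_lt_top (by simp) ((setLIntegral_le_lintegral _ _).trans_lt hI4)⟩
  by_contra hne
  rw [not_lt, top_le_iff] at hne
  rw [hne, ENNReal.mul_top (by simp [hcpos])] at hc4
  exact lt_irrefl _ hc4

end

/-! ### Interior cones of a `C²` domain and the embedding of `H¹` into `L⁴`. -/

section

open scoped ENNReal

/-- The coordinates attached to a linear isometry. -/
noncomputable def PlaneCoords.ofIsometry (R : Plane ≃ₗᵢ[ℝ] Plane) : PlaneCoords where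
  ℓ₀ := (EuclideanSpace.proj 0 : Plane →L[ℝ] ℝ).comp (R.toContinuousLinearEquiv : Plane →L[ℝ] Plane)
  ℓ₁ := (EuclideanSpace.proj 1 : Plane →L[ℝ] ℝ).comp (R.toContinuousLinearEquiv : Plane →L[ℝ] Plane)
  v₀ := R.symm (EuclideanSpace.single 0 1)
  v₁ := R.symm (EuclideanSpace.single 1 1)
  h₀₀ := by simp
  h₀₁ := by simp
  h₁₀ := by simp
  h₁₁ := by simp
  norm_le y := by
    rw [← R.norm_map y, EuclideanSpace.norm_eq, Fin.sum_univ_two, Real.sqrt_le_left (by positivity)]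
    simp only [ContinuousLinearMap.comp_apply, PiLp.proj_apply, Real.norm_eq_abs,
      ContinuousLinearEquiv.coe_coe, LinearIsometryEquiv.coe_toContinuousLinearEquiv]
    nlinarith [abs_nonneg (R y 0), abs_nonneg (R y 1)]
  norm_v₀ := by simp
  norm_v₁ := by simp

/-- At a boundary point, let `M` bound `|γ'|` on a compact interval. Moving by a vector of the cone
of slope `1 / (M + 1)` raises the point by at least `M + 1` times the horizontal shift, while the
graph rises by at most `M` times it. Interior points need only a small cone. -/
theorem IsC2Domain.exists_cone {U : Set Plane} (hU : IsC2Domain U) {p : Plane}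
    (hp : p ∈ closure U) : ∃ r > 0, ∃ (L : PlaneCoords) (m h : ℝ), 0 < m ∧ 0 < h ∧
      U ∩ Metric.ball p r ⊆ L.coneVertices m h U := by
  by_cases hpU : p ∈ U
  · obtain ⟨r, hr, hrU⟩ := Metric.isOpen_iff.1 hU.isOpen p hpU
    -- With `m ≤ 1` and height `r / 4` the cone has radius at most `r / 2`, so from a vertex within
    -- `r / 2` of `p` it stays in the ball of radius `r`. The boundary case uses the same numbers.
    refine ⟨r / 2, by positivity, PlaneCoords.ofIsometry (.refl ℝ _), 1, r / 4, one_pos,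
      by positivity, fun x hx y hy => hrU ?_⟩
    have h1 := mem_closedBall_zero_iff.1 (PlaneCoords.cone_subset one_pos hy)
    have h2 := mem_ball_iff_norm.1 hx.2
    rw [mem_ball_iff_norm, add_sub_right_comm]
    exact (norm_add_le _ _).trans_lt (by linarith)
  · have hpf : p ∈ frontier U := by rw [hU.isOpen.frontier_eq]; exact ⟨hp, hpU⟩
    obtain ⟨r, hr, R, γ, hγ, hUr⟩ := hU.boundary p hpf
    obtain ⟨M, hM⟩ := (isCompact_Icc (a := R p 0 - r) (b := R p 0 + r)).exists_bound_of_continuousOn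
      (hγ.continuous_deriv (by norm_num)).continuousOn
    have hM0 : 0 ≤ M := (norm_nonneg _).trans (hM (R p 0) ⟨by linarith, by linarith⟩)
    have hcoord : ∀ x ∈ Metric.ball p r, R x 0 ∈ Icc (R p 0 - r) (R p 0 + r) := by
      intro x hx
      have h1 : |R x 0 - R p 0| ≤ ‖R x - R p‖ := by
        simpa using PiLp.norm_apply_le (R x - R p) 0
      rw [← map_sub, R.norm_map] at h1
      have h2 := h1.trans (mem_ball_iff_norm.1 hx).le
      rw [abs_le] at h2
      constructor <;> linarith
    have hm1 : 1 / (M + 1) ≤ 1 := by rw [div_le_one (by linarith)]; linarith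
    refine ⟨r / 2, by positivity, PlaneCoords.ofIsometry R, 1 / (M + 1), r / 4, by positivity,
      by positivity, fun x hx y hy => ?_⟩
    have h1 := mem_closedBall_zero_iff.1 (PlaneCoords.cone_subset (by positivity) hy)
    have h2 := mem_ball_iff_norm.1 hx.2
    have hxr : x ∈ Metric.ball p r := Metric.ball_subset_ball (by linarith) hx.2
    have hxyr : x + y ∈ Metric.ball p r := by
      rw [mem_ball_iff_norm, add_sub_right_comm]
      refine (norm_add_le _ _).trans_lt ?_
      have : (1 + 1 / (M + 1)) * (r / 4) ≤ (1 + 1) * (r / 4) := by gcongr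
      linarith
    rw [hUr _ hxyr]
    have h3 := (hUr _ hxr).1 hx.1
    have h4 := (convex_Icc (R p 0 - r) (R p 0 + r)).norm_image_sub_le_of_norm_deriv_le
      (fun s _ => hγ.differentiable (by norm_num) s) hM (hcoord x hxr) (hcoord _ hxyr)
    obtain ⟨c1, c2, c3⟩ := hy
    simp only [PlaneCoords.ofIsometry, ContinuousLinearMap.comp_apply, PiLp.proj_apply,
      ContinuousLinearEquiv.coe_coe, LinearIsometryEquiv.coe_toContinuousLinearEquiv] at c1 c2 c3
    simp only [map_add, PiLp.add_apply, add_sub_cancel_left, Real.norm_eq_abs] at h4 ⊢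
    have h5 := (le_abs_self _).trans h4
    have h6 : |R y 0| * (M + 1) ≤ R y 1 := by
      calc _ ≤ 1 / (M + 1) * R y 1 * (M + 1) := by gcongr
        _ = _ := by field_simp
    rcases (abs_nonneg (R y 0)).eq_or_lt with h0 | h0
    · rw [← h0] at h5; linarith
    · linarith

/-- The embedding of `H¹(U)` into `L⁴(U)`. -/
theorem memLp_four {U : Set Plane} (hU : IsC2Domain U) {f : Plane → ℝ} {G : Plane → Plane}
    (hf : MemLp f 2 (volume.restrict U)) (hG : MemLp G 2 (volume.restrict U))
    (hfG : IsWeakGrad U f G) : MemLp f 4 (volume.restrict U) := by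
  refine ⟨hf.1, ?_⟩
  rw [eLpNorm_lt_top_iff_lintegral_rpow_enorm_lt_top (by norm_num) (by norm_num)]
  have hm := hU.isOpen.measurableSet
  have hb : volume U ≠ ⊤ := hU.isBounded.measure_lt_top.ne
  choose! r hr L m h hmpos hh hcone using fun p (hp : p ∈ closure U) => hU.exists_cone hp
  -- Compactness of the closure reduces the global bound to finitely many pieces, each with its own
  -- cone.
  obtain ⟨t, ht, hcov⟩ := (hU.isBounded.isCompact_closure).elim_nhds_subcover
    (fun p => Metric.ball p (r p)) fun p hp => Metric.ball_mem_nhds p (hr p hp)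
  have hsub : U ⊆ ⋃ p : t, U ∩ Metric.ball (p : Plane) (r p) := fun x hx => by
    obtain ⟨p, hp, hxp⟩ := mem_iUnion₂.1 (hcov (subset_closure hx))
    exact mem_iUnion.2 ⟨⟨p, hp⟩, hx, hxp⟩
  have key : ∫⁻ x in U, ‖f x‖ₑ ^ 4 < ⊤ := by
    calc _ ≤ ∫⁻ x in ⋃ p : t, U ∩ Metric.ball (p : Plane) (r p), ‖f x‖ₑ ^ 4 :=
        lintegral_mono_set hsub
      _ ≤ ∑' p : t, ∫⁻ x in U ∩ Metric.ball (p : Plane) (r p), ‖f x‖ₑ ^ 4 :=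
        lintegral_iUnion_le _ _
      _ < ⊤ := by
        rw [tsum_fintype]
        exact ENNReal.sum_lt_top.2 fun p _ =>
          memLp_four_of_coneVertices hm hb (hmpos p (ht p p.2)) (hh p (ht p p.2)) hf hG hfG
            inter_subset_left (hcone p (ht p p.2)) (hm.inter measurableSet_ball)
  simpa using key

end

/-! ### Mollification and the chain rule for weak gradients. -/

section

open scoped ENNReal Convolution

/-- A form of Scheffé's lemma. -/
theorem tendsto_integral_norm_sub_of_integral_norm_le {α E : Type*} [MeasurableSpace α]
    {μ : Measure α} [NormedAddCommGroup E] {h : α → E} {hn : ℕ → α → E} (hi : Integrable h μ)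
    (hni : ∀ n, Integrable (hn n) μ) (hlim : ∀ᵐ x ∂μ, Tendsto (fun n => hn n x) atTop (𝓝 (h x)))
    (hle : ∀ n, ∫ x, ‖hn n x‖ ∂μ ≤ ∫ x, ‖h x‖ ∂μ) :
    Tendsto (fun n => ∫ x, ‖hn n x - h x‖ ∂μ) atTop (𝓝 0) := by
  -- By the triangle inequality this integrand is bounded by `2 ‖h‖`, so dominated convergence
  -- applies even though the `hn` have no common dominating function.
  have h1 : Tendsto (fun n => ∫ x, (‖h x‖ + ‖hn n x‖ - ‖hn n x - h x‖) ∂μ) atTop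
      (𝓝 (∫ x, 2 * ‖h x‖ ∂μ)) := by
    refine tendsto_integral_of_dominated_convergence (fun x => 2 * ‖h x‖)
      (fun n => ((hi.norm.add (hni n).norm).sub ((hni n).sub hi).norm).1) (hi.norm.const_mul 2)
      (fun n => ae_of_all _ fun x => ?_) ?_
    · have a1 : ‖hn n x - h x‖ ≤ ‖hn n x‖ + ‖h x‖ := norm_sub_le _ _
      have a2 : ‖hn n x‖ ≤ ‖hn n x - h x‖ + ‖h x‖ := norm_le_norm_sub_add _ _
      rw [Real.norm_eq_abs, abs_le]
      constructor <;> linarith [norm_nonneg (h x)]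
    · filter_upwards [hlim] with x hx
      have := (tendsto_const_nhds (x := ‖h x‖)).add hx.norm |>.sub (hx.sub_const (h x)).norm
      simpa [two_mul] using this
  have h2 : Tendsto (fun n => 2 * (∫ x, ‖h x‖ ∂μ) -
      ∫ x, (‖h x‖ + ‖hn n x‖ - ‖hn n x - h x‖) ∂μ) atTop (𝓝 0) := by
    have := h1.const_sub (2 * ∫ x, ‖h x‖ ∂μ)
    rwa [integral_const_mul, sub_self] at this
  refine squeeze_zero (fun n => integral_nonneg fun x => norm_nonneg _) (fun n => ?_) h2
  have e : ∫ x, (‖h x‖ + ‖hn n x‖ - ‖hn n x - h x‖) ∂μ =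
      (∫ x, ‖h x‖ ∂μ) + (∫ x, ‖hn n x‖ ∂μ) - ∫ x, ‖hn n x - h x‖ ∂μ := by
    rw [integral_sub (f := fun x => ‖h x‖ + ‖hn n x‖)
      (g := fun x => ‖hn n x - h x‖) (hi.norm.add (hni n).norm) ((hni n).sub hi).norm, integral_add hi.norm (hni n).norm]
  rw [e]
  linarith [hle n]

/-- The normalized bump is nonnegative with integral one, so `|φ ⋆ h| ≤ φ ⋆ |h|`, whose integral is
that of `|h|`. -/
theorem integral_norm_convolution_normed_le (φ : ContDiffBump (0 : Plane)) {h : Plane → ℝ}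
    (hi : Integrable h) :
    ∫ x, ‖(φ.normed volume ⋆[ContinuousLinearMap.lsmul ℝ ℝ] h) x‖ ≤ ∫ x, ‖h x‖ := by
  have e := integral_convolution (μ := (volume : Measure Plane)) (ν := (volume : Measure Plane))
    (ContinuousLinearMap.lsmul ℝ ℝ) φ.integrable_normed hi.norm
  rw [φ.integral_normed] at e
  simp only [ContinuousLinearMap.lsmul_apply, one_smul] at e
  rw [← e]
  refine integral_mono_of_nonneg (ae_of_all _ fun x => norm_nonneg _)
    (φ.integrable_normed.integrable_convolution _ hi.norm) (ae_of_all _ fun x => ?_)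
  refine (norm_integral_le_integral_norm _).trans (le_of_eq ?_)
  refine integral_congr_ae (ae_of_all _ fun y => ?_)
  simp [abs_of_nonneg (φ.nonneg_normed _)]

/-- While the ball around `x` stays in `U`, the function `y ↦ φ (x - y)` is an admissible test
function. Its derivative in `y` is minus the derivative in `x` falling on the kernel. -/
theorem IsWeakGrad.fderiv_convolution {U : Set Plane} (hU : MeasurableSet U) {f : Plane → ℝ}
    {G : Plane → Plane} (hf : IntegrableOn f U) (hfG : IsWeakGrad U f G)
    (φ : ContDiffBump (0 : Plane)) {x : Plane} (hx : Metric.closedBall x φ.rOut ⊆ U) (v : Plane) :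
    fderiv ℝ (φ.normed volume ⋆[ContinuousLinearMap.lsmul ℝ ℝ] (U.indicator f)) x v =
      (φ.normed volume ⋆[ContinuousLinearMap.lsmul ℝ ℝ]
        (U.indicator fun y => inner ℝ (G y) v)) x := by
  have hfi : Integrable (U.indicator f) := (integrable_indicator_iff hU).2 hf
  have hφ : ContDiff ℝ ∞ (φ.normed volume) := φ.contDiff_normed
  have hsupp : ∀ y, y ∉ Metric.closedBall x φ.rOut → φ.normed volume (x - y) = 0 := by
    intro y hy
    have : x - y ∉ Function.support (φ.normed volume) := by
      rw [φ.support_normed_eq, mem_ball_zero_iff, ← dist_eq_norm, dist_comm]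
      intro hlt
      exact hy (Metric.mem_closedBall.2 hlt.le)
    simpa using this
  have hsub : Function.support (fun y => φ.normed volume (x - y)) ⊆ Metric.closedBall x φ.rOut :=
    fun y hy => by by_contra h; exact hy (hsupp y h)
  have key := hfG (fun y => φ.normed volume (x - y)) (hφ.comp (contDiff_const.sub contDiff_id))
    (HasCompactSupport.of_support_subset_isCompact (isCompact_closedBall _ _) hsub)
    ((closure_minimal hsub Metric.isClosed_closedBall).trans hx) v
  rw [(φ.hasCompactSupport_normed.hasFDerivAt_convolution_left (ContinuousLinearMap.lsmul ℝ ℝ)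
    (hφ.of_le (by simp)) hfi.locallyIntegrable x).fderiv]
  rw [convolution_eq_swap, convolution_eq_swap, ContinuousLinearMap.integral_apply]
  · have e1 : ∀ y, fderiv ℝ (fun y => φ.normed volume (x - y)) y v =
        -fderiv ℝ (φ.normed volume) (x - y) v := by
      intro y
      rw [show (fun y => φ.normed volume (x - y)) = φ.normed volume ∘ (x - ·) from rfl,
        (((hφ.differentiable (by simp) (x - y)).hasFDerivAt).comp y
        (f := (x - ·)) ((hasFDerivAt_id y).const_sub x)).fderiv]
      simp
    simp_rw [e1, mul_neg, integral_neg, neg_inj] at key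
    rw [← integral_indicator hU, ← integral_indicator hU] at key
    refine Eq.trans (integral_congr_ae (ae_of_all _ fun y => ?_))
      (key.trans (integral_congr_ae (ae_of_all _ fun y => ?_)))
    · by_cases hy : y ∈ U <;> simp [hy, ContinuousLinearMap.precompL, mul_comm]
    · by_cases hy : y ∈ U <;> simp [hy, mul_comm]
  · exact ((φ.hasCompactSupport_normed.fderiv (𝕜 := ℝ)).convolutionExists_left _
      (hφ.continuous_fderiv (by simp)) hfi.locallyIntegrable x).integrable_swap

theorem tendsto_integral_of_norm_sub_le {α : Type*} [MeasurableSpace α] {μ : Measure α}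
    {A : α → ℝ} {An B : ℕ → α → ℝ} (hA : Integrable A μ) (hAn : ∀ n, Integrable (An n) μ)
    (hB : ∀ n, Integrable (B n) μ) (hle : ∀ n x, |An n x - A x| ≤ B n x)
    (hlim : Tendsto (fun n => ∫ x, B n x ∂μ) atTop (𝓝 0)) :
    Tendsto (fun n => ∫ x, An n x ∂μ) atTop (𝓝 (∫ x, A x ∂μ)) := by
  rw [tendsto_iff_norm_sub_tendsto_zero]
  refine squeeze_zero (fun n => norm_nonneg _) (fun n => ?_) hlim
  rw [← integral_sub (hAn n) hA]
  exact norm_integral_le_of_norm_le (hB n) (ae_of_all _ (hle n))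

/-- The chain rule for weak gradients. -/
theorem IsWeakGrad.comp {U : Set Plane} (hU : IsOpen U) {f : Plane → ℝ} {G : Plane → Plane}
    (hf : IntegrableOn f U) (hG : IntegrableOn G U) (hfG : IsWeakGrad U f G) {F : ℝ → ℝ}
    (hF : ContDiff ℝ 1 F) {M : ℝ} (hM : ∀ s, |deriv F s| ≤ M) :
    IsWeakGrad U (fun x => F (f x)) (fun x => deriv F (f x) • G x) := by
  intro ψ hψ hψc hψU v
  have hUm := hU.measurableSet
  have hM0 : 0 ≤ M := (abs_nonneg _).trans (hM 0)
  have hFd : Differentiable ℝ F := hF.differentiable (by simp)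
  have hF'c : Continuous (deriv F) := hF.continuous_deriv (by simp)
  have hLip : ∀ a b, |F a - F b| ≤ M * |a - b| := fun a b =>
    convex_univ.norm_image_sub_le_of_norm_deriv_le (fun s _ => hFd s) (fun s _ => hM s)
      (mem_univ b) (mem_univ a)
  obtain ⟨δ, hδ, hδU⟩ := hψc.isCompact.exists_cthickening_subset_open hU hψU
  -- Outer radii at most `δ` keep the mollification inside `U` at points of the support of `ψ`; the
  -- fixed ratio `2` of the radii is what almost everywhere convergence requires.
  let φ : ℕ → ContDiffBump (0 : Plane) := fun n =>
    ⟨δ / (2 * (n + 1)), δ / (n + 1), by positivity, by gcongr; linarith⟩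
  have hφr : ∀ n, (φ n).rOut ≤ δ := fun n =>
    div_le_self hδ.le (by linarith [(Nat.cast_nonneg n : (0 : ℝ) ≤ n)])
  have hφlim : Tendsto (fun n => (φ n).rOut) atTop (𝓝 0) := by
    simpa using (tendsto_one_div_add_atTop_nhds_zero_nat (𝕜 := ℝ)).const_mul δ |>.congr
      fun n => by simp only [φ]; ring
  have hφK : ∀ᶠ n in atTop, (φ n).rOut ≤ 2 * (φ n).rIn := Eventually.of_forall fun n =>
    le_of_eq (by simp only [φ]; field_simp)
  set f' : Plane → ℝ := U.indicator f with hf'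
  set g' : Plane → ℝ := U.indicator (fun y => inner ℝ (G y) v) with hg'
  have hfi : Integrable f' := (integrable_indicator_iff hUm).2 hf
  have hgi : Integrable g' := (integrable_indicator_iff hUm).2 (hG.inner_const v)
  set fn : ℕ → Plane → ℝ := fun n => (φ n).normed volume ⋆[ContinuousLinearMap.lsmul ℝ ℝ] f' with hfn
  set gn : ℕ → Plane → ℝ := fun n => (φ n).normed volume ⋆[ContinuousLinearMap.lsmul ℝ ℝ] g' with hgn
  have hfni : ∀ n, Integrable (fn n) := fun n => (φ n).integrable_normed.integrable_convolution _ hfi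
  have hgni : ∀ n, Integrable (gn n) := fun n => (φ n).integrable_normed.integrable_convolution _ hgi
  have hfae := ContDiffBump.ae_convolution_tendsto_right_of_locallyIntegrable (μ := volume) hφlim hφK
    hfi.locallyIntegrable
  have hgae := ContDiffBump.ae_convolution_tendsto_right_of_locallyIntegrable (μ := volume) hφlim hφK
    hgi.locallyIntegrable
  have hfL := tendsto_integral_norm_sub_of_integral_norm_le hfi hfni hfae
    fun n => integral_norm_convolution_normed_le (φ n) hfi
  have hgL := tendsto_integral_norm_sub_of_integral_norm_le hgi hgni hgae
    fun n => integral_norm_convolution_normed_le (φ n) hgi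
  have hfnC : ∀ n, ContDiff ℝ 1 (fn n) := fun n =>
    (φ n).hasCompactSupport_normed.contDiff_convolution_left _ (φ n).contDiff_normed
      hfi.locallyIntegrable
  obtain ⟨C₀, hC₀⟩ := hψ.continuous.bounded_above_of_compact_support hψc
  have hψ'c : Continuous fun x => fderiv ℝ ψ x v :=
    (hψ.continuous_fderiv (by simp)).clm_apply continuous_const
  have hψ's : HasCompactSupport fun x => fderiv ℝ ψ x v :=
    (hψc.fderiv (𝕜 := ℝ)).comp_left (g := fun A : Plane →L[ℝ] ℝ => A v) (by simp)
  obtain ⟨C₁, hC₁⟩ := hψ'c.bounded_above_of_compact_support hψ's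
  have hC₀0 : 0 ≤ C₀ := (norm_nonneg _).trans (hC₀ 0)
  have hC₁0 : 0 ≤ C₁ := (norm_nonneg _).trans (hC₁ 0)
  -- Classical integration by parts for the smooth approximations. On the support of `ψ` their
  -- gradient is the mollified weak gradient; elsewhere the factor `ψ` vanishes.
  have hparts : ∀ n, ∫ x, F (fn n x) * fderiv ℝ ψ x v =
      -∫ x, deriv F (fn n x) * gn n x * ψ x := by
    intro n
    have hcomp : ContDiff ℝ 1 (fun x => F (fn n x)) := hF.comp (hfnC n)
    have hcd : Continuous fun x => fderiv ℝ (fun x => F (fn n x)) x v :=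
      (hcomp.continuous_fderiv (by simp)).clm_apply continuous_const
    rw [integral_mul_fderiv_eq_neg_fderiv_mul_of_integrable
      ((hcd.mul hψ.continuous).integrable_of_hasCompactSupport hψc.mul_left)
      ((hcomp.continuous.mul hψ'c).integrable_of_hasCompactSupport hψ's.mul_left)
      ((hcomp.continuous.mul hψ.continuous).integrable_of_hasCompactSupport hψc.mul_left)
      (fun x _ => hcomp.differentiable (by simp) x)
      (fun x _ => hψ.differentiable (by simp) x)]
    congr 1
    refine integral_congr_ae (ae_of_all _ fun x => ?_)
    simp only
    by_cases hx : x ∈ tsupport ψ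
    · congr 1
      have hb : Metric.closedBall x (φ n).rOut ⊆ U :=
        ((Metric.closedBall_subset_closedBall (hφr n)).trans
          (Metric.closedBall_subset_cthickening hx δ)).trans hδU
      have hd := ((hFd (fn n x)).hasDerivAt.comp_hasFDerivAt x
        ((hfnC n).differentiable (by simp) x).hasFDerivAt).fderiv
      rw [show (fun x => F (fn n x)) = F ∘ fn n from rfl, hd]
      simp only [smul_apply, smul_eq_mul]
      rw [hfG.fderiv_convolution hUm hf (φ n) hb v]
    · simp [image_eq_zero_of_notMem_tsupport hx]
  have hFm : ∀ {w : Plane → ℝ}, Integrable w → Integrable fun x => F (w x) * fderiv ℝ ψ x v := by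
    intro w hw
    -- `F ∘ w` need not be integrable on the plane when `F 0 ≠ 0`; the constant is split off and
    -- absorbed by the compact support of `ψ`.
    have h1 : Integrable fun x => (F (w x) - F 0) * fderiv ℝ ψ x v := by
      refine ((hw.norm.const_mul M).mul_const C₁).mono'
        ((((hF.continuous.comp_aestronglyMeasurable hw.1).sub aestronglyMeasurable_const)).mul
          hψ'c.aestronglyMeasurable) (ae_of_all _ fun x => ?_)
      rw [norm_mul]
      gcongr
      · simpa using hLip (w x) 0
      · exact hC₁ x
    refine (h1.add ((hψ'c.integrable_of_hasCompactSupport hψ's).const_mul (F 0))).congr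
      (ae_of_all _ fun x => ?_)
    simp only [Pi.add_apply]
    ring
  have hF'm : ∀ {w k : Plane → ℝ}, Integrable w → Integrable k →
      Integrable fun x => deriv F (w x) * k x * ψ x := by
    intro w k hw hk
    refine ((hk.norm.const_mul M).mul_const C₀).mono'
      (((hF'c.comp_aestronglyMeasurable hw.1).mul hk.1).mul hψ.continuous.aestronglyMeasurable)
      (ae_of_all _ fun x => ?_)
    rw [norm_mul, norm_mul]
    gcongr
    · exact hM _
    · exact hC₀ x
  have hlimL : Tendsto (fun n => ∫ x, F (fn n x) * fderiv ℝ ψ x v) atTop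
      (𝓝 (∫ x, F (f' x) * fderiv ℝ ψ x v)) := by
    refine tendsto_integral_of_norm_sub_le (B := fun n x => M * C₁ * ‖fn n x - f' x‖) (hFm hfi)
      (fun n => hFm (hfni n)) (fun n => (((hfni n).sub hfi).norm.const_mul _)) (fun n x => ?_) ?_
    · rw [← sub_mul, abs_mul]
      calc _ ≤ M * |fn n x - f' x| * C₁ := by gcongr; exacts [hLip _ _, hC₁ x]
        _ = _ := by rw [Real.norm_eq_abs]; ring
    · simp_rw [integral_const_mul]
      simpa using hfL.const_mul (M * C₁)
  -- `deriv F` is only continuous and bounded, so this error has no Lipschitz estimate: it vanishes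
  -- by dominated convergence, with bound `2 * M * |g'|`.
  have hD : Tendsto (fun n => ∫ x, |deriv F (fn n x) - deriv F (f' x)| * |g' x|) atTop (𝓝 0) := by
    have := tendsto_integral_of_dominated_convergence (μ := (volume : Measure Plane))
      (F := fun n x => |deriv F (fn n x) - deriv F (f' x)| * |g' x|) (f := fun _ => 0)
      (fun x => 2 * M * |g' x|)
      (fun n => (((hF'c.comp_aestronglyMeasurable (hfni n).1).sub
        (hF'c.comp_aestronglyMeasurable hfi.1)).norm.mul hgi.1.norm)) (hgi.abs.const_mul _)
      (fun n => ae_of_all _ fun x => ?_) ?_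
    · simpa using this
    · rw [norm_mul, Real.norm_eq_abs, Real.norm_eq_abs, abs_abs, abs_abs]
      gcongr
      refine (abs_sub _ _).trans ?_
      linarith [hM (fn n x), hM (f' x)]
    · filter_upwards [hfae] with x hx
      have h1 := (hF'c.tendsto (f' x)).comp hx
      simpa using ((h1.sub_const (deriv F (f' x))).abs).mul_const |g' x|
  have hDi : ∀ n, Integrable fun x => |deriv F (fn n x) - deriv F (f' x)| * |g' x| := fun n => by
    refine (hgi.abs.const_mul (2 * M)).mono' (((hF'c.comp_aestronglyMeasurable (hfni n).1).sub
        (hF'c.comp_aestronglyMeasurable hfi.1)).norm.mul hgi.1.norm) (ae_of_all _ fun x => ?_)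
    rw [norm_mul, Real.norm_eq_abs, Real.norm_eq_abs, abs_abs, abs_abs]
    gcongr
    refine (abs_sub _ _).trans ?_
    linarith [hM (fn n x), hM (f' x)]
  have hlimR : Tendsto (fun n => ∫ x, deriv F (fn n x) * gn n x * ψ x) atTop
      (𝓝 (∫ x, deriv F (f' x) * g' x * ψ x)) := by
    refine tendsto_integral_of_norm_sub_le (B := fun n x => M * C₀ * ‖gn n x - g' x‖ +
      C₀ * (|deriv F (fn n x) - deriv F (f' x)| * |g' x|)) (hF'm hfi hgi)
      (fun n => hF'm (hfni n) (hgni n))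
      (fun n => (((hgni n).sub hgi).norm.const_mul _).add ((hDi n).const_mul _)) (fun n x => ?_) ?_
    · rw [show deriv F (fn n x) * gn n x * ψ x - deriv F (f' x) * g' x * ψ x =
        deriv F (fn n x) * (gn n x - g' x) * ψ x +
          (deriv F (fn n x) - deriv F (f' x)) * g' x * ψ x by ring]
      refine (abs_add_le _ _).trans ?_
      rw [abs_mul, abs_mul, abs_mul, abs_mul]
      have h0 : |ψ x| ≤ C₀ := hC₀ x
      calc _ ≤ M * |gn n x - g' x| * C₀ + |deriv F (fn n x) - deriv F (f' x)| * |g' x| * C₀ := by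
            gcongr; exact hM _
        _ = _ := by rw [Real.norm_eq_abs]; ring
    · have := (hgL.const_mul (M * C₀)).add (hD.const_mul C₀)
      simp only [mul_zero, add_zero] at this
      refine this.congr fun n => ?_
      rw [integral_add (f := fun x => M * C₀ * ‖gn n x - g' x‖)
        (((hgni n).sub hgi).norm.const_mul _) ((hDi n).const_mul _),
        integral_const_mul, integral_const_mul]
  have hfinal := tendsto_nhds_unique hlimL (hlimR.neg.congr fun n => (hparts n).symm)
  have e1 : ∫ x in U, F (f x) * fderiv ℝ ψ x v = ∫ x, F (f' x) * fderiv ℝ ψ x v := by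
    rw [← setIntegral_eq_integral_of_forall_compl_eq_zero (s := U) (μ := volume)
      (f := fun x => F (f' x) * fderiv ℝ ψ x v)]
    · refine setIntegral_congr_fun hUm fun x hx => ?_
      simp [hf', hx]
    · intro x hx
      have : fderiv ℝ ψ x = 0 := image_eq_zero_of_notMem_tsupport fun h =>
        hx (hψU (tsupport_fderiv_subset ℝ h))
      simp [this]
  have e2 : ∫ x in U, inner ℝ (deriv F (f x) • G x) v * ψ x =
      ∫ x, deriv F (f' x) * g' x * ψ x := by
    rw [← setIntegral_eq_integral_of_forall_compl_eq_zero (s := U) (μ := volume)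
      (f := fun x => deriv F (f' x) * g' x * ψ x)]
    · refine setIntegral_congr_fun hUm fun x hx => ?_
      simp [hf', hg', hx, inner_smul_left]
    · intro x hx
      have : ψ x = 0 := image_eq_zero_of_notMem_tsupport fun h => hx (hψU h)
      simp [this]
  rw [e1, e2, hfinal]

end

/-! ### Calculus of weak gradients and the estimate `u² |∇u|² ∈ L¹`. -/

section

open scoped ENNReal

variable {U : Set Plane} {f h : Plane → ℝ} {G H : Plane → Plane}

theorem MemH1.memLp_weakGrad (hf : MemH1 U f) : MemLp (weakGrad U f) 2 (volume.restrict U) := by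
  rw [weakGrad, dif_pos hf]; exact hf.2.choose_spec.1

theorem MemH1.isWeakGrad (hf : MemH1 U f) : IsWeakGrad U f (weakGrad U f) := by
  rw [weakGrad, dif_pos hf]; exact hf.2.choose_spec.2

theorem MemLp.integrableOn_of_two {E : Type*} [NormedAddCommGroup E] {f : Plane → E}
    (hU : volume U ≠ ⊤) (hf : MemLp f 2 (volume.restrict U)) : IntegrableOn f U := by
  have : IsFiniteMeasure (volume.restrict U) := ⟨by simpa using hU.lt_top⟩
  exact hf.integrable (by norm_num)

/-- Uniqueness of the weak gradient. -/
theorem IsWeakGrad.ae_eq (hU : IsOpen U) (hG : IntegrableOn G U) (hH : IntegrableOn H U)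
    (hfG : IsWeakGrad U f G) (hfH : IsWeakGrad U f H) : G =ᵐ[volume.restrict U] H := by
  have key : ∀ᵐ x, x ∈ U → G x - H x = 0 := by
    refine hU.ae_eq_zero_of_integral_contDiff_smul_eq_zero (hG.sub hH).locallyIntegrableOn
      fun ψ hψ hψc hψU => ?_
    have hb : ∀ {K : Plane → Plane}, IntegrableOn K U → IntegrableOn (fun x => ψ x • K x) U := by
      intro K hK
      obtain ⟨C, hC⟩ := hψ.continuous.bounded_above_of_compact_support hψc
      exact hK.bdd_smul C hψ.continuous.aestronglyMeasurable (ae_of_all _ hC)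
    rw [← setIntegral_eq_integral_of_forall_compl_eq_zero (s := U)]
    · refine ext_inner_left ℝ fun v => ?_
      have h1 := hfG ψ hψ hψc hψU v
      rw [hfH ψ hψ hψc hψU v, neg_inj] at h1
      simp only [smul_sub]
      rw [integral_sub (hb hG) (hb hH), inner_sub_right, inner_zero_right,
        ← integral_inner (hb hG), ← integral_inner (hb hH), sub_eq_zero]
      have e : ∀ K : Plane → Plane, ∀ x, inner ℝ v (ψ x • K x) = inner ℝ (K x) v * ψ x := fun K x => by
        rw [inner_smul_right, real_inner_comm, mul_comm]
      simp only [e]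
      exact h1.symm
    · intro x hx
      rw [image_eq_zero_of_notMem_tsupport fun h => hx (hψU h), zero_smul]
  rw [Filter.EventuallyEq, ae_restrict_iff' hU.measurableSet]
  filter_upwards [key] with x hx hxU using sub_eq_zero.1 (hx hxU)

/-- `weakGrad` is an arbitrary choice, so its rules of calculus hold only almost everywhere: one
exhibits a square integrable weak gradient and appeals to uniqueness. -/
theorem MemH1.weakGrad_ae_eq (hU : IsOpen U) (hUv : volume U ≠ ⊤) (hf : MemLp f 2 (volume.restrict U))
    (hG : MemLp G 2 (volume.restrict U)) (hfG : IsWeakGrad U f G) :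
    MemH1 U f ∧ weakGrad U f =ᵐ[volume.restrict U] G :=
  have hm : MemH1 U f := ⟨hf, G, hG, hfG⟩
  ⟨hm, IsWeakGrad.ae_eq hU (MemLp.integrableOn_of_two hUv hm.memLp_weakGrad)
    (MemLp.integrableOn_of_two hUv hG) hm.isWeakGrad hfG⟩

theorem memLp_comb {p : ℝ≥0∞} {μ : Measure Plane} {e : ℕ → Plane → ℝ} (he : ∀ i, MemLp (e i) p μ)
    (N : ℕ) (c : Fin N → ℝ) : MemLp (comb e N c) p μ :=
  memLp_finsetSum _ fun i _ => (he i).const_mul (c i)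

theorem MemH1.comb (hU : IsOpen U) (hUv : volume U ≠ ⊤) {e : ℕ → Plane → ℝ}
    (he : ∀ i, MemH1 U (e i)) (N : ℕ) (c : Fin N → ℝ) : MemH1 U (comb e N c) ∧
      weakGrad U (comb e N c) =ᵐ[volume.restrict U] fun x => ∑ i, c i • weakGrad U (e i) x := by
  refine MemH1.weakGrad_ae_eq hU hUv (memLp_comb (fun i => (he i).1) N c)
    (memLp_finsetSum _ fun i _ => ((he i).memLp_weakGrad).const_smul (c i)) ?_
  intro ψ hψ hψc hψU v
  have hψ'c : Continuous fun x => fderiv ℝ ψ x v :=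
    (hψ.continuous_fderiv (by simp)).clm_apply continuous_const
  have hψ's : HasCompactSupport fun x => fderiv ℝ ψ x v :=
    (hψc.fderiv (𝕜 := ℝ)).comp_left (g := fun A : Plane →L[ℝ] ℝ => A v) (by simp)
  have i1 : ∀ i, IntegrableOn (fun x => e i x * fderiv ℝ ψ x v) U := fun i => by
    simpa using integrableOn_mul_comp_sub (MemLp.integrableOn_of_two hUv (he i).1) hψ'c hψ's 0
  have i2 : ∀ i, IntegrableOn (fun x => inner ℝ (weakGrad U (e i) x) v * ψ x) U := fun i => by
    simpa using integrableOn_mul_comp_sub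
      ((MemLp.integrableOn_of_two hUv (he i).memLp_weakGrad).inner_const v) hψ.continuous hψc 0
  simp only [AmbrosioTortorelli.comb, Finset.sum_mul, sum_inner, inner_smul_left, mul_assoc]
  rw [integral_finsetSum _ fun (i : Fin N) _ => (i1 i).const_mul _,
    integral_finsetSum _ fun (i : Fin N) _ => (i2 i).const_mul _, ← Finset.sum_neg_distrib]
  refine Finset.sum_congr rfl fun i _ => ?_
  rw [integral_const_mul, integral_const_mul, (he i).isWeakGrad ψ hψ hψc hψU v]
  simp

theorem MemH1.comp (hU : IsOpen U) (hUv : volume U ≠ ⊤) (hf : MemH1 U f) {F : ℝ → ℝ}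
    (hF : ContDiff ℝ 1 F) {M : ℝ} (hM : ∀ s, |deriv F s| ≤ M) :
    MemH1 U (fun x => F (f x)) ∧
      weakGrad U (fun x => F (f x)) =ᵐ[volume.restrict U]
        fun x => deriv F (f x) • weakGrad U f x := by
  have : IsFiniteMeasure (volume.restrict U) := ⟨by simpa using hUv.lt_top⟩
  have hLip : ∀ a b, ‖F a - F b‖ ≤ M * ‖a - b‖ := fun a b =>
    convex_univ.norm_image_sub_le_of_norm_deriv_le (fun s _ => hF.differentiable (by simp) s)
      (fun s _ => hM s) (mem_univ b) (mem_univ a)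
  have h1 : MemLp (fun x => F (f x) - F 0) 2 (volume.restrict U) :=
    MemLp.of_le_mul (c := M) hf.1 ((hF.continuous.comp_aestronglyMeasurable hf.1.1).sub
      aestronglyMeasurable_const) (ae_of_all _ fun x => by simpa using hLip (f x) 0)
  refine MemH1.weakGrad_ae_eq hU hUv ?_ ?_ (IsWeakGrad.comp hU
    (MemLp.integrableOn_of_two hUv hf.1) (MemLp.integrableOn_of_two hUv hf.memLp_weakGrad)
    hf.isWeakGrad hF hM)
  · exact (h1.add (memLp_const (F 0))).ae_eq (ae_of_all _ fun x => by simp)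
  · refine MemLp.of_le_mul (c := M) hf.memLp_weakGrad
      (((hF.continuous_deriv (by simp)).comp_aestronglyMeasurable hf.1.1).smul
        hf.memLp_weakGrad.1) (ae_of_all _ fun x => ?_)
    rw [norm_smul]
    gcongr
    exact hM _

/-- Smooth truncation of `s ↦ s ^ 3`. -/
noncomputable def truncCube (κ s : ℝ) : ℝ := s ^ 3 / (1 + κ * s ^ 2)

variable {κ : ℝ}

theorem contDiff_truncCube (hκ : 0 < κ) : ContDiff ℝ 1 (truncCube κ) := by
  unfold truncCube
  exact (contDiff_id.pow 3).div (by fun_prop) fun s => by positivity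

theorem deriv_truncCube (hκ : 0 < κ) (s : ℝ) :
    deriv (truncCube κ) s = (3 * s ^ 2 + κ * s ^ 4) / (1 + κ * s ^ 2) ^ 2 := by
  have hne : 1 + κ * s ^ 2 ≠ 0 := by positivity
  have h := ((hasDerivAt_pow 3 s).div (((hasDerivAt_pow 2 s).const_mul κ).const_add 1) hne).deriv
  rw [show truncCube κ = (fun x => x ^ 3) / (fun x => 1 + κ * x ^ 2) from rfl, h]
  congr 1
  push_cast
  ring

theorem abs_deriv_truncCube_le (hκ : 0 < κ) (s : ℝ) : |deriv (truncCube κ) s| ≤ 3 / κ := by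
  rw [deriv_truncCube hκ, abs_of_nonneg (by positivity), div_le_div_iff₀ (by positivity) hκ]
  nlinarith [sq_nonneg (κ * s ^ 2), sq_nonneg s, mul_nonneg hκ.le (sq_nonneg s)]

/-- Because `3 s² + κ s⁴ ≥ s² (1 + κ s²)`. The lower bound tends to `s²` as `κ → 0`. -/
theorem le_deriv_truncCube (hκ : 0 < κ) (s : ℝ) :
    s ^ 2 / (1 + κ * s ^ 2) ≤ deriv (truncCube κ) s := by
  rw [deriv_truncCube hκ, div_le_div_iff₀ (by positivity) (by positivity)]
  have : 0 ≤ s ^ 2 * (1 + κ * s ^ 2) * (2 * s ^ 0) := by positivity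
  have h2 : 0 ≤ s ^ 2 * (1 + κ * s ^ 2) := by positivity
  nlinarith

theorem abs_truncCube_le (hκ : 0 < κ) (s : ℝ) : |truncCube κ s| ≤ |s| ^ 3 := by
  unfold truncCube
  rw [abs_div, abs_pow, abs_of_pos (by positivity : 0 < 1 + κ * s ^ 2)]
  exact div_le_self (by positivity) (by nlinarith [sq_nonneg s])

/-- Solutions in `L⁴` of the weak Neumann problem `-Δ u = h` with `h ∈ L⁴` satisfy
`u ^ 2 |∇ u| ^ 2 ∈ L¹`. -/
theorem integrableOn_sq_mul_norm_weakGrad_sq (hU : IsOpen U) (hUv : volume U ≠ ⊤) (hf : MemH1 U f)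
    (hf4 : MemLp f 4 (volume.restrict U)) (hh4 : MemLp h 4 (volume.restrict U))
    (heq : ∀ ψ, MemH1 U ψ → dirichletForm U f ψ = l2Inner U h ψ) :
    IntegrableOn (fun x => f x ^ 2 * ‖weakGrad U f x‖ ^ 2) U := by
  have hf4i : IntegrableOn (fun x => f x ^ 4) U := by
    have : Integrable (fun x => |f x| ^ 4) (volume.restrict U) := by
      simpa using hf4.integrable_norm_pow (by norm_num)
    exact this.congr (ae_of_all _ fun x => (by norm_num : Even 4).pow_abs _)
  have hh4i : IntegrableOn (fun x => h x ^ 4) U := by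
    have : Integrable (fun x => |h x| ^ 4) (volume.restrict U) := by
      simpa using hh4.integrable_norm_pow (by norm_num)
    exact this.congr (ae_of_all _ fun x => (by norm_num : Even 4).pow_abs _)
  have hGi : IntegrableOn (fun x => ‖weakGrad U f x‖ ^ 2) U := by
    have : Integrable (fun x => ‖weakGrad U f x‖ ^ 2) (volume.restrict U) := by
      simpa using hf.memLp_weakGrad.integrable_norm_pow (by norm_num)
    exact this
  set B := ∫ x in U, (h x ^ 4 + f x ^ 4) with hB
  -- Testing with `truncCube κ ∘ f`, which lies in `H¹` because the truncated cube has bounded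
  -- derivative. The right side is at most `∫ |h| |f|³ ≤ B`, uniformly in `κ`.
  have hbound : ∀ κ : ℝ, 0 < κ → ∫⁻ x in U,
      ENNReal.ofReal (f x ^ 2 / (1 + κ * f x ^ 2) * ‖weakGrad U f x‖ ^ 2) ≤ ENNReal.ofReal B := by
    intro κ hκ
    obtain ⟨hm, hae⟩ := hf.comp hU hUv (contDiff_truncCube hκ) (abs_deriv_truncCube_le hκ)
    have h1 := heq _ hm
    have h2 : dirichletForm U f (fun x => truncCube κ (f x)) =
        ∫ x in U, deriv (truncCube κ) (f x) * ‖weakGrad U f x‖ ^ 2 := by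
      unfold dirichletForm
      refine integral_congr_ae ?_
      filter_upwards [hae] with x hx
      rw [hx, inner_smul_right, real_inner_self_eq_norm_sq]
    have hint : IntegrableOn (fun x => deriv (truncCube κ) (f x) * ‖weakGrad U f x‖ ^ 2) U :=
      hGi.bdd_mul (c := 3 / κ)
        (((contDiff_truncCube hκ).continuous_deriv (by simp)).comp_aestronglyMeasurable hf.1.1)
        (ae_of_all _ fun x => abs_deriv_truncCube_le hκ _)
    have hsum : Integrable (fun x => h x ^ 4 + f x ^ 4) (volume.restrict U) := hh4i.add hf4i
    have h3 : l2Inner U h (fun x => truncCube κ (f x)) ≤ B := by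
      refine (le_abs_self _).trans (norm_integral_le_of_norm_le
        (f := fun x => h x * truncCube κ (f x)) (g := fun x => h x ^ 4 + f x ^ 4) hsum (ae_of_all _ fun x => ?_))
      rw [norm_mul, Real.norm_eq_abs, Real.norm_eq_abs]
      calc |h x| * |truncCube κ (f x)| ≤ |h x| * |f x| ^ 3 := by
            gcongr; exact abs_truncCube_le hκ _
        _ ≤ |h x| ^ 4 + |f x| ^ 4 := by
            rcases le_total |h x| |f x| with hle | hle
            · have : |h x| * |f x| ^ 3 ≤ |f x| * |f x| ^ 3 := by gcongr
              have : 0 ≤ |h x| ^ 4 := by positivity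
              linarith [pow_succ' |f x| 3]
            · have : |h x| * |f x| ^ 3 ≤ |h x| * |h x| ^ 3 := by gcongr
              have : 0 ≤ |f x| ^ 4 := by positivity
              linarith [pow_succ' |h x| 3]
        _ = _ := by simp [(by norm_num : Even 4).pow_abs]
    calc _ ≤ ∫⁻ x in U, ENNReal.ofReal (deriv (truncCube κ) (f x) * ‖weakGrad U f x‖ ^ 2) := by
          refine lintegral_mono fun x => ENNReal.ofReal_le_ofReal ?_
          gcongr
          exact le_deriv_truncCube hκ _
      _ = ENNReal.ofReal (∫ x in U, deriv (truncCube κ) (f x) * ‖weakGrad U f x‖ ^ 2) := by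
          refine (ofReal_integral_eq_lintegral_ofReal hint (ae_of_all _ fun x => ?_)).symm
          have h0 := (by positivity : 0 ≤ f x ^ 2 / (1 + κ * f x ^ 2)).trans
            (le_deriv_truncCube hκ (f x))
          exact mul_nonneg h0 (sq_nonneg _)
      _ ≤ _ := by rw [← h2, h1]; exact ENNReal.ofReal_le_ofReal h3
  have hmeas : ∀ κ : ℝ, AEMeasurable (fun x =>
      ENNReal.ofReal (f x ^ 2 / (1 + κ * f x ^ 2) * ‖weakGrad U f x‖ ^ 2)) (volume.restrict U) := by
    intro κ
    have a1 := hf.1.1.aemeasurable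
    have a2 := hf.memLp_weakGrad.1.norm.aemeasurable
    fun_prop
  -- Fatou's lemma along `κ = 1 / (n + 1)` removes the truncation.
  have hfatou := lintegral_liminf_le' (u := atTop) (μ := volume.restrict U) (f := fun (n : ℕ) x =>
      ENNReal.ofReal (f x ^ 2 / (1 + 1 / ((n : ℝ) + 1) * f x ^ 2) * ‖weakGrad U f x‖ ^ 2))
      (fun n => hmeas _)
  have hlim : ∀ x, liminf (fun n : ℕ => ENNReal.ofReal
      (f x ^ 2 / (1 + 1 / ((n : ℝ) + 1) * f x ^ 2) * ‖weakGrad U f x‖ ^ 2)) atTop =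
      ENNReal.ofReal (f x ^ 2 * ‖weakGrad U f x‖ ^ 2) := by
    intro x
    refine Tendsto.liminf_eq (ENNReal.tendsto_ofReal (Tendsto.mul_const _ ?_))
    have h1 : Tendsto (fun n : ℕ => 1 + 1 / ((n : ℝ) + 1) * f x ^ 2) atTop (𝓝 1) := by
      simpa using ((tendsto_one_div_add_atTop_nhds_zero_nat (𝕜 := ℝ)).mul_const (f x ^ 2)).const_add 1
    have h2 := (tendsto_const_nhds (x := f x ^ 2)).div h1 one_ne_zero
    rwa [div_one] at h2
  simp_rw [hlim] at hfatou
  have hfin : ∫⁻ x in U, ENNReal.ofReal (f x ^ 2 * ‖weakGrad U f x‖ ^ 2) ≤ ENNReal.ofReal B := by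
    refine hfatou.trans ?_
    calc _ ≤ liminf (fun _ : ℕ => ENNReal.ofReal B) atTop :=
          liminf_le_liminf (Eventually.of_forall fun n => hbound _ (by positivity))
      _ = _ := liminf_const _
  refine ⟨(hf.1.1.pow 2).mul (hf.memLp_weakGrad.1.norm.pow 2), ?_⟩
  rw [hasFiniteIntegral_iff_ofReal (ae_of_all _ fun x => by positivity)]
  exact hfin.trans_lt ENNReal.ofReal_lt_top

end

/-! ### The Neumann eigenbasis and the products `e_k |∇e_i|`. -/

section

open scoped ENNReal

variable {U : Set Plane} {f h : Plane → ℝ}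

theorem MemLp.integrableOn_mul (hf : MemLp f 2 (volume.restrict U))
    (hh : MemLp h 2 (volume.restrict U)) : IntegrableOn (fun x => f x * h x) U :=
  MemLp.integrable_mul hf hh

theorem MemLp.integrableOn_inner {G H : Plane → Plane} (hG : MemLp G 2 (volume.restrict U))
    (hH : MemLp H 2 (volume.restrict U)) : IntegrableOn (fun x => inner ℝ (G x) (H x)) U := by
  have : Integrable (fun x => ‖G x‖ * ‖H x‖) (volume.restrict U) := MemLp.integrable_mul hG.norm hH.norm
  exact this.mono (hG.1.inner hH.1) (ae_of_all _ fun x => by simpa using norm_inner_le_norm (𝕜 := ℝ) (G x) (H x))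

theorem l2Inner_comb_left {e : ℕ → Plane → ℝ} (he : ∀ i, MemLp (e i) 2 (volume.restrict U))
    (hh : MemLp h 2 (volume.restrict U)) {N : ℕ} (c : Fin N → ℝ) :
    l2Inner U (comb e N c) h = ∑ i, c i * l2Inner U (e i) h := by
  simp only [l2Inner, comb, Finset.sum_mul, mul_assoc]
  rw [integral_finsetSum _ fun (i : Fin N) _ => (MemLp.integrableOn_mul (he i) hh).const_mul _]
  simp_rw [integral_const_mul]

theorem l2Inner_comm (f h : Plane → ℝ) : l2Inner U f h = l2Inner U h f := by
  simp only [l2Inner, mul_comm]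

theorem l2NormSq_eq_l2Inner (f : Plane → ℝ) : l2NormSq U f = l2Inner U f f := by
  simp only [l2NormSq, l2Inner, sq]

theorem dirichletForm_self (f : Plane → ℝ) :
    dirichletForm U f f = ∫ x in U, ‖weakGrad U f x‖ ^ 2 := by
  simp only [dirichletForm, real_inner_self_eq_norm_sq]

theorem dirichletForm_comb_left (hU : IsOpen U) (hUv : volume U ≠ ⊤) {e : ℕ → Plane → ℝ}
    (he : ∀ i, MemH1 U (e i)) (hh : MemH1 U h) {N : ℕ} (c : Fin N → ℝ) :
    dirichletForm U (comb e N c) h = ∑ i, c i * dirichletForm U (e i) h := by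
  have h1 : dirichletForm U (comb e N c) h =
      ∫ x in U, ∑ i, c i * inner ℝ (weakGrad U (e i) x) (weakGrad U h x) := by
    refine integral_congr_ae ?_
    filter_upwards [(MemH1.comb hU hUv he N c).2] with x hx
    rw [hx, sum_inner]
    simp only [inner_smul_left, conj_trivial]
  rw [h1, integral_finsetSum _ fun (i : Fin N) _ => (MemLp.integrableOn_inner
    (he i).memLp_weakGrad hh.memLp_weakGrad).const_mul _]
  simp_rw [integral_const_mul]
  rfl

namespace IsNeumannEigenbasis

variable {e : ℕ → Plane → ℝ} {lam : ℕ → ℝ} (he : IsNeumannEigenbasis U e lam)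

include he

theorem lam_nonneg (i : ℕ) : 0 ≤ lam i := by
  have h1 := he.eigen i (e i) (he.memH1 i)
  rw [← l2NormSq_eq_l2Inner, he.normalized, mul_one, dirichletForm_self] at h1
  rw [← h1]
  exact integral_nonneg fun x => sq_nonneg _

/-- By the eigenvalue equation the `H¹` product is `(1 + lam i)` times the `L²` product, and `lam i
≥ 0`. So `H¹` orthogonality passes to `L²`. -/
theorem l2Inner_eq (i j : ℕ) : l2Inner U (e i) (e j) = if i = j then 1 else 0 := by
  split_ifs with hij
  · rw [hij, ← l2NormSq_eq_l2Inner, he.normalized]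
  · have h1 := he.orthogonal i j hij
    rw [h1Inner, he.eigen i _ (he.memH1 j), ← one_add_mul] at h1
    have := he.lam_nonneg i
    exact (mul_eq_zero.1 h1).resolve_left (by positivity)

theorem l2Inner_comb_basis {N : ℕ} (c : Fin N → ℝ) (i : Fin N) :
    l2Inner U (comb e N c) (e i) = c i := by
  rw [l2Inner_comb_left (fun i => (he.memH1 i).1) (he.memH1 i).1]
  simp [he.l2Inner_eq, Fin.val_inj]

theorem l2Inner_comb_comb {N : ℕ} (c d : Fin N → ℝ) :
    l2Inner U (comb e N c) (comb e N d) = ∑ i, c i * d i := by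
  rw [l2Inner_comb_left (fun i => (he.memH1 i).1) (memLp_comb (fun i => (he.memH1 i).1) N d)]
  simp_rw [l2Inner_comm (e _) (comb e N d), he.l2Inner_comb_basis]

theorem l2NormSq_comb {N : ℕ} (c : Fin N → ℝ) : l2NormSq U (comb e N c) = ∑ i, c i ^ 2 := by
  simp_rw [l2NormSq_eq_l2Inner, he.l2Inner_comb_comb, sq]

/-- A combination of eigenfunctions solves a Neumann problem whose right side is again a
combination, hence again in `L⁴`. -/
theorem dirichletForm_comb (hU : IsOpen U) (hUv : volume U ≠ ⊤) {N : ℕ} (c : Fin N → ℝ)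
    {ψ : Plane → ℝ} (hψ : MemH1 U ψ) :
    dirichletForm U (comb e N c) ψ = l2Inner U (comb e N fun i => c i * lam i) ψ := by
  rw [dirichletForm_comb_left hU hUv he.memH1 hψ, l2Inner_comb_left (fun i => (he.memH1 i).1) hψ.1]
  simp_rw [he.eigen _ ψ hψ, mul_assoc]

theorem memLp_four (hU : IsC2Domain U) (i : ℕ) : MemLp (e i) 4 (volume.restrict U) :=
  AmbrosioTortorelli.memLp_four hU (he.memH1 i).1 (he.memH1 i).memLp_weakGrad (he.memH1 i).isWeakGrad

/-- The products `e_k |∇ e_i|` are square integrable. -/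
theorem integrableOn_sq_mul_norm_weakGrad_sq (hU : IsC2Domain U) (i k : ℕ) :
    IntegrableOn (fun x => e k x ^ 2 * ‖weakGrad U (e i) x‖ ^ 2) U := by
  have hUv : volume U ≠ ⊤ := hU.isBounded.measure_lt_top.ne
  have hcomb : ∀ {N : ℕ} (c : Fin N → ℝ), IntegrableOn
      (fun x => (∑ i, c i * e i x) ^ 2 * ‖∑ i, c i • weakGrad U (e i) x‖ ^ 2) U := by
    intro N c
    obtain ⟨hm, hae⟩ := MemH1.comb hU.isOpen hUv he.memH1 N c
    have := AmbrosioTortorelli.integrableOn_sq_mul_norm_weakGrad_sq hU.isOpen hUv hm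
      (memLp_comb (he.memLp_four hU) N c) (memLp_comb (he.memLp_four hU) N fun i => c i * lam i)
      (fun ψ hψ => he.dirichletForm_comb hU.isOpen hUv c hψ)
    refine Integrable.congr this ?_
    filter_upwards [hae] with x hx
    rw [hx]
    rfl
  have hpm : ∀ s t : ℝ, IntegrableOn (fun x => (s * e i x + t * e k x) ^ 2 *
      ‖s • weakGrad U (e i) x + t • weakGrad U (e k) x‖ ^ 2) U := by
    intro s t
    -- Adding the two indicators keeps the formula correct when `i = k`; the index range `i + k + 1`
    -- contains both.
    let c : Fin (i + k + 1) → ℝ := fun j => (if (j : ℕ) = i then s else 0) + if (j : ℕ) = k then t else 0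
    refine (hcomb c).congr (ae_of_all _ fun x => ?_)
    have aux : ∀ {E : Type} [AddCommGroup E] [Module ℝ E] (w : ℕ → E),
        ∑ j, c j • w j = s • w i + t • w k := by
      intro E _ _ w
      rw [Fin.sum_univ_eq_sum_range (fun j => ((if j = i then s else 0) + if j = k then t else 0) • w j)]
      simp only [add_smul, ite_smul, zero_smul, Finset.sum_add_distrib, Finset.sum_ite_eq',
        Finset.mem_range]
      rw [if_pos (by omega), if_pos (by omega)]
    have a1 := aux fun j => e j x
    have a2 := aux fun j => weakGrad U (e j) x
    simp only [smul_eq_mul] at a1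
    simp only [a1, a2]
  have hi := hpm 1 0
  have hk := hpm 0 1
  have hp := hpm 1 1
  have hn := hpm 1 (-1)
  simp only [one_mul, zero_mul, one_smul, zero_smul, add_zero, zero_add, neg_smul,
    neg_mul] at hi hk hp hn
  -- Polarization. With `a, b` the values, `p, q` the gradient norms and `r` the inner product, the
  -- `±` terms add up to `2 (a² + b²)(p² + q²) + 8 a b r`. The two added multiples of `4` absorb the
  -- mixed term, and `b² p²` remains.
  refine Integrable.mono' (((hp.add hn).add (hi.const_mul 4)).add (hk.const_mul 4))
    (((he.memH1 k).1.1.pow 2).mul ((he.memH1 i).memLp_weakGrad.1.norm.pow 2))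
    (ae_of_all _ fun x => ?_)
  simp only [Pi.add_apply, norm_add_sq_real, norm_neg, inner_neg_right]
  rw [Real.norm_of_nonneg (by positivity)]
  have hcs := abs_real_inner_le_norm (weakGrad U (e i) x) (weakGrad U (e k) x)
  set a := e i x
  set b := e k x
  set r := inner ℝ (weakGrad U (e i) x) (weakGrad U (e k) x)
  set p := ‖weakGrad U (e i) x‖
  set q := ‖weakGrad U (e k) x‖
  have h1 : -(a * b * r) ≤ |a| * |b| * (p * q) := by
    refine (neg_le_abs _).trans ?_
    rw [abs_mul, abs_mul]
    gcongr
  have h2 : |a| * |b| * (p * q) * 2 ≤ a ^ 2 * p ^ 2 + b ^ 2 * q ^ 2 := by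
    rw [← sq_abs a, ← sq_abs b]
    nlinarith [sq_nonneg (|a| * p - |b| * q)]
  nlinarith [sq_nonneg (a * q), sq_nonneg (a * p), sq_nonneg (b * q), sq_nonneg (b * p)]

end IsNeumannEigenbasis

end

/-! ### The cutoff and the energy density as a function of the coefficients. -/

section

open scoped ENNReal

namespace IsCutoff

variable {φ : ℝ → ℝ} (hφ : IsCutoff φ)

include hφ

theorem abs_le_two (s : ℝ) : |φ s| ≤ 2 := by
  have h1 : -1 ≤ φ s := by
    rw [← hφ.eq_neg_one (min s (-1)) (min_le_right _ _)]
    exact hφ.monotone (min_le_left _ _)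
  have h2 : φ s ≤ 2 := by
    rw [← hφ.eq_two (max s 2) (le_max_right _ _)]
    exact hφ.monotone (le_max_left _ _)
  rw [abs_le]
  constructor <;> linarith

theorem sq_le_four (s : ℝ) : φ s ^ 2 ≤ 4 := by
  nlinarith [abs_le.1 (hφ.abs_le_two s)]

theorem continuous_deriv : Continuous (deriv φ) := hφ.smooth.continuous_deriv (by simp)

theorem hasDerivAt (s : ℝ) : HasDerivAt φ (deriv φ s) s :=
  (hφ.smooth.differentiable (by simp) s).hasDerivAt

/-- `φ` is constant outside `[-1, 2]`, so `φ'` is continuous with compact support, and `|φ| ≤ 2`. -/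
theorem exists_bound_deriv_mul : ∃ M, ∀ s, |deriv φ s * φ s| ≤ M := by
  have hc : HasCompactSupport (deriv φ) :=
    HasCompactSupport.intro (isCompact_Icc (a := -1) (b := 2)) fun s hs => by
      rw [mem_Icc, not_and_or, not_le, not_le] at hs
      rcases hs with hs | hs
      · have : φ =ᶠ[𝓝 s] fun _ => -1 := by
          filter_upwards [Iio_mem_nhds hs] with a ha using hφ.eq_neg_one a (le_of_lt ha)
        rw [this.deriv_eq]; simp
      · have : φ =ᶠ[𝓝 s] fun _ => 2 := by
          filter_upwards [Ioi_mem_nhds hs] with a ha using hφ.eq_two a (le_of_lt ha)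
        rw [this.deriv_eq]; simp
  obtain ⟨M, hM⟩ := hφ.continuous_deriv.bounded_above_of_compact_support hc
  refine ⟨M * 2, fun s => ?_⟩
  rw [abs_mul]
  exact mul_le_mul (hM s) (hφ.abs_le_two s) (abs_nonneg _) ((norm_nonneg _).trans (hM s))

end IsCutoff

section Density

variable {N : ℕ}

/-- Pairs of coefficient vectors. -/
abbrev Coeffs (N : ℕ) : Type := (Fin N → ℝ) × (Fin N → ℝ)

/-- The `i`-th coordinate of the first component. -/
def fstCoord (i : Fin N) : Coeffs N →L[ℝ] ℝ :=
  (ContinuousLinearMap.proj i).comp (ContinuousLinearMap.fst ℝ _ _)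

/-- The `i`-th coordinate of the second component. -/
def sndCoord (i : Fin N) : Coeffs N →L[ℝ] ℝ :=
  (ContinuousLinearMap.proj i).comp (ContinuousLinearMap.snd ℝ _ _)

@[simp] theorem fstCoord_apply (i : Fin N) (p : Coeffs N) : fstCoord i p = p.1 i := rfl

@[simp] theorem sndCoord_apply (i : Fin N) (p : Coeffs N) : sndCoord i p = p.2 i := rfl

theorem norm_fstCoord_le (i : Fin N) : ‖fstCoord i‖ ≤ 1 :=
  ContinuousLinearMap.opNorm_le_bound _ zero_le_one fun p => by
    rw [one_mul]; exact (norm_le_pi_norm p.1 i).trans (norm_fst_le p)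

theorem norm_sndCoord_le (i : Fin N) : ‖sndCoord i‖ ≤ 1 :=
  ContinuousLinearMap.opNorm_le_bound _ zero_le_one fun p => by
    rw [one_mul]; exact (norm_le_pi_norm p.2 i).trans (norm_snd_le p)

/-- The Ambrosio–Tortorelli energy density in terms of the coefficients, when the values and
gradients of the basis functions are `E i` and `G i`, and `γ` is the value of the datum. -/
noncomputable def density (ε η : ℝ) (φ : ℝ → ℝ) (γ : ℝ) (E : Fin N → ℝ) (G : Fin N → Plane) (p : Coeffs N) : ℝ :=
  1 / 2 * ((η + φ (∑ i, p.2 i * E i) ^ 2) * ‖∑ i, p.1 i • G i‖ ^ 2 + (∑ i, p.1 i * E i - γ) ^ 2)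
    + ((1 - ∑ i, p.2 i * E i) ^ 2 / (4 * ε) + ε * ‖∑ i, p.2 i • G i‖ ^ 2)

/-- Partial derivative of `density` with respect to the `i`-th coefficient of `u`. -/
noncomputable def densityFst (η : ℝ) (φ : ℝ → ℝ) (γ : ℝ) (E : Fin N → ℝ) (G : Fin N → Plane) (p : Coeffs N)
    (i : Fin N) : ℝ :=
  (η + φ (∑ i, p.2 i * E i) ^ 2) * inner ℝ (∑ i, p.1 i • G i) (G i)
    + (∑ i, p.1 i * E i - γ) * E i

/-- Partial derivative of `density` with respect to the `i`-th coefficient of `z`. -/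
noncomputable def densitySnd (ε : ℝ) (φ : ℝ → ℝ) (E : Fin N → ℝ) (G : Fin N → Plane) (p : Coeffs N)
    (i : Fin N) : ℝ :=
  2 * ε * inner ℝ (∑ i, p.2 i • G i) (G i)
    + deriv φ (∑ i, p.2 i * E i) * φ (∑ i, p.2 i * E i) * ‖∑ i, p.1 i • G i‖ ^ 2 * E i
    - (1 - ∑ i, p.2 i * E i) / (2 * ε) * E i

theorem hasFDerivAt_density {ε η : ℝ} (hε : 0 < ε) {φ : ℝ → ℝ} (hφ : IsCutoff φ) (γ : ℝ)
    (E : Fin N → ℝ) (G : Fin N → Plane) (p : Coeffs N) :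
    HasFDerivAt (density ε η φ γ E G)
      (∑ i, densityFst η φ γ E G p i • fstCoord i + ∑ i, densitySnd ε φ E G p i • sndCoord i) p := by
  have hu : HasFDerivAt (fun p : Coeffs N => ∑ i, p.1 i * E i) (∑ i, E i • fstCoord i) p :=
    HasFDerivAt.fun_sum fun i _ => (fstCoord i).hasFDerivAt.mul_const (E i)
  have hz : HasFDerivAt (fun p : Coeffs N => ∑ i, p.2 i * E i) (∑ i, E i • sndCoord i) p :=
    HasFDerivAt.fun_sum fun i _ => (sndCoord i).hasFDerivAt.mul_const (E i)
  have hgu : HasFDerivAt (fun p : Coeffs N => ∑ i, p.1 i • G i)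
      (∑ i, (fstCoord i).smulRight (G i)) p :=
    HasFDerivAt.fun_sum fun i _ => (fstCoord i).hasFDerivAt.smul_const (G i)
  have hgz : HasFDerivAt (fun p : Coeffs N => ∑ i, p.2 i • G i)
      (∑ i, (sndCoord i).smulRight (G i)) p :=
    HasFDerivAt.fun_sum fun i _ => (sndCoord i).hasFDerivAt.smul_const (G i)
  have hφz := (hφ.hasDerivAt (∑ i, p.2 i * E i)).comp_hasFDerivAt p hz
  have h1 := ((((hφz.pow 2).const_add η).mul hgu.norm_sq).add ((hu.sub_const γ).pow 2)).const_mul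
    (1 / 2)
  have h2 := (((hz.const_sub 1).pow 2).mul_const (4 * ε)⁻¹).add (hgz.norm_sq.const_mul ε)
  refine ((h1.add h2).congr_of_eventuallyEq (Eventually.of_forall fun p => ?_)).congr_fderiv
    (ContinuousLinearMap.ext fun q => ?_)
  · simp [density, div_eq_mul_inv]
  have e1 : ∑ i, densityFst η φ γ E G p i * q.1 i =
      (η + φ (∑ i, p.2 i * E i) ^ 2) * inner ℝ (∑ i, p.1 i • G i) (∑ i, q.1 i • G i) +
        (∑ i, p.1 i * E i - γ) * ∑ i, E i * q.1 i := by
    simp only [densityFst, inner_sum, inner_smul_right, Finset.mul_sum, ← Finset.sum_add_distrib]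
    exact Finset.sum_congr rfl fun i _ => by ring
  have e2 : ∑ i, densitySnd ε φ E G p i * q.2 i =
      2 * ε * inner ℝ (∑ i, p.2 i • G i) (∑ i, q.2 i • G i) +
        (deriv φ (∑ i, p.2 i * E i) * φ (∑ i, p.2 i * E i) * ‖∑ i, p.1 i • G i‖ ^ 2 -
          (1 - ∑ i, p.2 i * E i) / (2 * ε)) * ∑ i, E i * q.2 i := by
    simp only [densitySnd, inner_sum, inner_smul_right]
    rw [Finset.mul_sum, Finset.mul_sum, ← Finset.sum_add_distrib]
    exact Finset.sum_congr rfl fun i _ => by ring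
  simp only [add_apply, smul_apply, sum_apply, smul_eq_mul, fstCoord_apply, sndCoord_apply, e1, e2,
    ContinuousLinearMap.comp_apply, innerSL_apply_apply, ContinuousLinearMap.smulRight_apply,
    neg_apply, Function.comp_apply]
  field_simp
  ring

end Density

end

/-! ### Differentiation of the energy under the integral sign. -/

section

open scoped ENNReal

section Energy

variable {N : ℕ} {μ : Measure Plane} {ε η : ℝ} {φ : ℝ → ℝ} {g : Plane → ℝ}
  {E : Fin N → Plane → ℝ} {G : Fin N → Plane → Plane}

theorem abs_sum_mul_le_of_norm_le {R : ℝ} {c : Fin N → ℝ} (hc : ‖c‖ ≤ R) (a : Fin N → ℝ) :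
    |∑ i, c i * a i| ≤ R * ∑ i, |a i| := by
  rw [Finset.mul_sum]
  refine (Finset.abs_sum_le_sum_abs _ _).trans (Finset.sum_le_sum fun i _ => ?_)
  rw [abs_mul]
  gcongr
  exact (norm_le_pi_norm c i).trans hc

theorem norm_sum_smul_le_of_norm_le {R : ℝ} {c : Fin N → ℝ} (hc : ‖c‖ ≤ R) (a : Fin N → Plane) :
    ‖∑ i, c i • a i‖ ≤ R * ∑ i, ‖a i‖ := by
  rw [Finset.mul_sum]
  refine (norm_sum_le _ _).trans (Finset.sum_le_sum fun i _ => ?_)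
  rw [norm_smul]
  gcongr
  exact (norm_le_pi_norm c i).trans hc

/-- Common bound for the partial derivatives of the energy density. -/
noncomputable def derivBound (ε η M R γ : ℝ) (E : Fin N → ℝ) (G : Fin N → Plane) : ℝ :=
  ((η + 4) * R + 2 * ε * R) * (∑ i, ‖G i‖) ^ 2 + (R + R / (2 * ε)) * (∑ i, |E i|) ^ 2 +
    (|γ| + 1 / (2 * ε)) * (∑ i, |E i|) +
    M * R ^ 2 * ((∑ i, ‖G i‖) ^ 2 + (∑ i, ‖G i‖) ^ 2 * (∑ i, |E i|) ^ 2)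

theorem abs_densityFst_le (hε : 0 < ε) (hη : 0 < η) (hφ : IsCutoff φ) {M R : ℝ} (hM : 0 ≤ M)
    (hR : 0 ≤ R) (γ : ℝ)
    (E : Fin N → ℝ) (G : Fin N → Plane) {p : Coeffs N} (hp : ‖p‖ ≤ R) (i : Fin N) :
    |densityFst η φ γ E G p i| ≤ derivBound ε η M R γ E G := by
  have hu := abs_sum_mul_le_of_norm_le ((norm_fst_le p).trans hp) E
  have hgu := norm_sum_smul_le_of_norm_le ((norm_fst_le p).trans hp) G
  have hEi : |E i| ≤ ∑ i, |E i| :=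
    Finset.single_le_sum (f := fun i => |E i|) (fun i _ => abs_nonneg _) (Finset.mem_univ i)
  have hGi : ‖G i‖ ≤ ∑ i, ‖G i‖ :=
    Finset.single_le_sum (f := fun i => ‖G i‖) (fun i _ => norm_nonneg _) (Finset.mem_univ i)
  have hφ4 := hφ.sq_le_four (∑ i, p.2 i * E i)
  unfold densityFst derivBound
  set S₀ := ∑ i, |E i|
  set S₁ := ∑ i, ‖G i‖
  have hS₀ : 0 ≤ S₀ := (abs_nonneg _).trans hEi
  have hS₁ : 0 ≤ S₁ := (norm_nonneg _).trans hGi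
  calc _ ≤ |(η + φ (∑ i, p.2 i * E i) ^ 2) * inner ℝ (∑ i, p.1 i • G i) (G i)| +
        |(∑ i, p.1 i * E i - γ) * E i| := abs_add_le _ _
    _ ≤ (η + 4) * (R * S₁ * S₁) + (R * S₀ + |γ|) * S₀ := by
        rw [abs_mul, abs_mul]
        gcongr
        · rw [abs_of_nonneg (by positivity)]; linarith
        · exact (abs_real_inner_le_norm _ _).trans (by gcongr)
        · exact (abs_sub _ _).trans (by gcongr)
    _ ≤ _ := by
        have h1 : 0 ≤ 2 * ε * R * S₁ ^ 2 + R / (2 * ε) * S₀ ^ 2 + 1 / (2 * ε) * S₀ +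
          M * R ^ 2 * (S₁ ^ 2 + S₁ ^ 2 * S₀ ^ 2) := by positivity
        linarith

theorem abs_densitySnd_le (hε : 0 < ε) (hη : 0 < η) {M R : ℝ}
    (hM : ∀ s, |deriv φ s * φ s| ≤ M) (hR : 0 ≤ R) (γ : ℝ)
    (E : Fin N → ℝ) (G : Fin N → Plane) {p : Coeffs N} (hp : ‖p‖ ≤ R) (i : Fin N) :
    |densitySnd ε φ E G p i| ≤ derivBound ε η M R γ E G := by
  have hz := abs_sum_mul_le_of_norm_le ((norm_snd_le p).trans hp) E
  have hgu := norm_sum_smul_le_of_norm_le ((norm_fst_le p).trans hp) G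
  have hgz := norm_sum_smul_le_of_norm_le ((norm_snd_le p).trans hp) G
  have hEi : |E i| ≤ ∑ i, |E i| :=
    Finset.single_le_sum (f := fun i => |E i|) (fun i _ => abs_nonneg _) (Finset.mem_univ i)
  have hGi : ‖G i‖ ≤ ∑ i, ‖G i‖ :=
    Finset.single_le_sum (f := fun i => ‖G i‖) (fun i _ => norm_nonneg _) (Finset.mem_univ i)
  have hM0 : 0 ≤ M := (abs_nonneg _).trans (hM 0)
  unfold densitySnd derivBound
  set S₀ := ∑ i, |E i|
  set S₁ := ∑ i, ‖G i‖
  have hS₀ : 0 ≤ S₀ := (abs_nonneg _).trans hEi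
  have hS₁ : 0 ≤ S₁ := (norm_nonneg _).trans hGi
  set z := ∑ i, p.2 i * E i
  calc _ ≤ |2 * ε * inner ℝ (∑ i, p.2 i • G i) (G i)| +
        |deriv φ z * φ z * ‖∑ i, p.1 i • G i‖ ^ 2 * E i| + |(1 - z) / (2 * ε) * E i| :=
        (abs_sub _ _).trans (by gcongr; exact abs_add_le _ _)
    _ ≤ 2 * ε * (R * S₁ * S₁) + M * (R * S₁) ^ 2 * S₀ + (1 + R * S₀) / (2 * ε) * S₀ := by
        rw [abs_mul, abs_mul _ (E i), abs_mul _ (‖_‖ ^ 2), abs_mul _ (E i), abs_div,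
          abs_of_pos (by positivity : 0 < 2 * ε), abs_of_nonneg (sq_nonneg (‖∑ i, p.1 i • G i‖))]
        gcongr
        · exact (abs_real_inner_le_norm _ _).trans (by gcongr)
        · exact hM z
        · exact (abs_sub _ _).trans (by rw [abs_one]; gcongr)
    _ ≤ _ := by
        have h1 : 0 ≤ (η + 4) * R * S₁ ^ 2 + R * S₀ ^ 2 + |γ| * S₀ := by positivity
        -- The cubic term, bounded through `S₀ ≤ 1 + S₀²`: its integrability is reduced to that of
        -- `|∇e_i|²` and `e_k² |∇e_i|²`.
        have h2 : M * R ^ 2 * (S₁ ^ 2 * S₀) ≤ M * R ^ 2 * (S₁ ^ 2 + S₁ ^ 2 * S₀ ^ 2) := by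
          gcongr
          nlinarith [mul_nonneg (sq_nonneg S₁) (sq_nonneg (S₀ - 1)),
            mul_nonneg (sq_nonneg S₁) (sq_nonneg S₀), sq_nonneg S₁]
        have h3 : (1 + R * S₀) / (2 * ε) * S₀ = 1 / (2 * ε) * S₀ + R / (2 * ε) * S₀ ^ 2 := by
          field_simp
        rw [h3]
        linarith

theorem norm_sum_smul_le_card_mul {H : Type*} [NormedAddCommGroup H] [NormedSpace ℝ H]
    {a : Fin N → ℝ} {L : Fin N → H} {B : ℝ}
    (ha : ∀ i, |a i| ≤ B) (hL : ∀ i, ‖L i‖ ≤ 1) : ‖∑ i, a i • L i‖ ≤ N * B := by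
  refine (norm_sum_le _ _).trans ?_
  calc ∑ i, ‖a i • L i‖ ≤ ∑ _i : Fin N, B := Finset.sum_le_sum fun i _ => by
        rw [norm_smul]
        calc _ ≤ |a i| * 1 := mul_le_mul_of_nonneg_left (hL i) (abs_nonneg _)
          _ ≤ B := by rw [mul_one]; exact ha i
    _ = N * B := by simp

theorem integrable_sum_smul {H : Type*} [NormedAddCommGroup H] [NormedSpace ℝ H]
    {a : Plane → Fin N → ℝ} (ha : ∀ i, Integrable (fun x => a x i) μ) (L : Fin N → H) :
    Integrable (fun x => ∑ i, a x i • L i) μ :=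
  integrable_finsetSum _ fun i _ => (ha i).smul_const (L i)

theorem integral_sum_smul {H : Type*} [NormedAddCommGroup H] [NormedSpace ℝ H] [CompleteSpace H]
    {a : Plane → Fin N → ℝ} (ha : ∀ i, Integrable (fun x => a x i) μ) (L : Fin N → H) :
    ∫ x, ∑ i, a x i • L i ∂μ = ∑ i, (∫ x, a x i ∂μ) • L i := by
  rw [integral_finsetSum _ fun i _ => (ha i).smul_const (L i)]
  simp only [integral_smul_const]

/-- Differentiation under the integral sign, in coordinates. -/
theorem hasFDerivAt_integral_of_sum_smul {H : Type*} [NormedAddCommGroup H] [NormedSpace ℝ H]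
    {L L' : Fin N → H →L[ℝ] ℝ} (hL : ∀ i, ‖L i‖ ≤ 1) (hL' : ∀ i, ‖L' i‖ ≤ 1)
    {f : H → Plane → ℝ} {A B : H → Plane → Fin N → ℝ}
    {b : Plane → ℝ} {p : H} (hf : ∀ q, Integrable (f q) μ)
    (hA : ∀ i, Integrable (fun x => A p x i) μ) (hB : ∀ i, Integrable (fun x => B p x i) μ)
    (hb : Integrable b μ) (hAb : ∀ x, ∀ q ∈ Metric.ball p 1, ∀ i, |A q x i| ≤ b x)
    (hBb : ∀ x, ∀ q ∈ Metric.ball p 1, ∀ i, |B q x i| ≤ b x)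
    (hd : ∀ x q, HasFDerivAt (fun q => f q x)
      (∑ i, A q x i • L i + ∑ i, B q x i • L' i) q) :
    HasFDerivAt (fun q => ∫ x, f q x ∂μ) (∑ i, (∫ x, A p x i ∂μ) • L i +
      ∑ i, (∫ x, B p x i ∂μ) • L' i) p := by
  have hA' := integrable_sum_smul hA L
  have hB' := integrable_sum_smul hB L'
  have key := hasFDerivAt_integral_of_dominated_of_fderiv_le (𝕜 := ℝ) (μ := μ) (F := f)
    (F' := fun q x => ∑ i, A q x i • L i + ∑ i, B q x i • L' i)
    (bound := fun x => N * b x + N * b x)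
    (Metric.ball_mem_nhds p one_pos) (Eventually.of_forall fun q => (hf q).1) (hf p) (hA'.add hB').1
    (ae_of_all _ fun x q hq => (norm_add_le _ _).trans (add_le_add
      (norm_sum_smul_le_card_mul (hAb x q hq) hL) (norm_sum_smul_le_card_mul (hBb x q hq) hL')))
    ((hb.const_mul _).add (hb.const_mul _)) (ae_of_all _ fun x q _ => hd x q)
  rwa [integral_add hA' hB', integral_sum_smul hA L, integral_sum_smul hB L'] at key

theorem integrable_norm_sq {F : Type*} [NormedAddCommGroup F] {w : Plane → F} (hw : MemLp w 2 μ) :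
    Integrable (fun x => ‖w x‖ ^ 2) μ := by
  simpa using hw.integrable_norm_pow (by norm_num)

theorem memLp_sum_mul (hE : ∀ i, MemLp (E i) 2 μ) (c : Fin N → ℝ) : MemLp (fun x => ∑ i, c i * E i x) 2 μ :=
  memLp_finsetSum _ fun i _ => (hE i).const_mul (c i)

theorem memLp_sum_smul (hG : ∀ i, MemLp (G i) 2 μ) (c : Fin N → ℝ) : MemLp (fun x => ∑ i, c i • G i x) 2 μ :=
  memLp_finsetSum _ fun i _ => (hG i).const_smul (c i)

variable (hE : ∀ i, MemLp (E i) 2 μ) (hG : ∀ i, MemLp (G i) 2 μ)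
  (hEG : ∀ i k, Integrable (fun x => E k x ^ 2 * ‖G i x‖ ^ 2) μ) (hg : MemLp g 2 μ)

include hE hG hEG hg in
-- All terms are products of two `L²` functions except `(∑ ‖G i‖)² (∑ |E i|)²`. That one is at most
-- `N²` times the sum of the products `E k ² ‖G i‖²`, and this is where `hEG` enters.
theorem integrable_derivBound [IsFiniteMeasure μ] (M R : ℝ) :
    Integrable (fun x => derivBound ε η M R (g x) (fun i => E i x) (fun i => G i x)) μ := by
  have hS₀ : MemLp (fun x => ∑ i, |E i x|) 2 μ := memLp_finsetSum _ fun i _ => (hE i).abs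
  have hS₁ : MemLp (fun x => ∑ i, ‖G i x‖) 2 μ := memLp_finsetSum _ fun i _ => (hG i).norm
  have h1 : Integrable (fun x => (∑ i, ‖G i x‖) ^ 2) μ := by simpa using integrable_norm_sq hS₁
  have h0 : Integrable (fun x => (∑ i, |E i x|) ^ 2) μ := by simpa using integrable_norm_sq hS₀
  have hγ : Integrable (fun x => (|g x| + 1 / (2 * ε)) * ∑ i, |E i x|) μ :=
    MemLp.integrable_mul (hg.abs.add (memLp_const _)) hS₀
  have h10 : Integrable (fun x => (∑ i, ‖G i x‖) ^ 2 * (∑ i, |E i x|) ^ 2) μ := by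
    have hb : Integrable (fun x => (N : ℝ) * N * ∑ i, ∑ k, E k x ^ 2 * ‖G i x‖ ^ 2) μ :=
      (integrable_finsetSum _ fun i _ => integrable_finsetSum _ fun k _ => hEG i k).const_mul _
    refine hb.mono' (h1.1.mul h0.1) (ae_of_all _ fun x => ?_)
    rw [Real.norm_of_nonneg (by positivity)]
    have a1 := sq_sum_le_card_mul_sum_sq (s := Finset.univ) (f := fun i => ‖G i x‖)
    have a0 := sq_sum_le_card_mul_sum_sq (s := Finset.univ) (f := fun i => |E i x|)
    simp only [Finset.card_univ, Fintype.card_fin, sq_abs] at a1 a0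
    calc _ ≤ (N * ∑ i, ‖G i x‖ ^ 2) * (N * ∑ i, E i x ^ 2) := by gcongr
      _ = N * N * ((∑ i, ‖G i x‖ ^ 2) * ∑ i, E i x ^ 2) := by ring
      _ = _ := by
        rw [Finset.sum_mul_sum]
        simp only [mul_comm (‖_‖ ^ 2)]
  exact (((h1.const_mul _).add (h0.const_mul _)).add hγ).add ((h1.add h10).const_mul _)

section

variable (p : Coeffs N)

include hE hG hg

theorem aestronglyMeasurable_densityFst (hφ : IsCutoff φ) (i : Fin N) : AEStronglyMeasurable
    (fun x => densityFst η φ (g x) (fun i => E i x) (fun i => G i x) p i) μ :=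
  (((hφ.smooth.continuous.comp_aestronglyMeasurable (memLp_sum_mul hE p.2).1).pow 2).const_add η
    |>.mul ((memLp_sum_smul hG p.1).1.inner (hG i).1)).add
    (((memLp_sum_mul hE p.1).1.sub hg.1).mul (hE i).1)

omit hg in
theorem aestronglyMeasurable_densitySnd (hφ : IsCutoff φ) (i : Fin N) : AEStronglyMeasurable
    (fun x => densitySnd ε φ (fun i => E i x) (fun i => G i x) p i) μ := by
  have hz := (memLp_sum_mul hE p.2).1
  have h1 := hφ.smooth.continuous.comp_aestronglyMeasurable hz
  have h2 := hφ.continuous_deriv.comp_aestronglyMeasurable hz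
  have h3 := (memLp_sum_smul hG p.1).1.norm.pow 2
  have h4 := ((memLp_sum_smul hG p.2).1.inner (𝕜 := ℝ) (hG i).1).const_mul (2 * ε)
  exact (h4.add (((h2.mul h1).mul h3).mul (hE i).1)).sub
    (((aestronglyMeasurable_const.sub hz).mul_const (2 * ε)⁻¹).mul (hE i).1)

theorem integrable_bulk (hφ : IsCutoff φ) : Integrable (fun x =>
    (η + φ (∑ i, p.2 i * E i x) ^ 2) * ‖∑ i, p.1 i • G i x‖ ^ 2 + (∑ i, p.1 i * E i x - g x) ^ 2)
    μ := by
  have h1 : Integrable (fun x => (∑ i, p.1 i * E i x - g x) ^ 2) μ := by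
    simpa using integrable_norm_sq ((memLp_sum_mul hE p.1).sub hg)
  refine Integrable.add ((integrable_norm_sq (memLp_sum_smul hG p.1)).bdd_mul (c := |η| + 4)
    (((hφ.smooth.continuous.comp_aestronglyMeasurable (memLp_sum_mul hE p.2).1).pow 2).const_add η)
    (ae_of_all _ fun x => ?_)) h1
  refine (norm_add_le _ _).trans (add_le_add le_rfl ?_)
  rw [Real.norm_of_nonneg (sq_nonneg _)]
  exact hφ.sq_le_four _

omit hg in
theorem integrable_phase [IsFiniteMeasure μ] : Integrable (fun x =>
    (1 - ∑ i, p.2 i * E i x) ^ 2 / (4 * ε) + ε * ‖∑ i, p.2 i • G i x‖ ^ 2) μ := by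
  have h1 : Integrable (fun x => (1 - ∑ i, p.2 i * E i x) ^ 2) μ := by
    simpa using integrable_norm_sq ((memLp_const (1 : ℝ)).sub (memLp_sum_mul hE p.2))
  exact (h1.div_const _).add ((integrable_norm_sq (memLp_sum_smul hG p.2)).const_mul ε)

theorem integrable_density [IsFiniteMeasure μ] (hφ : IsCutoff φ) : Integrable
    (fun x => density ε η φ (g x) (fun i => E i x) (fun i => G i x) p) μ :=
  ((integrable_bulk hE hG hg p hφ).const_mul _).add (integrable_phase hE hG p)

include hEG

theorem integrable_densityFst [IsFiniteMeasure μ] (hε : 0 < ε) (hη : 0 < η) (hφ : IsCutoff φ) (i : Fin N) : Integrable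
    (fun x => densityFst η φ (g x) (fun i => E i x) (fun i => G i x) p i) μ :=
  -- The derivative of `φ` does not occur in `densityFst`, so the bound with `M = 0` suffices.
  (integrable_derivBound (ε := ε) (η := η) hE hG hEG hg 0 ‖p‖).mono'
    (aestronglyMeasurable_densityFst hE hG hg p hφ i)
    (ae_of_all _ fun _ => abs_densityFst_le hε hη hφ le_rfl (norm_nonneg p) _ _ _ le_rfl i)

theorem integrable_densitySnd [IsFiniteMeasure μ] (hε : 0 < ε) (hφ : IsCutoff φ) (i : Fin N) : Integrable
    (fun x => densitySnd ε φ (fun i => E i x) (fun i => G i x) p i) μ := by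
  obtain ⟨M, hM⟩ := hφ.exists_bound_deriv_mul
  -- `η` does not occur in `densitySnd`; any positive value serves in the bound.
  exact (integrable_derivBound (ε := ε) (η := 1) hE hG hEG hg M ‖p‖).mono'
    (aestronglyMeasurable_densitySnd hE hG p hφ i)
    (ae_of_all _ fun _ => abs_densitySnd_le hε one_pos hM (norm_nonneg p) _ _ _ le_rfl i)

/-- Differentiability of the energy as a function of the coefficients. -/
theorem hasFDerivAt_integral_density [IsFiniteMeasure μ] (hε : 0 < ε) (hη : 0 < η) (hφ : IsCutoff φ) :
    HasFDerivAt
      (fun p : Coeffs N => ∫ x, density ε η φ (g x) (fun i => E i x) (fun i => G i x) p ∂μ)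
      (∑ i, (∫ x, densityFst η φ (g x) (fun i => E i x) (fun i => G i x) p i ∂μ) • fstCoord i +
        ∑ i, (∫ x, densitySnd ε φ (fun i => E i x) (fun i => G i x) p i ∂μ) • sndCoord i) p := by
  obtain ⟨M, hM⟩ := hφ.exists_bound_deriv_mul
  have hM0 : 0 ≤ M := (abs_nonneg _).trans (hM 0)
  -- One dominating function must serve for all coefficients near `p`, hence `derivBound` with `R =
  -- ‖p‖ + 1`.
  have hb : ∀ q ∈ Metric.ball p 1, ‖q‖ ≤ ‖p‖ + 1 := fun q hq => by
    have := norm_le_norm_add_norm_sub' q p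
    linarith [mem_ball_iff_norm.1 hq]
  refine hasFDerivAt_integral_of_sum_smul norm_fstCoord_le norm_sndCoord_le
    (f := fun q x => density ε η φ (g x) (fun i => E i x) (fun i => G i x) q)
    (A := fun q x => densityFst η φ (g x) (fun i => E i x) (fun i => G i x) q)
    (B := fun q x => densitySnd ε φ (fun i => E i x) (fun i => G i x) q) (fun q => integrable_density hE hG hg q hφ)
    (fun i => integrable_densityFst hE hG hEG hg p hε hη hφ i)
    (fun i => integrable_densitySnd hE hG hEG hg p hε hφ i)
    (integrable_derivBound (ε := ε) (η := η) hE hG hEG hg M (‖p‖ + 1))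
    (fun x q hq i => abs_densityFst_le hε hη hφ hM0 (by positivity) _ _ _ (hb q hq) i)
    (fun x q hq i => abs_densitySnd_le hε hη hM (by positivity) _ _ _ (hb q hq) i)
    (fun x q => hasFDerivAt_density hε hφ _ _ _ q)

end

end Energy

end

/-! ### Energy against `H¹` norms, and Bessel's inequalities. -/

section

open scoped ENNReal

section EnergyBounds

variable {U : Set Plane} {ε η : ℝ} {φ : ℝ → ℝ} {g u z : Plane → ℝ}

theorem dirichletForm_self_nonneg (f : Plane → ℝ) : 0 ≤ dirichletForm U f f := by
  rw [dirichletForm_self]; exact integral_nonneg fun x => sq_nonneg _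

theorem l2NormSq_nonneg (f : Plane → ℝ) : 0 ≤ l2NormSq U f := integral_nonneg fun _ => sq_nonneg _

theorem MemLp.integrableOn_sq (hu : MemLp u 2 (volume.restrict U)) :
    IntegrableOn (fun x => u x ^ 2) U := by
  have : Integrable (fun x => u x ^ 2) (volume.restrict U) := by simpa using integrable_norm_sq hu
  exact this

theorem MemLp.integrableOn_sub_sq (hu : MemLp u 2 (volume.restrict U))
    (hz : MemLp z 2 (volume.restrict U)) : IntegrableOn (fun x => (u x - z x) ^ 2) U :=
  MemLp.integrableOn_sq (hu.sub hz)

theorem l2NormSq_le_two_mul_add (hu : MemLp u 2 (volume.restrict U))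
    (hz : MemLp z 2 (volume.restrict U)) :
    l2NormSq U u ≤ 2 * l2NormSq U z + 2 * ∫ x in U, (u x - z x) ^ 2 := by
  unfold l2NormSq
  rw [← integral_const_mul, ← integral_const_mul, ← integral_add
    ((MemLp.integrableOn_sq hz).const_mul 2) ((MemLp.integrableOn_sub_sq hu hz).const_mul 2)]
  refine integral_mono (MemLp.integrableOn_sq hu) (((MemLp.integrableOn_sq hz).const_mul 2).add
    ((MemLp.integrableOn_sub_sq hu hz).const_mul 2)) fun x => ?_
  simp only
  nlinarith [sq_nonneg (u x - 2 * z x)]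

theorem integral_sub_sq_le (hu : MemLp u 2 (volume.restrict U))
    (hz : MemLp z 2 (volume.restrict U)) :
    ∫ x in U, (u x - z x) ^ 2 ≤ 2 * l2NormSq U u + 2 * l2NormSq U z := by
  unfold l2NormSq
  rw [← integral_const_mul, ← integral_const_mul, ← integral_add
    ((MemLp.integrableOn_sq hu).const_mul 2) ((MemLp.integrableOn_sq hz).const_mul 2)]
  refine integral_mono (MemLp.integrableOn_sub_sq hu hz)
    (((MemLp.integrableOn_sq hu).const_mul 2).add
    ((MemLp.integrableOn_sq hz).const_mul 2)) fun x => ?_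
  simp only
  nlinarith [sq_nonneg (u x + z x)]

theorem integrableOn_mul_norm_weakGrad_sq (hφ : IsCutoff φ) (hu : MemH1 U u) (hz : MemH1 U z) :
    IntegrableOn (fun x => (η + φ (z x) ^ 2) * ‖weakGrad U u x‖ ^ 2) U := by
  refine (integrable_norm_sq hu.memLp_weakGrad).bdd_mul (c := |η| + 4)
    (((hφ.smooth.continuous.comp_aestronglyMeasurable hz.1.1).pow 2).const_add η)
    (ae_of_all _ fun x => (norm_add_le _ _).trans (add_le_add le_rfl ?_))
  rw [Real.norm_of_nonneg (sq_nonneg _)]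
  exact hφ.sq_le_four _

theorem AT_eq (hUv : volume U ≠ ⊤) (hφ : IsCutoff φ) (hg : MemLp g 2 (volume.restrict U))
    (hu : MemH1 U u) (hz : MemH1 U z) : AT U ε η φ g u z =
      1 / 2 * ((∫ x in U, (η + φ (z x) ^ 2) * ‖weakGrad U u x‖ ^ 2) + ∫ x in U, (u x - g x) ^ 2) +
        ((∫ x in U, (1 - z x) ^ 2) / (4 * ε) + ε * dirichletForm U z z) := by
  have : IsFiniteMeasure (volume.restrict U) := ⟨by simpa using hUv.lt_top⟩
  rw [AT, integral_add (integrableOn_mul_norm_weakGrad_sq hφ hu hz)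
    (MemLp.integrableOn_sub_sq hu.1 hg), integral_add
    ((MemLp.integrableOn_sub_sq (memLp_const (1 : ℝ)) hz.1).div_const (4 * ε))
    ((integrable_norm_sq hz.memLp_weakGrad).const_mul ε), integral_div, integral_const_mul,
    dirichletForm_self]

/-- Upper bound of the energy by the norms. -/
theorem AT_le (hUv : volume U ≠ ⊤) (hε : 0 < ε) (hφ : IsCutoff φ)
    (hg : MemLp g 2 (volume.restrict U)) (hu : MemH1 U u) (hz : MemH1 U z) : AT U ε η φ g u z ≤
      1 / 2 * ((η + 4) * dirichletForm U u u + (2 * l2NormSq U u + 2 * l2NormSq U g)) +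
        ((2 * volume.real U + 2 * l2NormSq U z) / (4 * ε) + ε * dirichletForm U z z) := by
  have : IsFiniteMeasure (volume.restrict U) := ⟨by simpa using hUv.lt_top⟩
  rw [AT_eq hUv hφ hg hu hz]
  have h1 : ∫ x in U, (η + φ (z x) ^ 2) * ‖weakGrad U u x‖ ^ 2 ≤
      (η + 4) * dirichletForm U u u := by
    rw [dirichletForm_self, ← integral_const_mul]
    refine integral_mono (integrableOn_mul_norm_weakGrad_sq hφ hu hz)
      ((integrable_norm_sq hu.memLp_weakGrad).const_mul _) fun x => ?_
    have := hφ.sq_le_four (z x)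
    simp only
    gcongr
  have h2 := integral_sub_sq_le hu.1 hg
  have h3 : ∫ x in U, (1 - z x) ^ 2 ≤ 2 * volume.real U + 2 * l2NormSq U z := by
    have := integral_sub_sq_le (U := U) (memLp_const (1 : ℝ)) hz.1
    simpa [l2NormSq] using this
  gcongr

theorem AT_nonneg (hε : 0 < ε) (hη : 0 < η) : 0 ≤ AT U ε η φ g u z := by
  unfold AT
  have h1 : 0 ≤ ∫ x in U, ((η + φ (z x) ^ 2) * ‖weakGrad U u x‖ ^ 2 + (u x - g x) ^ 2) :=
    integral_nonneg fun x => by positivity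
  have h2 : 0 ≤ ∫ x in U, ((1 - z x) ^ 2 / (4 * ε) + ε * ‖weakGrad U z x‖ ^ 2) :=
    integral_nonneg fun x => by positivity
  positivity

/-- The energy controls the `H¹` norms. -/
theorem h1NormSq_le_of_AT_le (hUv : volume U ≠ ⊤) (hε : 0 < ε) (hη : 0 < η) (hφ : IsCutoff φ)
    (hg : MemLp g 2 (volume.restrict U)) (hu : MemH1 U u) (hz : MemH1 U z) {A : ℝ}
    (hA : AT U ε η φ g u z ≤ A) :
    h1NormSq U u ≤ 2 * l2NormSq U g + 4 * A + 2 * A / η ∧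
      h1NormSq U z ≤ 2 * volume.real U + 8 * ε * A + A / ε := by
  have : IsFiniteMeasure (volume.restrict U) := ⟨by simpa using hUv.lt_top⟩
  rw [AT_eq hUv hφ hg hu hz] at hA
  have h1 : η * dirichletForm U u u ≤ ∫ x in U, (η + φ (z x) ^ 2) * ‖weakGrad U u x‖ ^ 2 := by
    rw [dirichletForm_self, ← integral_const_mul]
    refine integral_mono ((integrable_norm_sq hu.memLp_weakGrad).const_mul _)
      (integrableOn_mul_norm_weakGrad_sq hφ hu hz) fun x => ?_
    simp only
    gcongr
    exact le_add_of_nonneg_right (sq_nonneg _)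
  have p1 := dirichletForm_self_nonneg (U := U) u
  have p2 := dirichletForm_self_nonneg (U := U) z
  have p3 : 0 ≤ ∫ x in U, (u x - g x) ^ 2 := integral_nonneg fun x => sq_nonneg _
  have p4 : 0 ≤ ∫ x in U, (1 - z x) ^ 2 := integral_nonneg fun x => sq_nonneg _
  have q1 : 0 ≤ η * dirichletForm U u u := by positivity
  have q2 : 0 ≤ ε * dirichletForm U z z := by positivity
  have q4 : 0 ≤ (∫ x in U, (1 - z x) ^ 2) / (4 * ε) := by positivity
  have r1 : dirichletForm U u u ≤ 2 * A / η := by rw [le_div_iff₀ hη]; linarith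
  have r2 : dirichletForm U z z ≤ A / ε := by rw [le_div_iff₀ hε]; linarith
  have r4 : ∫ x in U, (1 - z x) ^ 2 ≤ 4 * ε * A := by
    have : (∫ x in U, (1 - z x) ^ 2) / (4 * ε) ≤ A := by linarith
    rw [div_le_iff₀ (by positivity)] at this
    linarith
  have s1 := l2NormSq_le_two_mul_add hu.1 hg
  have s2 : l2NormSq U z ≤ 2 * volume.real U + 2 * ∫ x in U, (1 - z x) ^ 2 := by
    have := l2NormSq_le_two_mul_add (U := U) hz.1 (memLp_const (1 : ℝ))
    have e : ∀ x, (z x - 1) ^ 2 = (1 - z x) ^ 2 := fun x => by ring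
    simpa [l2NormSq, e] using this
  unfold h1NormSq
  rw [← dirichletForm_self, ← dirichletForm_self]
  constructor <;> linarith

end EnergyBounds

namespace IsNeumannEigenbasis

variable {U : Set Plane} {e : ℕ → Plane → ℝ} {lam : ℕ → ℝ} (he : IsNeumannEigenbasis U e lam)
  {u : Plane → ℝ}

include he

/-- Bessel's inequality in `L²`. -/
theorem l2NormSq_proj_le (N : ℕ) (hu : MemLp u 2 (volume.restrict U)) :
    l2NormSq U (proj U e N u) ≤ l2NormSq U u := by
  set c : Fin N → ℝ := fun i => l2Inner U u (e i) with hc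
  have hm := memLp_comb (fun i => (he.memH1 i).1) N c
  have h0 : 0 ≤ ∫ x in U, (u x - comb e N c x) ^ 2 := integral_nonneg fun x => sq_nonneg _
  have h1 : ∫ x in U, (u x - comb e N c x) ^ 2 =
      l2NormSq U u - 2 * l2Inner U (comb e N c) u + l2NormSq U (comb e N c) := by
    unfold l2NormSq l2Inner
    have i1 : IntegrableOn (fun x => u x ^ 2 - 2 * (comb e N c x * u x)) U :=
      (MemLp.integrableOn_sq hu).sub ((MemLp.integrableOn_mul hm hu).const_mul 2)
    rw [← integral_const_mul, ← integral_sub (MemLp.integrableOn_sq hu)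
      ((MemLp.integrableOn_mul hm hu).const_mul 2), ← integral_add i1 (MemLp.integrableOn_sq hm)]
    exact integral_congr_ae (ae_of_all _ fun x => by simp only; ring)
  have h2 : l2Inner U (comb e N c) u = l2NormSq U (comb e N c) := by
    rw [l2Inner_comb_left (fun i => (he.memH1 i).1) hu, he.l2NormSq_comb]
    exact Finset.sum_congr rfl fun i _ => by rw [l2Inner_comm, hc, sq]
  change l2NormSq U (comb e N c) ≤ _
  linarith

/-- Bessel's inequality for the Dirichlet form. -/
theorem dirichletForm_proj_le (hU : IsOpen U) (hUv : volume U ≠ ⊤) (N : ℕ) (hu : MemH1 U u) :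
    dirichletForm U (proj U e N u) (proj U e N u) ≤ dirichletForm U u u := by
  set c : Fin N → ℝ := fun i => l2Inner U u (e i) with hc
  have hm := (MemH1.comb hU hUv he.memH1 N c).1
  have h0 : 0 ≤ ∫ x in U, ‖weakGrad U u x - weakGrad U (comb e N c) x‖ ^ 2 :=
    integral_nonneg fun x => sq_nonneg _
  have i1 := integrable_norm_sq hu.memLp_weakGrad
  have i2 := integrable_norm_sq hm.memLp_weakGrad
  have i3 := (MemLp.integrableOn_inner hm.memLp_weakGrad hu.memLp_weakGrad).const_mul 2
  have h1 : ∫ x in U, ‖weakGrad U u x - weakGrad U (comb e N c) x‖ ^ 2 =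
      dirichletForm U u u - 2 * dirichletForm U (comb e N c) u +
        dirichletForm U (comb e N c) (comb e N c) := by
    have i4 : Integrable (fun x => ‖weakGrad U u x‖ ^ 2 -
        2 * inner ℝ (weakGrad U (comb e N c) x) (weakGrad U u x)) (volume.restrict U) := i1.sub i3
    rw [dirichletForm_self, dirichletForm_self, dirichletForm]
    rw [← integral_const_mul, ← integral_sub i1 i3, ← integral_add i4 i2]
    refine integral_congr_ae (ae_of_all _ fun x => ?_)
    simp only
    rw [norm_sub_sq_real, real_inner_comm]
  -- By the eigenvalue equation both sides are `L²` products against the same element of `V_N`, and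
  -- these see `u` only through its coefficients.
  have h2 : dirichletForm U (comb e N c) u = dirichletForm U (comb e N c) (comb e N c) := by
    rw [he.dirichletForm_comb hU hUv c hu, he.dirichletForm_comb hU hUv c hm,
      he.l2Inner_comb_comb, l2Inner_comb_left (fun i => (he.memH1 i).1) hu.1]
    exact Finset.sum_congr rfl fun i _ => by rw [l2Inner_comm, hc]
  change dirichletForm U (comb e N c) (comb e N c) ≤ _
  linarith

end IsNeumannEigenbasis

end

/-! ### The energy on `V_N × V_N` and its gradient flow. -/

section

open scoped ENNReal

theorem comb_add_smul_comb (e : ℕ → Plane → ℝ) {N : ℕ} (c d : Fin N → ℝ) (s : ℝ) :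
    comb e N c + s • comb e N d = comb e N (c + s • d) := by
  ext x
  simp [comb, add_mul, Finset.sum_add_distrib, Finset.mul_sum, mul_assoc]

theorem comb_single (e : ℕ → Plane → ℝ) {N : ℕ} (i : Fin N) : comb e N (Pi.single i 1) = e i := by
  ext x
  simp [comb, Pi.single_apply]

theorem comb_zero (e : ℕ → Plane → ℝ) (N : ℕ) : comb e N 0 = 0 := by
  ext x
  simp [comb]

/-- Derivative of the energy with respect to the `i`-th coefficient of `u`. -/
noncomputable def energyFst (U : Set Plane) (η : ℝ) (φ : ℝ → ℝ) (g : Plane → ℝ) (e : ℕ → Plane → ℝ)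
    {N : ℕ} (p : Coeffs N) (i : Fin N) : ℝ :=
  ∫ x in U, densityFst η φ (g x) (fun i : Fin N => e i x) (fun i : Fin N => weakGrad U (e i) x) p i

/-- Derivative of the energy with respect to the `i`-th coefficient of `z`. -/
noncomputable def energySnd (U : Set Plane) (ε : ℝ) (φ : ℝ → ℝ) (e : ℕ → Plane → ℝ)
    {N : ℕ} (p : Coeffs N) (i : Fin N) : ℝ :=
  ∫ x in U, densitySnd ε φ (fun i : Fin N => e i x) (fun i : Fin N => weakGrad U (e i) x) p i

namespace IsNeumannEigenbasis

variable {U : Set Plane} {ε η T : ℝ} {φ : ℝ → ℝ} {g u₀ z₀ : Plane → ℝ} {e : ℕ → Plane → ℝ}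
  {lam : ℕ → ℝ} (he : IsNeumannEigenbasis U e lam) {N : ℕ}

include he

theorem AT_comb (hU : IsC2Domain U) (hφ : IsCutoff φ) (hg : MemLp g 2 (volume.restrict U))
    (p : Coeffs N) : AT U ε η φ g (comb e N p.1) (comb e N p.2) =
      ∫ x in U, density ε η φ (g x) (fun i : Fin N => e i x)
        (fun i : Fin N => weakGrad U (e i) x) p := by
  have hUv : volume U ≠ ⊤ := hU.isBounded.measure_lt_top.ne
  have : IsFiniteMeasure (volume.restrict U) := ⟨by simpa using hUv.lt_top⟩
  have hE : ∀ i : Fin N, MemLp (e i) 2 (volume.restrict U) := fun i => (he.memH1 i).1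
  have hG : ∀ i : Fin N, MemLp (weakGrad U (e i)) 2 (volume.restrict U) :=
    fun i => (he.memH1 i).memLp_weakGrad
  simp only [density]
  rw [integral_add ((integrable_bulk hE hG hg p hφ).const_mul _) (integrable_phase hE hG p),
    integral_const_mul, AT]
  congr 1
  · congr 1
    refine integral_congr_ae ?_
    filter_upwards [(MemH1.comb hU.isOpen hUv he.memH1 N p.1).2] with x hx
    rw [hx]
    rfl
  · refine integral_congr_ae ?_
    filter_upwards [(MemH1.comb hU.isOpen hUv he.memH1 N p.2).2] with x hx
    rw [hx]
    rfl

theorem hasFDerivAt_AT (hU : IsC2Domain U) (hε : 0 < ε) (hη : 0 < η) (hφ : IsCutoff φ)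
    (hg : MemLp g 2 (volume.restrict U)) (p : Coeffs N) :
    HasFDerivAt (fun p : Coeffs N => AT U ε η φ g (comb e N p.1) (comb e N p.2))
      (∑ i, energyFst U η φ g e p i • fstCoord i + ∑ i, energySnd U ε φ e p i • sndCoord i) p := by
  have hUv : volume U ≠ ⊤ := hU.isBounded.measure_lt_top.ne
  have : IsFiniteMeasure (volume.restrict U) := ⟨by simpa using hUv.lt_top⟩
  simp only [he.AT_comb hU hφ hg]
  exact hasFDerivAt_integral_density (fun i => (he.memH1 i).1)
    (fun i => (he.memH1 i).memLp_weakGrad)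
    (fun i k => he.integrableOn_sq_mul_norm_weakGrad_sq hU i k) hg p hε hη hφ

/-- Basis directions identify the projected gradients; general directions give their representation
of the differential. -/
theorem hasDerivAt_AT_line (hU : IsC2Domain U) (hε : 0 < ε) (hη : 0 < η) (hφ : IsCutoff φ)
    (hg : MemLp g 2 (volume.restrict U)) (p q : Coeffs N) :
    HasDerivAt (fun s : ℝ => AT U ε η φ g (comb e N p.1 + s • comb e N q.1)
        (comb e N p.2 + s • comb e N q.2))
      (∑ i, energyFst U η φ g e p i * q.1 i + ∑ i, energySnd U ε φ e p i * q.2 i) 0 := by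
  have hl : HasDerivAt (fun s : ℝ => p + s • q) q 0 := by
    simpa using ((hasDerivAt_id (0 : ℝ)).smul_const q).const_add p
  have hF := he.hasFDerivAt_AT hU hε hη hφ hg (p + (0 : ℝ) • q)
  have h := hF.comp_hasDerivAt 0 hl
  simp only [comb_add_smul_comb]
  simpa [add_apply, sum_apply, Function.comp_def] using h

theorem projGradFst_eq (hU : IsC2Domain U) (hε : 0 < ε) (hη : 0 < η) (hφ : IsCutoff φ)
    (hg : MemLp g 2 (volume.restrict U)) (p : Coeffs N) :
    projGradFst e N (AT U ε η φ g) (comb e N p.1) (comb e N p.2) =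
      comb e N (energyFst U η φ g e p) := by
  unfold projGradFst
  congr 1
  ext i
  have h := (he.hasDerivAt_AT_line hU hε hη hφ hg p (Pi.single i 1, 0)).deriv
  simpa [comb_single, comb_zero, Pi.single_apply] using h

theorem projGradSnd_eq (hU : IsC2Domain U) (hε : 0 < ε) (hη : 0 < η) (hφ : IsCutoff φ)
    (hg : MemLp g 2 (volume.restrict U)) (p : Coeffs N) :
    projGradSnd e N (AT U ε η φ g) (comb e N p.1) (comb e N p.2) =
      comb e N (energySnd U ε φ e p) := by
  unfold projGradSnd
  congr 1
  ext i
  have h := (he.hasDerivAt_AT_line hU hε hη hφ hg p (0, Pi.single i 1)).deriv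
  simpa [comb_single, comb_zero, Pi.single_apply] using h

theorem l2Inner_proj_basis (i : Fin N) : l2Inner U (proj U e N g) (e i) = l2Inner U g (e i) :=
  he.l2Inner_comb_basis _ i

/-- The Galerkin system is the gradient flow of the energy on the coefficients. -/
theorem galerkin_gradientFlow (hU : IsC2Domain U) (hε : 0 < ε) (hφ : IsCutoff φ)
    (hg : MemLp g 2 (volume.restrict U)) {a b : ℝ → Fin N → ℝ}
    (hab : IsGalerkinSolution U ε η φ g u₀ z₀ e T N a b) {t : ℝ} (ht : t ∈ Icc 0 T) (i : Fin N) :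
    HasDerivWithinAt (fun s => a s i) (-energyFst U η φ g e (a t, b t) i) (Icc 0 T) t ∧
      HasDerivWithinAt (fun s => b s i) (-energySnd U ε φ e (a t, b t) i) (Icc 0 T) t := by
  have hUv : volume U ≠ ⊤ := hU.isBounded.measure_lt_top.ne
  have : IsFiniteMeasure (volume.restrict U) := ⟨by simpa using hUv.lt_top⟩
  have hE : ∀ i : Fin N, MemLp (e i) 2 (volume.restrict U) := fun i => (he.memH1 i).1
  have hG : ∀ i : Fin N, MemLp (weakGrad U (e i)) 2 (volume.restrict U) :=
    fun i => (he.memH1 i).memLp_weakGrad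
  have hEG : ∀ i k : Fin N, Integrable (fun x => e k x ^ 2 * ‖weakGrad U (e i) x‖ ^ 2)
      (volume.restrict U) := fun i k => he.integrableOn_sq_mul_norm_weakGrad_sq hU i k
  have hca := MemH1.comb hU.isOpen hUv he.memH1 N (a t)
  have hcb := MemH1.comb hU.isOpen hUv he.memH1 N (b t)
  have hpg : MemLp (proj U e N g) 2 (volume.restrict U) := memLp_comb (fun i => (he.memH1 i).1) N _
  have j1 : IntegrableOn (fun x => (comb e N (a t) x - g x) * e i x) U :=
    MemLp.integrableOn_mul (hca.1.1.sub hg) (hE i)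
  have j2 : IntegrableOn (fun x => inner ℝ (weakGrad U (comb e N (b t)) x) (weakGrad U (e i) x)) U :=
    MemLp.integrableOn_inner hcb.1.memLp_weakGrad (hG i)
  have j3 : IntegrableOn (fun x => (1 - comb e N (b t) x) / (2 * ε) * e i x) U := by
    have := (MemLp.integrableOn_mul ((memLp_const (1 : ℝ)).sub hcb.1.1) (hE i)).const_mul (2 * ε)⁻¹
    refine Integrable.congr this (ae_of_all _ fun x => ?_)
    simp only [Pi.sub_apply]
    ring
  constructor
  · convert hab.eq_u t ht i using 1
    have e1 : energyFst U η φ g e (a t, b t) i = ∫ x in U, ((η + φ (comb e N (b t) x) ^ 2) *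
        inner ℝ (weakGrad U (comb e N (a t)) x) (weakGrad U (e i) x) +
        (comb e N (a t) x - g x) * e i x) := by
      refine integral_congr_ae ?_
      filter_upwards [hca.2] with x hx
      rw [hx]
      rfl
    have j0 : IntegrableOn (fun x => (η + φ (comb e N (b t) x) ^ 2) *
        inner ℝ (weakGrad U (comb e N (a t)) x) (weakGrad U (e i) x)) U := by
      refine (MemLp.integrableOn_inner hca.1.memLp_weakGrad (hG i)).bdd_mul (c := |η| + 4)
        (((hφ.smooth.continuous.comp_aestronglyMeasurable hcb.1.1.1).pow 2).const_add η)
        (ae_of_all _ fun x => (norm_add_le _ _).trans (add_le_add le_rfl ?_))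
      rw [Real.norm_of_nonneg (sq_nonneg _)]
      exact hφ.sq_le_four _
    -- Only the `i`-th coefficient of `w` enters, so `g` and `π_N g` are interchangeable.
    have e2 : ∀ w : Plane → ℝ, MemLp w 2 (volume.restrict U) →
        ∫ x in U, (comb e N (a t) x - w x) * e i x = a t i - l2Inner U w (e i) := by
      intro w hw
      simp only [sub_mul]
      rw [integral_sub (MemLp.integrableOn_mul hca.1.1 (hE i)) (MemLp.integrableOn_mul hw (hE i))]
      congr 1
      exact he.l2Inner_comb_basis (a t) i
    rw [e1, integral_add j0 j1, e2 g hg, e2 _ hpg, he.l2Inner_proj_basis]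
    ring
  · convert hab.eq_z t ht i using 1
    have j4 : IntegrableOn (fun x => deriv φ (comb e N (b t) x) * φ (comb e N (b t) x) *
        ‖weakGrad U (comb e N (a t)) x‖ ^ 2 * e i x) U := by
      -- The cubic term is integrable because it is the full partial derivative minus its other two
      -- terms, which are products of `L²` functions.
      have h1 := ((integrable_densitySnd hE hG hEG hg (a t, b t) hε hφ i).sub
        (j2.const_mul (2 * ε))).add j3
      refine h1.congr ?_
      filter_upwards [hca.2, hcb.2] with x hx hx'
      simp only [Pi.add_apply, Pi.sub_apply, densitySnd]
      rw [hx, hx']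
      simp only [comb]
      ring
    have e1 : energySnd U ε φ e (a t, b t) i = ∫ x in U,
        (2 * ε * inner ℝ (weakGrad U (comb e N (b t)) x) (weakGrad U (e i) x) +
          deriv φ (comb e N (b t) x) * φ (comb e N (b t) x) *
            ‖weakGrad U (comb e N (a t)) x‖ ^ 2 * e i x -
          (1 - comb e N (b t) x) / (2 * ε) * e i x) := by
      refine integral_congr_ae ?_
      filter_upwards [hca.2, hcb.2] with x hx hx'
      rw [hx, hx']
      rfl
    have j5 : IntegrableOn (fun x =>
        2 * ε * inner ℝ (weakGrad U (comb e N (b t)) x) (weakGrad U (e i) x) +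
          deriv φ (comb e N (b t) x) * φ (comb e N (b t) x) *
            ‖weakGrad U (comb e N (a t)) x‖ ^ 2 * e i x) U := (j2.const_mul (2 * ε)).add j4
    rw [e1, integral_sub j5 j3, integral_add (j2.const_mul (2 * ε)) j4, integral_const_mul]
    unfold dirichletForm
    ring

end IsNeumannEigenbasis

end

/-! ### Dissipation of the energy along Galerkin solutions. -/

section

open scoped ENNReal

/-- Integrated form of a pointwise dissipation identity `E' = -Q` with `Q ≥ 0`. -/
theorem energy_dissipation {E Q : ℝ → ℝ} {T : ℝ} (hT : 0 < T)
    (hE : ∀ t ∈ Icc 0 T, HasDerivWithinAt E (-Q t) (Icc 0 T) t) (hQ : ∀ t ∈ Icc 0 T, 0 ≤ Q t) :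
    IntervalIntegrable Q volume 0 T ∧ (∀ t ∈ Icc 0 T, E t + ∫ s in (0 : ℝ)..t, Q s = E 0) ∧
      IsGreatest (E '' Icc 0 T) (E 0) := by
  have hcont : ContinuousOn E (Icc 0 T) := fun t ht => (hE t ht).continuousWithinAt
  have hder : ∀ t ∈ Ioo 0 T, HasDerivAt E (-Q t) t := fun t ht =>
    (hE t (Ioo_subset_Icc_self ht)).hasDerivAt (Icc_mem_nhds ht.1 ht.2)
  -- No measurability of `Q` is assumed: it is the nonnegative derivative of the continuous function
  -- `-E`, and such a derivative is integrable.
  have hint : IntervalIntegrable Q volume 0 T := by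
    refine intervalIntegral.intervalIntegrable_deriv_of_nonneg (g := fun t => -E t) ?_ ?_ ?_
    · rw [uIcc_of_le hT.le]
      exact hcont.neg
    · intro t ht
      rw [min_eq_left hT.le, max_eq_right hT.le] at ht
      have h := (hder t ht).neg
      rw [neg_neg] at h
      exact h
    · intro t ht
      rw [min_eq_left hT.le, max_eq_right hT.le] at ht
      exact hQ t (Ioo_subset_Icc_self ht)
  have hid : ∀ t ∈ Icc 0 T, E t + ∫ s in (0 : ℝ)..t, Q s = E 0 := by
    intro t ht
    have h1 : IntervalIntegrable Q volume 0 t := hint.mono_set (by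
      rw [uIcc_of_le ht.1, uIcc_of_le hT.le]
      exact Icc_subset_Icc le_rfl ht.2)
    have h2 := intervalIntegral.integral_eq_sub_of_hasDerivAt_of_le ht.1
      (hcont.mono (Icc_subset_Icc le_rfl ht.2))
      (fun s hs => hder s ⟨hs.1, hs.2.trans_le ht.2⟩) h1.neg
    simp only [intervalIntegral.integral_neg] at h2
    linarith
  refine ⟨hint, hid, ⟨0, ⟨le_rfl, hT.le⟩, rfl⟩, ?_⟩
  rintro _ ⟨t, ht, rfl⟩
  have h3 : 0 ≤ ∫ s in (0 : ℝ)..t, Q s :=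
    intervalIntegral.integral_nonneg ht.1 fun s hs => hQ s ⟨hs.1, hs.2.trans ht.2⟩
  have := hid t ht
  change E t ≤ E 0
  linarith

/-- A nonnegative sum of squares of derivatives is integrable when dominated by an integrable
function. -/
theorem intervalIntegrable_sum_sq_derivWithin {ι : Type*} [Fintype ι] {a : ℝ → ι → ℝ} {Q : ℝ → ℝ}
    {T : ℝ} (hT : 0 < T) (hQ : IntervalIntegrable Q volume 0 T)
    (h : ∀ t ∈ Icc 0 T, ∑ i, derivWithin (fun s => a s i) (Icc 0 T) t ^ 2 ≤ Q t) :
    IntervalIntegrable (fun t => ∑ i, derivWithin (fun s => a s i) (Icc 0 T) t ^ 2) volume 0 T := by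
  rw [intervalIntegrable_iff_integrableOn_Ioo_of_le hT.le] at hQ ⊢
  -- The two-sided derivative of any real function is measurable, and it agrees with `derivWithin`
  -- in the open interval.
  have hm : Measurable fun t => ∑ i, deriv (fun s => a s i) t ^ 2 :=
    Finset.measurable_sum _ fun i _ => (measurable_deriv _).pow_const 2
  have hae : ∀ᵐ t ∂volume.restrict (Ioo 0 T), ∑ i, deriv (fun s => a s i) t ^ 2 =
      ∑ i, derivWithin (fun s => a s i) (Icc 0 T) t ^ 2 := by
    filter_upwards [ae_restrict_mem measurableSet_Ioo] with t ht
    exact Finset.sum_congr rfl fun i _ => by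
      rw [derivWithin_of_mem_nhds (Icc_mem_nhds ht.1 ht.2)]
  refine Integrable.mono' hQ (hm.aestronglyMeasurable.congr hae) ?_
  filter_upwards [ae_restrict_mem measurableSet_Ioo] with t ht
  rw [Real.norm_of_nonneg (Finset.sum_nonneg fun i _ => sq_nonneg _)]
  exact h t (Ioo_subset_Icc_self ht)

theorem l2NormSq_le_h1NormSq (U : Set Plane) (f : Plane → ℝ) : l2NormSq U f ≤ h1NormSq U f :=
  le_add_of_nonneg_right (integral_nonneg fun _ => sq_nonneg _)

namespace IsNeumannEigenbasis

variable {U : Set Plane} {ε η T : ℝ} {φ : ℝ → ℝ} {g u₀ z₀ : Plane → ℝ} {e : ℕ → Plane → ℝ}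
  {lam : ℕ → ℝ} (he : IsNeumannEigenbasis U e lam) {N : ℕ}

include he

theorem projGradNormSq_eq (hU : IsC2Domain U) (hε : 0 < ε) (hη : 0 < η) (hφ : IsCutoff φ)
    (hg : MemLp g 2 (volume.restrict U)) (p : Coeffs N) :
    projGradNormSq U e N (AT U ε η φ g) (comb e N p.1) (comb e N p.2) =
      ∑ i, energyFst U η φ g e p i ^ 2 + ∑ i, energySnd U ε φ e p i ^ 2 := by
  rw [projGradNormSq, he.projGradFst_eq hU hε hη hφ hg, he.projGradSnd_eq hU hε hη hφ hg,
    he.l2NormSq_comb, he.l2NormSq_comb]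

/-- Chain rule: each partial derivative of the energy is multiplied by the velocity of its
coefficient, which is minus itself. -/
theorem hasDerivWithinAt_AT_galerkin (hU : IsC2Domain U) (hε : 0 < ε) (hη : 0 < η)
    (hφ : IsCutoff φ) (hg : MemLp g 2 (volume.restrict U)) {a b : ℝ → Fin N → ℝ}
    (hab : IsGalerkinSolution U ε η φ g u₀ z₀ e T N a b) {t : ℝ} (ht : t ∈ Icc 0 T) :
    HasDerivWithinAt (fun s => AT U ε η φ g (comb e N (a s)) (comb e N (b s)))
      (-projGradNormSq U e N (AT U ε η φ g) (comb e N (a t)) (comb e N (b t))) (Icc 0 T) t := by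
  have hda : HasDerivWithinAt a (fun i => -energyFst U η φ g e (a t, b t) i) (Icc 0 T) t :=
    hasDerivWithinAt_pi.2 fun i => (he.galerkin_gradientFlow hU hε hφ hg hab ht i).1
  have hdb : HasDerivWithinAt b (fun i => -energySnd U ε φ e (a t, b t) i) (Icc 0 T) t :=
    hasDerivWithinAt_pi.2 fun i => (he.galerkin_gradientFlow hU hε hφ hg hab ht i).2
  have h := (he.hasFDerivAt_AT hU hε hη hφ hg (a t, b t)).comp_hasDerivWithinAt t (hda.prodMk hdb)
  rw [he.projGradNormSq_eq hU hε hη hφ hg (a t, b t)]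
  refine h.congr_deriv ?_
  simp [add_apply, sum_apply, sq, Finset.sum_neg_distrib]
  ring

theorem l2NormSq_timeDeriv_fst (hT : 0 < T) (hU : IsC2Domain U) (hε : 0 < ε) (hφ : IsCutoff φ)
    (hg : MemLp g 2 (volume.restrict U)) {a b : ℝ → Fin N → ℝ}
    (hab : IsGalerkinSolution U ε η φ g u₀ z₀ e T N a b) {t : ℝ} (ht : t ∈ Icc 0 T) :
    l2NormSq U (timeDeriv e N T a t) = ∑ i, energyFst U η φ g e (a t, b t) i ^ 2 := by
  rw [timeDeriv, he.l2NormSq_comb]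
  refine Finset.sum_congr rfl fun i _ => ?_
  rw [(he.galerkin_gradientFlow hU hε hφ hg hab ht i).1.derivWithin (uniqueDiffOn_Icc hT t ht),
    neg_sq]

theorem l2NormSq_timeDeriv_snd (hT : 0 < T) (hU : IsC2Domain U) (hε : 0 < ε) (hφ : IsCutoff φ)
    (hg : MemLp g 2 (volume.restrict U)) {a b : ℝ → Fin N → ℝ}
    (hab : IsGalerkinSolution U ε η φ g u₀ z₀ e T N a b) {t : ℝ} (ht : t ∈ Icc 0 T) :
    l2NormSq U (timeDeriv e N T b t) = ∑ i, energySnd U ε φ e (a t, b t) i ^ 2 := by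
  rw [timeDeriv, he.l2NormSq_comb]
  refine Finset.sum_congr rfl fun i _ => ?_
  rw [(he.galerkin_gradientFlow hU hε hφ hg hab ht i).2.derivWithin (uniqueDiffOn_Icc hT t ht),
    neg_sq]

theorem continuousOn_l2NormSq_comb {a : ℝ → Fin N → ℝ} {s : Set ℝ}
    (ha : ∀ i, ContinuousOn (fun t => a t i) s) :
    ContinuousOn (fun t => l2NormSq U (comb e N (a t))) s := by
  simp only [he.l2NormSq_comb]
  exact continuousOn_finsetSum _ fun i _ => (ha i).pow 2

end IsNeumannEigenbasis

/-- Bound for the time integral of a sum of a bounded and an integrable function. -/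
theorem integral_add_le_of_le {f h : ℝ → ℝ} {T K B : ℝ} (hT : 0 ≤ T)
    (hf : IntervalIntegrable f volume 0 T) (hh : IntervalIntegrable h volume 0 T)
    (hfK : ∀ t ∈ Icc 0 T, f t ≤ K) (hB : ∫ t in (0 : ℝ)..T, h t ≤ B) :
    ∫ t in (0 : ℝ)..T, (f t + h t) ≤ T * K + B := by
  rw [intervalIntegral.integral_add hf hh]
  have := intervalIntegral.integral_mono_on hT hf intervalIntegrable_const hfK
  rw [intervalIntegral.integral_const, smul_eq_mul, sub_zero] at this
  linarith

end

end AmbrosioTortorelli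

/-! ### The a priori estimates. -/

theorem proposition2p6 (U : Set Plane) (hU : IsC2Domain U)
    (ε η T : ℝ) (hε : 0 < ε) (hη : 0 < η) (hT : 0 < T)
    (φ : ℝ → ℝ) (hφ : IsCutoff φ)
    (g u₀ z₀ : Plane → ℝ) (hg : MemLp g 2 (volume.restrict U))
    (hu₀ : MemH1 U u₀) (hz₀ : MemH1 U z₀)
    (e : ℕ → Plane → ℝ) (lam : ℕ → ℝ) (he : IsNeumannEigenbasis U e lam) :
    ∃ C : ℝ, ∀ (N : ℕ) (a b : ℝ → Fin N → ℝ),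
      IsGalerkinSolution U ε η φ g u₀ z₀ e T N a b →
      -- the projected gradient represents the differential of the energy on `V_N × V_N`
      (∀ t ∈ Icc 0 T, ∀ c d : Fin N → ℝ,
        HasDerivAt
          (fun s : ℝ => AT U ε η φ g (comb e N (a t) + s • comb e N c)
            (comb e N (b t) + s • comb e N d))
          (l2Inner U (projGradFst e N (AT U ε η φ g) (comb e N (a t)) (comb e N (b t)))
              (comb e N c)
            + l2Inner U (projGradSnd e N (AT U ε η φ g) (comb e N (a t)) (comb e N (b t)))
              (comb e N d)) 0) ∧
      -- the energy identity, in differential form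
      (∀ t ∈ Icc 0 T,
        HasDerivWithinAt (fun s => AT U ε η φ g (comb e N (a s)) (comb e N (b s)))
          (- projGradNormSq U e N (AT U ε η φ g) (comb e N (a t)) (comb e N (b t)))
          (Icc 0 T) t ∧
        projGradNormSq U e N (AT U ε η φ g) (comb e N (a t)) (comb e N (b t))
          = l2NormSq U (timeDeriv e N T a t) + l2NormSq U (timeDeriv e N T b t)) ∧
      -- all time integrals below are integrals of integrable functions
      IntervalIntegrable (fun t => l2NormSq U (timeDeriv e N T a t)) volume 0 T ∧
      IntervalIntegrable (fun t => l2NormSq U (timeDeriv e N T b t)) volume 0 T ∧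
      IntervalIntegrable
        (fun t => projGradNormSq U e N (AT U ε η φ g) (comb e N (a t)) (comb e N (b t)))
        volume 0 T ∧
      -- the energy identity, integrated in time
      (∀ t ∈ Icc 0 T,
        AT U ε η φ g (comb e N (a t)) (comb e N (b t))
          + (∫ s in (0 : ℝ)..t,
              (l2NormSq U (timeDeriv e N T a s) + l2NormSq U (timeDeriv e N T b s)))
          = AT U ε η φ g (proj U e N u₀) (proj U e N z₀)) ∧
      -- the a priori bound
      (∃ S : ℝ,
        IsLUB ((fun t => AT U ε η φ g (comb e N (a t)) (comb e N (b t))) '' Icc 0 T) S ∧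
        S + (∫ t in (0 : ℝ)..T,
              (l2NormSq U (timeDeriv e N T a t) + l2NormSq U (timeDeriv e N T b t)))
          = S + (∫ t in (0 : ℝ)..T,
              projGradNormSq U e N (AT U ε η φ g) (comb e N (a t)) (comb e N (b t))) ∧
        S + (∫ t in (0 : ℝ)..T,
              (l2NormSq U (timeDeriv e N T a t) + l2NormSq U (timeDeriv e N T b t))) ≤ C) ∧
      -- uniform bounds in `L^∞(0, T; H¹(U))`
      (∀ t ∈ Icc 0 T,
        MemH1 U (comb e N (a t)) ∧ h1NormSq U (comb e N (a t)) ≤ C ∧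
        MemH1 U (comb e N (b t)) ∧ h1NormSq U (comb e N (b t)) ≤ C) ∧
      -- uniform bounds in `H¹(0, T; L²(U))`
      IntervalIntegrable (fun t => l2NormSq U (comb e N (a t))) volume 0 T ∧
      IntervalIntegrable (fun t => l2NormSq U (comb e N (b t))) volume 0 T ∧
      (∫ t in (0 : ℝ)..T,
        (l2NormSq U (comb e N (a t)) + l2NormSq U (timeDeriv e N T a t))) ≤ C ∧
      (∫ t in (0 : ℝ)..T,
        (l2NormSq U (comb e N (b t)) + l2NormSq U (timeDeriv e N T b t))) ≤ C := by
  have hUv : volume U ≠ ⊤ := hU.isBounded.measure_lt_top.ne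
  -- The right side of `AT_le` at `(u₀, z₀)` rather than at the projections, hence independent of
  -- `N`.
  obtain ⟨A₀, hA₀⟩ : ∃ A₀ : ℝ, A₀ = 1 / 2 * ((η + 4) * dirichletForm U u₀ u₀ +
      (2 * l2NormSq U u₀ + 2 * l2NormSq U g)) +
      ((2 * volume.real U + 2 * l2NormSq U z₀) / (4 * ε) + ε * dirichletForm U z₀ z₀) := ⟨_, rfl⟩
  have hA₀nonneg : 0 ≤ A₀ := (AT_nonneg hε hη).trans
    ((AT_le hUv hε hφ hg hu₀ hz₀ (η := η)).trans hA₀.ge)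
  have hG := l2NormSq_nonneg (U := U) g
  have hV : 0 ≤ volume.real U := measureReal_nonneg
  -- The sum of the two bounds of `h1NormSq_le_of_AT_le`, so that one constant serves both
  -- components.
  obtain ⟨K, hK⟩ : ∃ K : ℝ, K = 2 * l2NormSq U g + 4 * A₀ + 2 * A₀ / η +
      (2 * volume.real U + 8 * ε * A₀ + A₀ / ε) := ⟨_, rfl⟩
  have hKu : 0 ≤ 2 * l2NormSq U g + 4 * A₀ + 2 * A₀ / η := by positivity
  have hKz : 0 ≤ 2 * volume.real U + 8 * ε * A₀ + A₀ / ε := by positivity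
  have hTK : 0 ≤ T * K := mul_nonneg hT.le (by linarith)
  -- `2 * A₀` covers the supremum plus the dissipation, `K` the `H¹` norms at each time, and `T * K
  -- + A₀` the norms in `H¹(0, T; L²)`.
  refine ⟨2 * A₀ + K + T * K, fun N a b hab => ?_⟩
  have hmem : ∀ c : Fin N → ℝ, MemH1 U (comb e N c) := fun c =>
    (MemH1.comb hU.isOpen hUv he.memH1 N c).1
  have hP : ∀ t ∈ Icc 0 T,
      projGradNormSq U e N (AT U ε η φ g) (comb e N (a t)) (comb e N (b t))
        = l2NormSq U (timeDeriv e N T a t) + l2NormSq U (timeDeriv e N T b t) := fun t ht => by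
    rw [he.projGradNormSq_eq hU hε hη hφ hg (a t, b t),
      he.l2NormSq_timeDeriv_fst hT hU hε hφ hg hab ht,
      he.l2NormSq_timeDeriv_snd hT hU hε hφ hg hab ht]
  have hE : ∀ t ∈ Icc 0 T, HasDerivWithinAt
      (fun s => AT U ε η φ g (comb e N (a s)) (comb e N (b s)))
      (-(l2NormSq U (timeDeriv e N T a t) + l2NormSq U (timeDeriv e N T b t))) (Icc 0 T) t :=
    fun t ht => hP t ht ▸ he.hasDerivWithinAt_AT_galerkin hU hε hη hφ hg hab ht
  obtain ⟨hQ, hid, hmax⟩ := energy_dissipation hT hE fun t _ =>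
    add_nonneg (l2NormSq_nonneg _) (l2NormSq_nonneg _)
  -- `hQ` concerns only the sum of the two dissipation terms; each of them is nonnegative,
  -- measurable and dominated by that sum.
  have hQa : IntervalIntegrable (fun t => l2NormSq U (timeDeriv e N T a t)) volume 0 T := by
    have := intervalIntegrable_sum_sq_derivWithin (a := a) hT hQ fun t _ => by
      rw [timeDeriv, he.l2NormSq_comb]
      exact le_add_of_nonneg_right (l2NormSq_nonneg _)
    simpa only [timeDeriv, he.l2NormSq_comb] using this
  have hQb : IntervalIntegrable (fun t => l2NormSq U (timeDeriv e N T b t)) volume 0 T := by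
    have := intervalIntegrable_sum_sq_derivWithin (a := b) hT hQ fun t _ => by
      rw [timeDeriv, timeDeriv, he.l2NormSq_comb (fun i => derivWithin (fun s => b s i) _ _)]
      exact le_add_of_nonneg_left (l2NormSq_nonneg _)
    simpa only [timeDeriv, he.l2NormSq_comb] using this
  -- `AT_le` is applied to the projected data, and Bessel's inequalities replace their norms by
  -- those of `u₀` and `z₀`.
  have hinit : AT U ε η φ g (comb e N (a 0)) (comb e N (b 0)) ≤ A₀ := by
    have h1 := AT_le (η := η) hUv hε hφ hg (hmem (a 0)) (hmem (b 0))
    rw [hab.init_u, hab.init_z] at h1 ⊢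
    have hη4 : 0 ≤ η + 4 := by positivity
    have h2 := he.l2NormSq_proj_le N hu₀.1
    have h3 := he.l2NormSq_proj_le N hz₀.1
    have h4 := he.dirichletForm_proj_le hU.isOpen hUv N hu₀
    have h5 := he.dirichletForm_proj_le hU.isOpen hUv N hz₀
    refine h1.trans (hA₀ ▸ ?_)
    gcongr
  have hAt : ∀ t ∈ Icc 0 T, AT U ε η φ g (comb e N (a t)) (comb e N (b t)) ≤ A₀ := fun t ht =>
    (hmax.2 ⟨t, ht, rfl⟩).trans hinit
  have hbd : ∀ t ∈ Icc 0 T, h1NormSq U (comb e N (a t)) ≤ K ∧ h1NormSq U (comb e N (b t)) ≤ K :=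
    fun t ht => by
      have h := h1NormSq_le_of_AT_le hUv hε hη hφ hg (hmem (a t)) (hmem (b t)) (hAt t ht)
      exact ⟨by linarith [h.1], by linarith [h.2]⟩
  have hTmem : T ∈ Icc 0 T := ⟨hT.le, le_rfl⟩
  -- The total dissipation is the initial energy minus the final one, which is nonnegative.
  have hQle : ∫ t in (0 : ℝ)..T,
      (l2NormSq U (timeDeriv e N T a t) + l2NormSq U (timeDeriv e N T b t)) ≤ A₀ := by
    have h1 := hid T hTmem
    have h2 : 0 ≤ AT U ε η φ g (comb e N (a T)) (comb e N (b T)) := AT_nonneg hε hη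
    linarith
  have hQsum := intervalIntegral.integral_add hQa hQb
  have hQa0 : 0 ≤ ∫ t in (0 : ℝ)..T, l2NormSq U (timeDeriv e N T a t) :=
    intervalIntegral.integral_nonneg hT.le fun t _ => l2NormSq_nonneg _
  have hQb0 : 0 ≤ ∫ t in (0 : ℝ)..T, l2NormSq U (timeDeriv e N T b t) :=
    intervalIntegral.integral_nonneg hT.le fun t _ => l2NormSq_nonneg _
  have hPint : EqOn
      (fun t => l2NormSq U (timeDeriv e N T a t) + l2NormSq U (timeDeriv e N T b t))
      (fun t => projGradNormSq U e N (AT U ε η φ g) (comb e N (a t)) (comb e N (b t)))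
      (uIcc 0 T) := fun t ht => (hP t (uIcc_of_le hT.le ▸ ht)).symm
  have hca : IntervalIntegrable (fun t => l2NormSq U (comb e N (a t))) volume 0 T := by
    refine ContinuousOn.intervalIntegrable (he.continuousOn_l2NormSq_comb fun i t ht => ?_)
    rw [uIcc_of_le hT.le] at ht ⊢
    exact (hab.eq_u t ht i).continuousWithinAt
  have hcb : IntervalIntegrable (fun t => l2NormSq U (comb e N (b t))) volume 0 T := by
    refine ContinuousOn.intervalIntegrable (he.continuousOn_l2NormSq_comb fun i t ht => ?_)
    rw [uIcc_of_le hT.le] at ht ⊢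
    exact (hab.eq_z t ht i).continuousWithinAt
  refine ⟨fun t _ c d => ?_, fun t ht => ⟨?_, hP t ht⟩, hQa, hQb, ?_, fun t ht => ?_,
    ⟨_, hmax.isLUB, ?_, ?_⟩, fun t ht => ?_, hca, hcb, ?_, ?_⟩
  · have h := he.hasDerivAt_AT_line hU hε hη hφ hg (a t, b t) (c, d)
    rwa [← he.l2Inner_comb_comb, ← he.l2Inner_comb_comb,
      ← he.projGradFst_eq hU hε hη hφ hg, ← he.projGradSnd_eq hU hε hη hφ hg] at h
  · exact he.hasDerivWithinAt_AT_galerkin hU hε hη hφ hg hab ht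
  · exact (intervalIntegrable_congr (hPint.mono uIoc_subset_uIcc)).1 hQ
  · rw [← hab.init_u, ← hab.init_z]
    exact hid t ht
  · rw [intervalIntegral.integral_congr hPint]
  · linarith
  · obtain ⟨h1, h2⟩ := hbd t ht
    exact ⟨hmem _, by linarith, hmem _, by linarith⟩
  · refine (integral_add_le_of_le hT.le hca hQa (K := K) (B := A₀) (fun t ht =>
      (l2NormSq_le_h1NormSq _ _).trans (hbd t ht).1) ?_).trans (by linarith)
    linarith
  · refine (integral_add_le_of_le hT.le hcb hQb (K := K) (B := A₀) (fun t ht =>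
      (l2NormSq_le_h1NormSq _ _).trans (hbd t ht).2) ?_).trans (by linarith)
    linarith
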